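/- \textbf{Theorem.} There are a randomized word-RAM program $P$ and constants $c\ge 1$ and $C$ such that the following holds for every $n$ and every connected undirected unweighted graph $G=(V,E)$ on $V=\{0,\dots,n-1\}$, given to $P$ by its adjacency matrix, when $P$ is run with words of $c\,(\lfloor\log_2 n\rfloor+1)$ bits. Let $D$ be the diameter of $G$. (1) The expected number of steps of $P$ on $G$ is at most $C\,n^2\log (n+1)$; thus $P$ runs in expected time $O(n^2\log n)$ and halts with probability $1$. (2) Every value $\hat D$ that $P$ returns on $G$ with positive probability satisfies $\hat D\le D$ and, if $D=3h+z$ with $h\ge 0$ an integer and $z\in\{0,1,2\}$, $$\hat D\ \ge\ \begin{cases}2h-1 & \text{if } z\in\{0,1\},\\ 2h & \text{if } z=2.\end{cases}$$ (3) Every such $\hat D$ is obtained in the following way from some set of centers and some spanner. There are a nonempty set $A\subseteq V$ and a subgraph $H$ of $G$ on the vertex set $V$ such that, with the bunches $B_A(u)=\{v\in V: d(u,v)<d(u,A)\}$ and the clusters $C_A(w)=\{v\in V: w\in B_A(v)\}$, where $d$ is the distance in $G$ and $d(u,A)=\min_{a\in A}d(u,a)$, \begin{itemize} \item $|C_A(w)|\le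 4\sqrt n$ for all $w\in V$ and $|B_A(v)|\le C\sqrt n$ for all $v\in V$; \item $H$ is an additive $2$-spanner of $G$: $d_H(u,v)\le d(u,v)+2$ for all $u,v\in V$; \item $\hat D=\max(D_1,D_2-2)$, where $D_1=\max_{u,v\in V}M(u,v)$ and $D_2=\max_{u\in A}\max_{v\in V}d_H(u,v)$. \end{itemize} Here $M(u,u)=0$; and for $u\ne v$, with $m(u,v)$ the minimum of $n$ and of all $d(u,w)+d(v,w)$ such that $u,v\in C_A(w)$, one has $M(u,v)=m(u,v)$ if $m(u,v)\neq n$ and $M(u,v)=d(u,A)+d(v,A)-1$ if $m(u,v)=n$. -/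

import Mathlib

/-! ### A randomized word RAM -/

/-- Binary word operations. -/
inductive BinOp where
  | add | sub | mul | div | mod | lt | eq

/-- The value of an operation on naturals, before it is reduced to a machine word.
Subtraction is truncated at `0`, and a comparison yields `1` (true) or `0` (false). -/
def BinOp.eval : BinOp → ℕ → ℕ → ℕ
  | .add, a, b => a + b
  | .sub, a, b => a - b
  | .mul, a, b => a * b
  | .div, a, b => a / b
  | .mod, a, b => a % b
  | .lt, a, b => if a < b then 1 else 0
  | .eq, a, b => if a = b then 1 else 0

/-- Programs of the word RAM. Registers and arrays are named by fixed numbers, so that a program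
uses finitely many of either. Every primitive acts on single words. -/
inductive Prog where
  /-- `x := k` -/
  | const (x k : ℕ)
  /-- `x := y op z`, for registers `x`, `y`, `z` -/
  | op (o : BinOp) (x y z : ℕ)
  /-- `x := a[y]`, for registers `x`, `y` and an array `a` -/
  | load (x a y : ℕ)
  /-- `a[y] := z`, for registers `y`, `z` and an array `a` -/
  | store (a y z : ℕ)
  /-- `x := ` a uniformly random element of `{0, …, y}`, for registers `x`, `y` -/
  | rand (x y : ℕ)
  /-- first `p`, then `q` -/
  | seq (p q : Prog)
  /-- if register `x` is nonzero then `p` else `q` -/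
  | ite (x : ℕ) (p q : Prog)
  /-- while register `x` is nonzero do `p` -/
  | loop (x : ℕ) (p : Prog)

/-- The contents of the registers and of the arrays. -/
structure Store where
  reg : ℕ → ℕ
  arr : ℕ → ℕ → ℕ

/-- The store in which register `x` has been set to `v`. -/
def Store.setReg (s : Store) (x v : ℕ) : Store :=
  { s with reg := Function.update s.reg x v }

/-- The store in which the entry `i` of array `a` has been set to `v`. -/
def Store.setArr (s : Store) (a i v : ℕ) : Store :=
  { s with arr := Function.update s.arr a (Function.update (s.arr a) i v) }

/-- A configuration: the program parts that remain to be executed, in order, and the store. -/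
structure Config where
  todo : List Prog
  store : Store

/-- The machine has halted when nothing remains to be executed. -/
def Config.Halted (c : Config) : Prop := c.todo = []

/-- One step of the machine with words of `w` bits. Every executed primitive, every test of a
condition and every unfolding of a sequential composition is one step. -/
noncomputable def step (w : ℕ) : Config → PMF Config
  | ⟨[], s⟩ => PMF.pure ⟨[], s⟩
  | ⟨.const x k :: r, s⟩ => PMF.pure ⟨r, s.setReg x (k % 2 ^ w)⟩
  | ⟨.op o x y z :: r, s⟩ => PMF.pure ⟨r, s.setReg x (o.eval (s.reg y) (s.reg z) % 2 ^ w)⟩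
  | ⟨.load x a y :: r, s⟩ => PMF.pure ⟨r, s.setReg x (s.arr a (s.reg y))⟩
  | ⟨.store a y z :: r, s⟩ => PMF.pure ⟨r, s.setArr a (s.reg y) (s.reg z)⟩
  | ⟨.rand x y :: r, s⟩ =>
      (PMF.uniformOfFintype (Fin (s.reg y + 1))).map fun v => ⟨r, s.setReg x v.val⟩
  | ⟨.seq p q :: r, s⟩ => PMF.pure ⟨p :: q :: r, s⟩
  | ⟨.ite x p q :: r, s⟩ => PMF.pure ⟨(if s.reg x ≠ 0 then p else q) :: r, s⟩
  | ⟨.loop x p :: r, s⟩ => PMF.pure ⟨if s.reg x ≠ 0 then p :: .loop x p :: r else r, s⟩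

/-- The distribution of the configuration after `t` steps. -/
noncomputable def runDist (w : ℕ) : ℕ → Config → PMF Config
  | 0, c => PMF.pure c
  | t + 1, c => (step w c).bind (runDist w t)

/-- The expected number `E[T] = ∑ₜ Pr[T > t]` of steps until `p`, started on the store `s`,
halts; it is `∞` if `p` fails to halt with positive probability. -/
noncomputable def expectedTime (w : ℕ) (p : Prog) (s : Store) : ENNReal :=
  ∑' t : ℕ, (runDist w t ⟨[p], s⟩).toOuterMeasure {c | ¬ c.Halted}

/-- Some run of `p` of positive probability, started on `s`, halts with `v` in register `0`. -/
def CanReturn (w : ℕ) (p : Prog) (s : Store) (v : ℕ) : Prop :=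
  ∃ (t : ℕ) (c : Config), c ∈ (runDist w t ⟨[p], s⟩).support ∧ c.Halted ∧ c.store.reg 0 = v

open Classical in
/-- The initial store for a graph on `{0, …, n - 1}`: register `0` holds `n`, array `0` holds the
adjacency matrix row by row, and everything else is `0`. -/
noncomputable def graphInput {n : ℕ} (G : SimpleGraph (Fin n)) : Store where
  reg x := if x = 0 then n else 0
  arr a i := if a = 0 ∧ ∃ u v : Fin n, G.Adj u v ∧ i = u * n + v then 1 else 0

/-! ### Bunches, clusters, spanners and the diameter estimate -/

section Estimate

variable {V : Type*}

/-- The distance `d(u, A)` from `u` to the (nonempty) set `A`. -/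
noncomputable def distToSet (G : SimpleGraph V) (A : Set V) (u : V) : ℕ :=
  sInf (G.dist u '' A)

/-- The bunch `B_A(u)`. -/
def bunch (G : SimpleGraph V) (A : Set V) (u : V) : Set V :=
  {v | G.dist u v < distToSet G A u}

/-- The cluster `C_A(w)`; it is empty for `w ∈ A`. -/
def cluster (G : SimpleGraph V) (A : Set V) (w : V) : Set V :=
  {v | w ∈ bunch G A v}

/-- A nonempty set of centers all whose clusters have at most `4√n` vertices and all whose bunches
have at most `C√n` vertices, where `n` is the number of vertices. -/
def IsCenterSet (C : ℝ) (G : SimpleGraph V) (A : Set V) : Prop :=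
  A.Nonempty ∧ (∀ w, ((cluster G A w).ncard : ℝ) ≤ 4 * √(Nat.card V)) ∧
    ∀ v, ((bunch G A v).ncard : ℝ) ≤ C * √(Nat.card V)

/-- `H` is an additive `k`-spanner of `G`. -/
def IsAdditiveSpanner (k : ℕ) (G H : SimpleGraph V) : Prop :=
  H ≤ G ∧ ∀ u v, H.edist u v ≤ G.edist u v + k

/-- The entry `(u, v)` of the matrix after the first stage: the minimum of `n` and of all
`d(u, w) + d(v, w)` for which `u` and `v` lie in the cluster of `w`. -/
noncomputable def clusterEntry (G : SimpleGraph V) (A : Set V) (u v : V) : ℕ :=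
  sInf (insert (Nat.card V)
    {k | ∃ w, u ∈ cluster G A w ∧ v ∈ cluster G A w ∧ k = G.dist u w + G.dist v w})

open Classical in
/-- The entry `M(u, v)` of the final matrix: off the diagonal, the entries that still equal `n`
have been replaced by `d(u, A) + d(v, A) - 1`. -/
noncomputable def matrixEntry (G : SimpleGraph V) (A : Set V) (u v : V) : ℤ :=
  if u = v then 0
  else if clusterEntry G A u v = Nat.card V then
    (distToSet G A u : ℤ) + distToSet G A v - 1
  else clusterEntry G A u v

/-- The estimate `max (D₁, D₂ - 2)`, where `D₁` is the largest entry of the matrix and `D₂` is the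
largest eccentricity in `H` of a center. -/
noncomputable def diamEstimate (G H : SimpleGraph V) (A : Set V) : ℤ :=
  max (⨆ p : V × V, matrixEntry G A p.1 p.2) ((⨆ u : A, ((H.eccent u).toNat : ℤ)) - 2)

end Estimate

/-! The bounds for the estimate are purely metric. If a vertex `w` lies in the bunches of both `u`
and `v`, then `d(u,v) + 2 ≤ d(u,A) + d(v,A)`; conversely, under this inequality a shortest path from
`u` to `v` contains such a `w`. So for `u ≠ v` the matrix entry is the minimum of `d(u,v)` and
`d(u,A) + d(v,A) - 1` (`matrixEntry_eq_min`). In particular it is at most `d(u,v)`, and since the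
spanner error `2` is subtracted from `D₂`, the estimate `k` is at most the diameter `D`. For the
lower bound let `d(x,y) = D`. The path from `x` through its nearest center to `y` gives `D ≤ d(x,A)
+ k + 2`, and the same holds with `y` in place of `x`. As the entry at `(x,y)` is at most `k`,
either `D ≤ k` or `2(D - k - 2) - 1 ≤ k`. Both imply `3k ≥ 2D - 5`, and rounding gives the claim
(`le_diamEstimate`).

It remains to construct `A` and `H` in time `O(n² log n)`. This is done deterministically: the
program draws no random numbers, so the statements about expectation and possible outputs reduce to
a single run. Let `s` be about `√n` and `2^L` about `n`.

Centers. A breadth-first search that is cut off at `s` vertices, and at `s` scanned neighbours of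
each, lists the `s` vertices closest to `v` in `O(s²) = O(n)` steps. If `A` meets every list, the
first center in a list is a nearest one, and the bunch of `v` lies before it. To keep clusters small
as well, centers are chosen greedily with respect to a potential: the number of lists without a
center, plus the number of list positions before the first center that hold a vertex with a large
cluster. An averaging argument and the Cauchy-Schwarz inequality show that the best vertex removes
at least the fraction `1/(2s)` of the potential (`potential_le_of_gain_le`,
`potential_add_gain_le`). Hence `O(s log n)` rounds of `O(ns)` steps bring it to `0`, and `A` has
`O(s log n)` elements.

Spanner. The threshold `th` is halved from at least `n` down to `s`. At each level, vertices with at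
least `th` unmarked neighbours become cluster centers and their neighbours are marked, so there are
at most `n/th` of them. Search trees of these centers in the old unmarked part, which has `O(n·th)`
edges, are added to `H`; one level takes `O(n²)` steps. A shortest path that meets a newly marked
vertex is replaced by a detour through the adjacent cluster center at an extra cost of `2`
(`spanner_step`). The last unmarked part is added as a whole, which leaves `O(ns)` edges, so the
searches in `H` from all of `A` take `O(s log n · ns) = O(n² log n)` steps.

Machine. The algorithm is written in a small language with bounded loops. A `Spec` records absence
of overflow, a time bound and a postcondition, and `Cmd.code_correct` transfers it to the word RAM.
-/

/-! ### Deterministic runs -/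

/-- The machine goes from `c` to `c'` in exactly `t` steps, with certainty. -/
def Runs (w t : ℕ) (c c' : Config) : Prop := runDist w t c = PMF.pure c'

theorem runDist_add (w a b : ℕ) (c : Config) :
    runDist w (a + b) c = (runDist w a c).bind (runDist w b) := by
  induction a generalizing c with
  | zero => simp [runDist]
  | succ a ih =>
    rw [Nat.succ_add]
    simp only [runDist, PMF.bind_bind]
    congr 1
    funext c'
    exact ih c'

theorem Runs.trans {w a b : ℕ} {c c' c'' : Config} (h : Runs w a c c') (h' : Runs w b c' c'') :
    Runs w (a + b) c c'' := by
  rw [Runs, runDist_add, h, PMF.pure_bind, h']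

theorem Runs.of_step {w : ℕ} {c c' : Config} (h : step w c = PMF.pure c') : Runs w 1 c c' := by
  simp [Runs, runDist, h]

theorem Runs.of_halted {w : ℕ} {c : Config} (h : c.Halted) (t : ℕ) : Runs w t c c := by
  obtain ⟨l, s⟩ := c
  obtain rfl : l = [] := h
  induction t with
  | zero => rfl
  | succ t ih => simpa [Runs, runDist, step] using ih

/-- A halted configuration is fixed by `step`, so the tail probabilities vanish from time `T` on;
each of the `T` earlier ones is at most `1`. -/
theorem expectedTime_le_of_runs {w T : ℕ} {p : Prog} {s s' : Store}
    (h : Runs w T ⟨[p], s⟩ ⟨[], s'⟩) : expectedTime w p s ≤ T := by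
  classical
  have hz : ∀ t ∉ Finset.range T,
      (runDist w t ⟨[p], s⟩).toOuterMeasure {c | ¬ c.Halted} = 0 := by
    intro t ht
    obtain ⟨k, rfl⟩ := Nat.exists_eq_add_of_le (not_lt.1 (fun hh => ht (Finset.mem_range.2 hh)))
    have := h.trans (Runs.of_halted (w := w) (c := ⟨[], s'⟩) rfl k)
    rw [this, PMF.toOuterMeasure_pure_apply]
    simp [Config.Halted]
  rw [expectedTime, tsum_eq_sum hz]
  calc _ ≤ ∑ t ∈ Finset.range T, (1 : ENNReal) := by
        refine Finset.sum_le_sum fun t _ => ?_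
        rw [PMF.toOuterMeasure_apply]
        exact (ENNReal.tsum_le_tsum fun c => Set.indicator_le_self _ _ c).trans
          (PMF.tsum_coe _).le
    _ = T := by simp

/-- A halted outcome at time `t` is still present at time `t + T`, when the distribution is already
concentrated on the final configuration of the certain run. -/
theorem CanReturn.eq_of_runs {w T v : ℕ} {p : Prog} {s s' : Store}
    (h : Runs w T ⟨[p], s⟩ ⟨[], s'⟩) (hv : CanReturn w p s v) : s'.reg 0 = v := by
  obtain ⟨t, c, hc, hh, rfl⟩ := hv
  have h1 : runDist w (t + T) ⟨[p], s⟩ = PMF.pure ⟨[], s'⟩ := by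
    rw [Nat.add_comm]
    exact h.trans (Runs.of_halted (c := ⟨[], s'⟩) rfl t)
  have h2 : c ∈ (runDist w (t + T) ⟨[p], s⟩).support := by
    rw [runDist_add, PMF.mem_support_bind_iff]
    refine ⟨c, hc, ?_⟩
    rw [show runDist w T c = PMF.pure c from Runs.of_halted hh T]
    simp
  rw [h1] at h2
  simp at h2
  rw [h2]

/-! ### A structured language with bounded loops -/

/-- Expressions: literals, variables, array reads and word operations. -/
inductive Ex where
  | lit (k : ℕ)
  | var (x : ℕ)
  | get (a : ℕ) (e : Ex)
  | bin (o : BinOp) (e f : Ex)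

/-- The result of the operation is certain to fit into a word below `N`. -/
def BinOp.Fits (N : ℕ) : BinOp → ℕ → ℕ → Prop
  | .add, a, b => a + b < N
  | .mul, a, b => a * b < N
  | _, _, _ => True

namespace Ex

/-- The value of an expression. -/
def eval (s : Store) : Ex → ℕ
  | lit k => k
  | var x => s.reg x
  | get a e => s.arr a (e.eval s)
  | bin o e f => o.eval (e.eval s) (f.eval s)

/-- No overflow occurs when the expression is evaluated with words below `N`. -/
def ok (N : ℕ) (s : Store) : Ex → Prop
  | lit k => k < N
  | var _ => True
  | get _ e => e.ok N s
  | bin o e f => e.ok N s ∧ f.ok N s ∧ o.Fits N (e.eval s) (f.eval s)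

/-- The number of machine steps for the evaluation. -/
def size : Ex → ℕ
  | lit _ => 1
  | var _ => 3
  | get _ e => e.size + 2
  | bin _ e f => e.size + f.size + 3

/-- Code that puts the value into the temporary register `2 * k + 1`. -/
def code (k : ℕ) : Ex → Prog
  | lit c => .const (2 * k + 1) c
  | var x => .seq (.const (2 * k + 1) 0) (.op .add (2 * k + 1) (2 * x) (2 * k + 1))
  | get a e => .seq (e.code k) (.load (2 * k + 1) a (2 * k + 1))
  | bin o e f => .seq (e.code k) (.seq (f.code (k + 1))
      (.op o (2 * k + 1) (2 * k + 1) (2 * (k + 1) + 1)))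

end Ex

/-- Commands. -/
inductive Cmd where
  | skip
  | assign (x : ℕ) (e : Ex)
  | put (a : ℕ) (e f : Ex)
  | seq (c d : Cmd)
  | ite (e : Ex) (c d : Cmd)
  | loop (x : ℕ) (e : Ex) (c : Cmd)

/-- Run `f` with `x = 0, …, m - 1` in turn. -/
def iterStore (x : ℕ) (f : Store → Store) : ℕ → Store → Store
  | 0, s => s
  | m + 1, s => f ((iterStore x f m s).setReg x m)

namespace Cmd

/-- The final store. -/
def den : Cmd → Store → Store
  | skip, s => s
  | assign x e, s => s.setReg x (e.eval s)
  | put a e f, s => s.setArr a (e.eval s) (f.eval s)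
  | seq c d, s => d.den (c.den s)
  | ite e c d, s => if e.eval s ≠ 0 then c.den s else d.den s
  | loop x e c, s => iterStore x c.den (e.eval s) s

/-- The number of machine steps. -/
def cost : Cmd → Store → ℕ
  | skip, _ => 1
  | assign _ e, _ => e.size + 4
  | put _ e f, _ => e.size + f.size + 3
  | seq c d, s => c.cost s + d.cost (c.den s) + 1
  | ite e c d, s => e.size + 2 + if e.eval s ≠ 0 then c.cost s else d.cost s
  | loop x e c, s => e.size + 6 +
      ∑ i ∈ Finset.range (e.eval s), (c.cost ((iterStore x c.den i s).setReg x i) + 11)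

/-- No overflow occurs with words below `N`. -/
def ok (N : ℕ) : Cmd → Store → Prop
  | skip, _ => True
  | assign _ e, s => e.ok N s
  | put _ e f, s => e.ok N s ∧ f.ok N s
  | seq c d, s => c.ok N s ∧ d.ok N (c.den s)
  | ite e c d, s => e.ok N s ∧ if e.eval s ≠ 0 then c.ok N s else d.ok N s
  | loop x e c, s => e.ok N s ∧
      ∀ i < e.eval s, c.ok N ((iterStore x c.den i s).setReg x i)

/-- The body of the machine loop for a bounded loop. -/
def loopCode (k x : ℕ) (p : Prog) : Prog :=
  .seq (.const (2 * (k + 3) + 1) 0)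
    (.seq (.op .add (2 * x) (2 * (k + 1) + 1) (2 * (k + 3) + 1))
      (.seq p (.seq (.const (2 * (k + 3) + 1) 1)
        (.seq (.op .add (2 * (k + 1) + 1) (2 * (k + 1) + 1) (2 * (k + 3) + 1))
          (.op .lt (2 * (k + 2) + 1) (2 * (k + 1) + 1) (2 * k + 1))))))

/-- The machine program, using the temporaries from `k` on. -/
def code (k : ℕ) : Cmd → Prog
  | skip => .const (2 * k + 1) 0
  | assign x e => .seq (e.code k) (.seq (.const (2 * (k + 1) + 1) 0)
      (.op .add (2 * x) (2 * k + 1) (2 * (k + 1) + 1)))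
  | put a e f => .seq (e.code k) (.seq (f.code (k + 1)) (.store a (2 * k + 1) (2 * (k + 1) + 1)))
  | seq c d => .seq (c.code k) (d.code k)
  | ite e c d => .seq (e.code k) (.ite (2 * k + 1) (c.code k) (d.code k))
  | loop x e c => .seq (e.code k) (.seq (.const (2 * (k + 1) + 1) 0)
      (.seq (.op .lt (2 * (k + 2) + 1) (2 * (k + 1) + 1) (2 * k + 1))
        (.loop (2 * (k + 2) + 1) (loopCode k x (c.code (k + 3))))))

end Cmd

/-! ### Correctness of the compilation -/

/-- The machine store `σ` represents `s`: variables are the even registers. -/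
structure Sim (s σ : Store) : Prop where
  reg : ∀ x, σ.reg (2 * x) = s.reg x
  arr : σ.arr = s.arr

/-- All contents are below `N`. -/
structure Bdd (N : ℕ) (s : Store) : Prop where
  reg : ∀ x, s.reg x < N
  arr : ∀ a i, s.arr a i < N

/-- The temporaries below `k` agree. -/
def SameTemps (k : ℕ) (σ σ' : Store) : Prop := ∀ j < k, σ'.reg (2 * j + 1) = σ.reg (2 * j + 1)

@[simp] theorem Store.reg_setReg (s : Store) (x v y : ℕ) :
    (s.setReg x v).reg y = if y = x then v else s.reg y := by
  simp [Store.setReg, Function.update_apply]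

@[simp] theorem Store.arr_setReg (s : Store) (x v : ℕ) : (s.setReg x v).arr = s.arr := rfl

@[simp] theorem Store.reg_setArr (s : Store) (a i v : ℕ) : (s.setArr a i v).reg = s.reg := rfl

theorem Store.arr_setArr_apply (s : Store) (a i v b j : ℕ) :
    (s.setArr a i v).arr b j = if b = a ∧ j = i then v else s.arr b j := by
  simp only [Store.setArr, Function.update_apply]
  by_cases h : b = a
  · subst h
    by_cases h' : j = i <;> simp [h']
  · simp [h]

@[simp] theorem Store.arr_setArr (s : Store) (a i v b : ℕ) :
    (s.setArr a i v).arr b = if b = a then Function.update (s.arr a) i v else s.arr b := by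
  simp only [Store.setArr, Function.update_apply]

theorem SameTemps.trans {k : ℕ} {σ σ' σ'' : Store} (h : SameTemps k σ σ')
    (h' : SameTemps k σ' σ'') : SameTemps k σ σ'' := fun j hj => (h' j hj).trans (h j hj)

theorem SameTemps.mono {k l : ℕ} {σ σ' : Store} (h : SameTemps l σ σ') (hk : k ≤ l) :
    SameTemps k σ σ' := fun j hj => h j (hj.trans_le hk)

theorem SameTemps.setTemp {k j : ℕ} {σ σ' : Store} (h : SameTemps k σ σ') (hj : k ≤ j) (v : ℕ) :
    SameTemps k σ (σ'.setReg (2 * j + 1) v) := by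
  intro i hi
  rw [Store.reg_setReg, if_neg (by omega), h i hi]

theorem SameTemps.setVar {k : ℕ} {σ σ' : Store} (h : SameTemps k σ σ') (x v : ℕ) :
    SameTemps k σ (σ'.setReg (2 * x) v) := by
  intro i hi
  rw [Store.reg_setReg, if_neg (by omega), h i hi]

theorem SameTemps.refl (k : ℕ) (σ : Store) : SameTemps k σ σ := fun _ _ => rfl

theorem Sim.setTemp {s σ : Store} (h : Sim s σ) (k v : ℕ) : Sim s (σ.setReg (2 * k + 1) v) :=
  ⟨fun x => by rw [Store.reg_setReg, if_neg (by omega), h.reg], by simp [h.arr]⟩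

theorem Sim.setVar {s σ : Store} (h : Sim s σ) (x v : ℕ) :
    Sim (s.setReg x v) (σ.setReg (2 * x) v) :=
  ⟨fun y => by simp [h.reg], by simp [h.arr]⟩

theorem Sim.setArr {s σ : Store} (h : Sim s σ) (a i v : ℕ) :
    Sim (s.setArr a i v) (σ.setArr a i v) :=
  ⟨fun y => by simp [h.reg], by funext b j; simp [h.arr, Store.arr_setArr_apply]⟩

theorem Bdd.setReg {N : ℕ} {s : Store} (h : Bdd N s) {x v : ℕ} (hv : v < N) :
    Bdd N (s.setReg x v) :=
  ⟨fun y => by rw [Store.reg_setReg]; split_ifs; exacts [hv, h.reg y], h.arr⟩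

theorem Bdd.setArr {N : ℕ} {s : Store} (h : Bdd N s) {a i v : ℕ} (hv : v < N) :
    Bdd N (s.setArr a i v) :=
  ⟨h.reg, fun b j => by rw [Store.arr_setArr_apply]; split_ifs; exacts [hv, h.arr b j]⟩

theorem BinOp.eval_lt {N : ℕ} (hN : 1 < N) {o : BinOp} {a b : ℕ} (ha : a < N)
    (h : o.Fits N a b) : o.eval a b < N := by
  cases o
  · exact h
  · exact (Nat.sub_le a b).trans_lt ha
  · exact h
  · exact (Nat.div_le_self a b).trans_lt ha
  · exact (Nat.mod_le a b).trans_lt ha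
  · simp only [BinOp.eval]; split_ifs <;> omega
  · simp only [BinOp.eval]; split_ifs <;> omega

theorem Ex.eval_lt {N : ℕ} (hN : 1 < N) {s : Store} (hs : Bdd N s) (e : Ex) (h : e.ok N s) :
    e.eval s < N := by
  induction e with
  | lit k => exact h
  | var x => exact hs.reg x
  | get a e ih => exact hs.arr _ _
  | bin o e f ihe ihf => exact BinOp.eval_lt hN (ihe h.1) h.2.2

theorem runs_const (w x k : ℕ) (r : List Prog) (s : Store) (hk : k < 2 ^ w) :
    Runs w 1 ⟨.const x k :: r, s⟩ ⟨r, s.setReg x k⟩ :=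
  Runs.of_step (by rw [step, Nat.mod_eq_of_lt hk])

theorem runs_op (w : ℕ) (o : BinOp) (x y z : ℕ) (r : List Prog) (s : Store)
    (h : o.eval (s.reg y) (s.reg z) < 2 ^ w) :
    Runs w 1 ⟨.op o x y z :: r, s⟩ ⟨r, s.setReg x (o.eval (s.reg y) (s.reg z))⟩ :=
  Runs.of_step (by rw [step, Nat.mod_eq_of_lt h])

theorem runs_seq (w : ℕ) (p q : Prog) (r : List Prog) (s : Store) :
    Runs w 1 ⟨.seq p q :: r, s⟩ ⟨p :: q :: r, s⟩ := Runs.of_step rfl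

theorem Runs.cast {w t t' : ℕ} {c c' : Config} (h : Runs w t c c') (e : t = t') :
    Runs w t' c c' := e ▸ h

/-- The temporaries act as a stack: code generated at level `k` leaves those below `k` alone, so the
left operand in slot `k` survives the evaluation of the right one at level `k + 1`. -/
theorem Ex.code_correct {w : ℕ} (hN : 1 < 2 ^ w) {s : Store} (hs : Bdd (2 ^ w) s) (e : Ex)
    (h : e.ok (2 ^ w) s) (k : ℕ) (σ : Store) (hσ : Sim s σ) (r : List Prog) :
    ∃ σ', Runs w e.size ⟨e.code k :: r, σ⟩ ⟨r, σ'⟩ ∧ Sim s σ' ∧ SameTemps k σ σ' ∧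
      σ'.reg (2 * k + 1) = e.eval s := by
  induction e generalizing k σ r with
  | lit c =>
    exact ⟨_, runs_const _ _ _ _ _ h, hσ.setTemp _ _, (SameTemps.refl k σ).setTemp le_rfl _,
      by simp [Ex.eval]⟩
  | var x =>
    refine ⟨_, ((runs_seq _ _ _ _ _).trans ((runs_const _ _ _ _ _ (by omega)).trans
      (runs_op _ _ _ _ _ _ _ ?_))).cast rfl, ((hσ.setTemp _ _).setTemp _ _),
      (((SameTemps.refl k σ).setTemp le_rfl _).setTemp le_rfl _), ?_⟩
    · have : 2 * x ≠ 2 * k + 1 := by omega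
      simpa [BinOp.eval, this, hσ.reg] using hs.reg x
    · have : 2 * x ≠ 2 * k + 1 := by omega
      simp [BinOp.eval, this, hσ.reg, Ex.eval]
  | get a e ih =>
    obtain ⟨σ', h1, h2, h3, h4⟩ := ih h k σ hσ (.load (2 * k + 1) a (2 * k + 1) :: r)
    refine ⟨_, ((runs_seq _ _ _ _ _).trans (h1.trans (Runs.of_step rfl))).cast
      (by simp only [Ex.size]; omega), h2.setTemp _ _, h3.setTemp le_rfl _, ?_⟩
    simp [Ex.eval, h4, h2.arr]
  | bin o e f ihe ihf =>
    obtain ⟨σ', h1, h2, h3, h4⟩ := ihe h.1 k σ hσ (.seq (f.code (k + 1))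
      (.op o (2 * k + 1) (2 * k + 1) (2 * (k + 1) + 1)) :: r)
    obtain ⟨σ'', g1, g2, g3, g4⟩ := ihf h.2.1 (k + 1) σ' h2
      (.op o (2 * k + 1) (2 * k + 1) (2 * (k + 1) + 1) :: r)
    have h5 : σ''.reg (2 * k + 1) = e.eval s := by rw [g3 k (by omega), h4]
    refine ⟨_, ((runs_seq _ _ _ _ _).trans (h1.trans ((runs_seq _ _ _ _ _).trans (g1.trans
      (runs_op _ _ _ _ _ _ _ ?_))))).cast (by simp only [Ex.size]; omega),
      g2.setTemp _ _, (h3.trans (g3.mono (by omega))).setTemp le_rfl _, ?_⟩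
    · rw [h5, g4]
      exact BinOp.eval_lt hN (Ex.eval_lt hN hs e h.1) h.2.2
    · rw [Store.reg_setReg, if_pos rfl, h5, g4, Ex.eval]

theorem iterStore_succ' (x : ℕ) (f : Store → Store) (m : ℕ) (s : Store) :
    iterStore x f (m + 1) s = f ((iterStore x f m s).setReg x m) := rfl

/-- Boundedness of the store is carried through the same induction, since the next command needs it
in order that the reductions modulo `2 ^ w` have no effect. -/
theorem Cmd.code_correct {w : ℕ} (hN : 1 < 2 ^ w) (c : Cmd) (s : Store) (hs : Bdd (2 ^ w) s)
    (h : c.ok (2 ^ w) s) (k : ℕ) (σ : Store) (hσ : Sim s σ) (r : List Prog) :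
    Bdd (2 ^ w) (c.den s) ∧
    ∃ σ', Runs w (c.cost s) ⟨c.code k :: r, σ⟩ ⟨r, σ'⟩ ∧ Sim (c.den s) σ' ∧
      SameTemps k σ σ' := by
  induction c generalizing s k σ r with
  | skip =>
    exact ⟨hs, _, runs_const _ _ _ _ _ (by omega), hσ.setTemp _ _,
      (SameTemps.refl k σ).setTemp le_rfl _⟩
  | assign x e =>
    have he := Ex.eval_lt hN hs e h
    obtain ⟨σ', h1, h2, h3, h4⟩ := Ex.code_correct hN hs e h k σ hσ
      (.seq (.const (2 * (k + 1) + 1) 0) (.op .add (2 * x) (2 * k + 1) (2 * (k + 1) + 1)) :: r)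
    have h5 : BinOp.eval .add ((σ'.setReg (2 * (k + 1) + 1) 0).reg (2 * k + 1))
        ((σ'.setReg (2 * (k + 1) + 1) 0).reg (2 * (k + 1) + 1)) = e.eval s := by
      simp [BinOp.eval, h4]
    refine ⟨hs.setReg he, _, ((runs_seq _ _ _ _ _).trans (h1.trans ((runs_seq _ _ _ _ _).trans
      ((runs_const _ _ _ _ _ (by omega)).trans (runs_op _ _ _ _ _ _ _ ?_))))).cast
      (by simp only [Cmd.cost]; omega), ?_, ?_⟩
    · rwa [h5]
    · rw [h5]
      exact (h2.setTemp _ _).setVar _ _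
    · exact (h3.setTemp (by omega) _).setVar _ _
  | put a e f =>
    obtain ⟨σ', h1, h2, h3, h4⟩ := Ex.code_correct hN hs e h.1 k σ hσ
      (.seq (f.code (k + 1)) (.store a (2 * k + 1) (2 * (k + 1) + 1)) :: r)
    obtain ⟨σ'', g1, g2, g3, g4⟩ := Ex.code_correct hN hs f h.2 (k + 1) σ' h2
      (.store a (2 * k + 1) (2 * (k + 1) + 1) :: r)
    have h5 : σ''.reg (2 * k + 1) = e.eval s := by rw [g3 k (by omega), h4]
    refine ⟨hs.setArr (Ex.eval_lt hN hs f h.2), _, ((runs_seq _ _ _ _ _).trans (h1.trans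
      ((runs_seq _ _ _ _ _).trans (g1.trans (Runs.of_step rfl))))).cast
      (by simp only [Cmd.cost]; omega), ?_, ?_⟩
    · rw [h5, g4]
      exact g2.setArr _ _ _
    · exact h3.trans (g3.mono (by omega))
  | seq c d ihc ihd =>
    obtain ⟨hb, σ', h1, h2, h3⟩ := ihc s hs h.1 k σ hσ (d.code k :: r)
    obtain ⟨hb', σ'', g1, g2, g3⟩ := ihd _ hb h.2 k σ' h2 r
    exact ⟨hb', σ'', ((runs_seq _ _ _ _ _).trans (h1.trans g1)).cast
      (by simp only [Cmd.cost]; omega), g2, h3.trans g3⟩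
  | ite e c d ihc ihd =>
    obtain ⟨σ', h1, h2, h3, h4⟩ := Ex.code_correct hN hs e h.1 k σ hσ
      (.ite (2 * k + 1) (c.code k) (d.code k) :: r)
    have hst : step w ⟨.ite (2 * k + 1) (c.code k) (d.code k) :: r, σ'⟩ =
        PMF.pure ⟨(if e.eval s ≠ 0 then c.code k else d.code k) :: r, σ'⟩ := by
      rw [step, h4]
    have h6 := (runs_seq w (e.code k) (.ite (2 * k + 1) (c.code k) (d.code k)) r σ).trans
      (h1.trans (Runs.of_step hst))
    have hok := h.2
    by_cases hz : e.eval s ≠ 0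
    · rw [if_pos hz] at h6 hok
      obtain ⟨hb, σ'', g1, g2, g3⟩ := ihc s hs hok k σ' h2 r
      simp only [Cmd.den, Cmd.cost, if_pos hz]
      exact ⟨hb, σ'', (h6.trans g1).cast (by omega), g2, h3.trans g3⟩
    · rw [if_neg hz] at h6 hok
      obtain ⟨hb, σ'', g1, g2, g3⟩ := ihd s hs hok k σ' h2 r
      simp only [Cmd.den, Cmd.cost, if_neg hz]
      exact ⟨hb, σ'', (h6.trans g1).cast (by omega), g2, h3.trans g3⟩
  | loop x e c ih =>
    have he := Ex.eval_lt hN hs e h.1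
    obtain ⟨σ', h1, h2, h3, h4⟩ := Ex.code_correct hN hs e h.1 k σ hσ
      (.seq (.const (2 * (k + 1) + 1) 0)
      (.seq (.op .lt (2 * (k + 2) + 1) (2 * (k + 1) + 1) (2 * k + 1))
        (.loop (2 * (k + 2) + 1) (Cmd.loopCode k x (c.code (k + 3))))) :: r)
    set m := e.eval s with hm
    -- Temporaries `k`, `k + 1`, `k + 2` hold the bound, the counter and the outcome of their
    -- comparison. The variable `x` only receives a copy of the counter, so the body may overwrite
    -- it. The 11 extra steps per round are the loop test and the bookkeeping around the body; the
    -- set-up takes 5 steps besides the evaluation of the bound, and the last, failing test is the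
    -- sixth.
    have key : ∀ i ≤ m, Bdd (2 ^ w) (iterStore x c.den i s) ∧ ∃ τ : Store,
        Runs w (e.size + 5 + ∑ j ∈ Finset.range i,
            (c.cost ((iterStore x c.den j s).setReg x j) + 11))
          ⟨(Cmd.loop x e c).code k :: r, σ⟩
          ⟨.loop (2 * (k + 2) + 1) (Cmd.loopCode k x (c.code (k + 3))) :: r, τ⟩ ∧
        Sim (iterStore x c.den i s) τ ∧ SameTemps k σ τ ∧ τ.reg (2 * k + 1) = m ∧
        τ.reg (2 * (k + 1) + 1) = i ∧ τ.reg (2 * (k + 2) + 1) = if i < m then 1 else 0 := by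
      intro i
      induction i with
      | zero =>
        intro _
        refine ⟨hs, _, ((runs_seq _ _ _ _ _).trans (h1.trans ((runs_seq _ _ _ _ _).trans
          ((runs_const _ _ _ _ _ (by omega)).trans ((runs_seq _ _ _ _ _).trans
          (runs_op _ _ _ _ _ _ _ ?_)))))).cast ?_, (h2.setTemp _ _).setTemp _ _,
          (h3.setTemp (by omega) _).setTemp (by omega) _, ?_, ?_, ?_⟩
        · simp only [BinOp.eval]
          split_ifs <;> omega
        · simp only [Finset.range_zero, Finset.sum_empty]
          omega
        · simp [h4]
        · simp
        · simp [h4, BinOp.eval]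
      | succ i ihi =>
        intro hi
        obtain ⟨hb, τ, t1, t2, t3, t4, t5, t6⟩ := ihi (by omega)
        rw [if_pos (by omega)] at t6
        have hst : step w ⟨.loop (2 * (k + 2) + 1) (Cmd.loopCode k x (c.code (k + 3))) :: r, τ⟩ =
            PMF.pure ⟨Cmd.loopCode k x (c.code (k + 3)) ::
              .loop (2 * (k + 2) + 1) (Cmd.loopCode k x (c.code (k + 3))) :: r, τ⟩ := by
          rw [step, t6, if_pos one_ne_zero]
        set R := Prog.loop (2 * (k + 2) + 1) (Cmd.loopCode k x (c.code (k + 3))) :: r with hR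
        have hil : i < 2 ^ w := by omega
        set τ₁ := (τ.setReg (2 * (k + 3) + 1) 0).setReg (2 * x) i with hτ₁
        have hr1 : Runs w 1 ⟨.op .add (2 * x) (2 * (k + 1) + 1) (2 * (k + 3) + 1) ::
            (.seq (c.code (k + 3)) (.seq (.const (2 * (k + 3) + 1) 1)
        (.seq (.op .add (2 * (k + 1) + 1) (2 * (k + 1) + 1) (2 * (k + 3) + 1))
          (.op .lt (2 * (k + 2) + 1) (2 * (k + 1) + 1) (2 * k + 1))))) :: R,
              τ.setReg (2 * (k + 3) + 1) 0⟩ ⟨(.seq (c.code (k + 3)) (.seq (.const (2 * (k + 3) + 1) 1)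
        (.seq (.op .add (2 * (k + 1) + 1) (2 * (k + 1) + 1) (2 * (k + 3) + 1))
          (.op .lt (2 * (k + 2) + 1) (2 * (k + 1) + 1) (2 * k + 1))))) :: R, τ₁⟩ := by
          have := runs_op w .add (2 * x) (2 * (k + 1) + 1) (2 * (k + 3) + 1)
            ((.seq (c.code (k + 3)) (.seq (.const (2 * (k + 3) + 1) 1)
        (.seq (.op .add (2 * (k + 1) + 1) (2 * (k + 1) + 1) (2 * (k + 3) + 1))
          (.op .lt (2 * (k + 2) + 1) (2 * (k + 1) + 1) (2 * k + 1))))) :: R)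
              (τ.setReg (2 * (k + 3) + 1) 0)
          simp only [Store.reg_setReg, BinOp.eval, t5, if_true, add_zero] at this
          rw [if_neg (by omega)] at this
          exact this hil
        have hsim : Sim ((iterStore x c.den i s).setReg x i) τ₁ := (t2.setTemp _ _).setVar _ _
        obtain ⟨hb', τ₂, g1, g2, g3⟩ := ih _ (hb.setReg hil) (h.2 i (by omega)) (k + 3) τ₁ hsim
          ((.seq (.const (2 * (k + 3) + 1) 1)
        (.seq (.op .add (2 * (k + 1) + 1) (2 * (k + 1) + 1) (2 * (k + 3) + 1))
          (.op .lt (2 * (k + 2) + 1) (2 * (k + 1) + 1) (2 * k + 1)))) :: R)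
        have u0 : τ₂.reg (2 * k + 1) = m := by
          rw [g3 k (by omega), hτ₁, Store.reg_setReg, if_neg (by omega), Store.reg_setReg,
            if_neg (by omega), t4]
        have u1 : τ₂.reg (2 * (k + 1) + 1) = i := by
          rw [g3 (k + 1) (by omega), hτ₁, Store.reg_setReg, if_neg (by omega), Store.reg_setReg,
            if_neg (by omega), t5]
        set τ₃ := (τ₂.setReg (2 * (k + 3) + 1) 1).setReg (2 * (k + 1) + 1) (i + 1) with hτ₃
        set τ₄ := τ₃.setReg (2 * (k + 2) + 1) (if i + 1 < m then 1 else 0) with hτ₄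
        have hr2 := runs_op w .add (2 * (k + 1) + 1) (2 * (k + 1) + 1) (2 * (k + 3) + 1)
            (.op .lt (2 * (k + 2) + 1) (2 * (k + 1) + 1) (2 * k + 1) :: R)
            (τ₂.setReg (2 * (k + 3) + 1) 1)
        simp only [Store.reg_setReg, BinOp.eval, if_true] at hr2
        rw [if_neg (by omega), u1] at hr2
        have hr3 := runs_op w .lt (2 * (k + 2) + 1) (2 * (k + 1) + 1) (2 * k + 1) R τ₃
        have e1 : τ₃.reg (2 * (k + 1) + 1) = i + 1 := by simp [hτ₃]
        have e2 : τ₃.reg (2 * k + 1) = m := by simp [hτ₃, u0]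
        simp only [BinOp.eval, e1, e2] at hr3
        refine ⟨hb', τ₄, (t1.trans ((Runs.of_step hst).trans ((runs_seq _ _ _ _ _).trans
          ((runs_const _ _ _ _ _ (by omega)).trans ((runs_seq _ _ _ _ _).trans (hr1.trans
          ((runs_seq _ _ _ _ _).trans (g1.trans ((runs_seq _ _ _ _ _).trans
          ((runs_const _ _ _ _ _ hN).trans ((runs_seq _ _ _ _ _).trans ((hr2 (by omega)).trans
          (hr3 (by split_ifs <;> omega)))))))))))))).cast ?_, ?_, ?_, ?_, ?_, ?_⟩
        · rw [Finset.sum_range_succ]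
          omega
        · exact ((g2.setTemp _ _).setTemp _ _).setTemp _ _
        · refine SameTemps.setTemp (SameTemps.setTemp (SameTemps.setTemp ?_ (by omega) _)
            (by omega) _) (by omega) _
          exact t3.trans ((((SameTemps.refl k τ).setTemp (by omega) _).setVar _ _).trans
            (g3.mono (by omega)))
        · simp [hτ₄, e2]
        · simp [hτ₄, e1]
        · simp [hτ₄]
    obtain ⟨hb, τ, t1, t2, t3, t4, t5, t6⟩ := key m le_rfl
    rw [if_neg (lt_irrefl _)] at t6
    have hst : step w ⟨.loop (2 * (k + 2) + 1) (Cmd.loopCode k x (c.code (k + 3))) :: r, τ⟩ =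
        PMF.pure ⟨r, τ⟩ := by
      rw [step, t6]
      rfl
    refine ⟨hb, τ, (t1.trans (Runs.of_step hst)).cast ?_, t2, t3⟩
    rw [Cmd.cost, ← hm]
    omega

/-! ### Specifications -/

namespace Cmd

/-- The variable `x` may be written. -/
def wr (x : ℕ) : Cmd → Bool
  | skip => false
  | assign y _ => y == x
  | put _ _ _ => false
  | seq c d => c.wr x || d.wr x
  | ite _ c d => c.wr x || d.wr x
  | loop y _ c => y == x || c.wr x

/-- The array `a` may be written. -/
def wa (a : ℕ) : Cmd → Bool
  | skip => false
  | assign _ _ => false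
  | put b _ _ => b == a
  | seq c d => c.wa a || d.wa a
  | ite _ c d => c.wa a || d.wa a
  | loop _ _ c => c.wa a

/-- The command has no loops. -/
def flat : Cmd → Bool
  | seq c d => c.flat && d.flat
  | ite _ c d => c.flat && d.flat
  | loop _ _ _ => false
  | _ => true

/-- A bound for the time of a command without loops. -/
def bound : Cmd → ℕ
  | skip => 1
  | assign _ e => e.size + 4
  | put _ e f => e.size + f.size + 3
  | seq c d => c.bound + d.bound + 1
  | ite e c d => e.size + 2 + max c.bound d.bound
  | loop _ _ _ => 0

theorem cost_le_bound (c : Cmd) (hf : c.flat = true) (s : Store) : c.cost s ≤ c.bound := by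
  induction c generalizing s with
  | skip => exact le_rfl
  | assign x e => exact le_rfl
  | put a e f => exact le_rfl
  | seq c d ihc ihd =>
    simp only [flat, Bool.and_eq_true] at hf
    exact Nat.add_le_add_right (Nat.add_le_add (ihc hf.1 s) (ihd hf.2 _)) 1
  | ite e c d ihc ihd =>
    simp only [flat, Bool.and_eq_true] at hf
    refine Nat.add_le_add_left ?_ _
    split_ifs
    exacts [(ihc hf.1 s).trans (le_max_left _ _), (ihd hf.2 s).trans (le_max_right _ _)]
  | loop x e c _ => simp [flat] at hf

end Cmd

/-- The stores agree on everything that `c` cannot write. -/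
structure Frame (c : Cmd) (s s' : Store) : Prop where
  reg : ∀ x, c.wr x = false → s'.reg x = s.reg x
  arr : ∀ a, c.wa a = false → s'.arr a = s.arr a

theorem Frame.iter {x : ℕ} {e : Ex} {c : Cmd} (hc : ∀ s, Frame c s (c.den s)) (m : ℕ)
    (s : Store) : Frame (.loop x e c) s (iterStore x c.den m s) := by
  induction m with
  | zero => exact ⟨fun _ _ => rfl, fun _ _ => rfl⟩
  | succ m ih =>
    constructor
    · intro y hy
      have h := hy
      simp only [Cmd.wr, Bool.or_eq_false_iff, beq_eq_false_iff_ne] at h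
      rw [iterStore_succ', (hc _).reg y h.2, Store.reg_setReg, if_neg (Ne.symm h.1), ih.reg y hy]
    · intro a ha
      rw [iterStore_succ', (hc _).arr a ha, Store.arr_setReg, ih.arr a ha]

/-- `Cmd.wr` and `Cmd.wa` are computable, so for a concrete program the preservation of a given
register or array reduces to `rfl`. Specifications thus need to mention only what changes. -/
theorem frame_den (c : Cmd) (s : Store) : Frame c s (c.den s) := by
  induction c generalizing s with
  | skip => exact ⟨fun _ _ => rfl, fun _ _ => rfl⟩
  | assign y e =>
    refine ⟨fun x hx => ?_, fun _ _ => rfl⟩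
    simp only [Cmd.wr, beq_eq_false_iff_ne] at hx
    simp [Cmd.den, Ne.symm hx]
  | put b e f =>
    refine ⟨fun _ _ => rfl, fun a ha => ?_⟩
    simp only [Cmd.wa, beq_eq_false_iff_ne] at ha
    funext i
    simp [Cmd.den, Ne.symm ha]
  | seq c d ihc ihd =>
    refine ⟨fun x hx => ?_, fun a ha => ?_⟩
    · simp only [Cmd.wr, Bool.or_eq_false_iff] at hx
      rw [Cmd.den, (ihd _).reg x hx.2, (ihc _).reg x hx.1]
    · simp only [Cmd.wa, Bool.or_eq_false_iff] at ha
      rw [Cmd.den, (ihd _).arr a ha.2, (ihc _).arr a ha.1]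
  | ite e c d ihc ihd =>
    refine ⟨fun x hx => ?_, fun a ha => ?_⟩
    · simp only [Cmd.wr, Bool.or_eq_false_iff] at hx
      rw [Cmd.den]
      split_ifs
      exacts [(ihc _).reg x hx.1, (ihd _).reg x hx.2]
    · simp only [Cmd.wa, Bool.or_eq_false_iff] at ha
      rw [Cmd.den]
      split_ifs
      exacts [(ihc _).arr a ha.1, (ihd _).arr a ha.2]
  | loop x e c ih => exact Frame.iter ih _ s

theorem Frame.trans {c : Cmd} {s s' s'' : Store} (h : Frame c s s') (h' : Frame c s' s'') :
    Frame c s s'' :=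
  ⟨fun x hx => (h'.reg x hx).trans (h.reg x hx), fun a ha => (h'.arr a ha).trans (h.arr a ha)⟩

theorem Frame.mono {c d : Cmd} {s s' : Store} (h : Frame c s s')
    (hr : ∀ x, d.wr x = false → c.wr x = false) (ha : ∀ a, d.wa a = false → c.wa a = false) :
    Frame d s s' := ⟨fun x hx => h.reg x (hr x hx), fun a hx => h.arr a (ha a hx)⟩

theorem Frame.setReg {c : Cmd} {s s' : Store} (h : Frame c s s') {x : ℕ} (hx : c.wr x = true)
    (v : ℕ) : Frame c s (s'.setReg x v) := by
  refine ⟨fun y hy => ?_, h.arr⟩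
  rw [Store.reg_setReg, if_neg (by rintro rfl; simp [hx] at hy), h.reg y hy]

theorem Frame.setArr {c : Cmd} {s s' : Store} (h : Frame c s s') {a : ℕ} (ha : c.wa a = true)
    (i v : ℕ) : Frame c s (s'.setArr a i v) := by
  refine ⟨h.reg, fun b hb => ?_⟩
  rw [Store.arr_setArr, if_neg (by rintro rfl; simp [ha] at hb), h.arr b hb]

/-- With words below `N` and started on `s`, the command runs without overflow for at most `T`
steps and establishes `Q`. -/
structure Spec (N : ℕ) (c : Cmd) (s : Store) (T : ℕ) (Q : Store → Prop) : Prop where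
  ok : c.ok N s
  cost : c.cost s ≤ T
  post : Q (c.den s)

namespace Spec

variable {N : ℕ} {c d : Cmd} {s : Store} {T T' : ℕ} {Q R : Store → Prop}

theorem mono (h : Spec N c s T R) (hT : T ≤ T') (hQ : ∀ s', R s' → Frame c s s' → Q s') :
    Spec N c s T' Q := ⟨h.ok, h.cost.trans hT, hQ _ h.post (frame_den _ _)⟩

theorem le (h : Spec N c s T Q) (hT : T ≤ T') : Spec N c s T' Q :=
  ⟨h.ok, h.cost.trans hT, h.post⟩

theorem skip (h : Q s) : Spec N .skip s 1 Q := ⟨trivial, le_rfl, h⟩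

theorem assign {x : ℕ} {e : Ex} (hok : e.ok N s) (h : Q (s.setReg x (e.eval s))) :
    Spec N (.assign x e) s (e.size + 4) Q := ⟨hok, le_rfl, h⟩

theorem put {a : ℕ} {e f : Ex} (he : e.ok N s) (hf : f.ok N s)
    (h : Q (s.setArr a (e.eval s) (f.eval s))) :
    Spec N (.put a e f) s (e.size + f.size + 3) Q := ⟨⟨he, hf⟩, le_rfl, h⟩

theorem seq {T₁ T₂ : ℕ} (h : Spec N c s T₁ R)
    (h' : ∀ s', R s' → Frame c s s' → Spec N d s' T₂ Q) : Spec N (.seq c d) s (T₁ + T₂ + 1) Q := by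
  have h2 := h' _ h.post (frame_den _ _)
  exact ⟨⟨h.ok, h2.ok⟩, Nat.add_le_add_right (Nat.add_le_add h.cost h2.cost) 1, h2.post⟩

theorem ite {e : Ex} (he : e.ok N s) (h : e.eval s ≠ 0 → Spec N c s T Q)
    (h' : e.eval s = 0 → Spec N d s T Q) : Spec N (.ite e c d) s (e.size + 2 + T) Q := by
  by_cases hz : e.eval s ≠ 0
  · have h1 := h hz
    refine ⟨⟨he, ?_⟩, ?_, ?_⟩
    · rw [if_pos hz]; exact h1.ok
    · rw [Cmd.cost, if_pos hz]; exact Nat.add_le_add_left h1.cost _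
    · rw [Cmd.den, if_pos hz]; exact h1.post
  · have h1 := h' (not_not.1 hz)
    refine ⟨⟨he, ?_⟩, ?_, ?_⟩
    · rw [if_neg hz]; exact h1.ok
    · rw [Cmd.cost, if_neg hz]; exact Nat.add_le_add_left h1.cost _
    · rw [Cmd.den, if_neg hz]; exact h1.post

theorem flat (hf : c.flat = true) (hok : c.ok N s) (hT : c.bound ≤ T) (h : Q (c.den s)) :
    Spec N c s T Q := ⟨hok, (c.cost_le_bound hf s).trans hT, h⟩

/-- A bounded loop with an invariant `I i t`, in which `t` bounds the time spent so far. -/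
theorem loopAcc {x : ℕ} {e : Ex} (I : ℕ → ℕ → Store → Prop) (m : ℕ) (hm : e.eval s = m)
    (hok : e.ok N s) (h0 : I 0 0 s)
    (hs : ∀ i < m, ∀ t s', I i t s' → Frame (.loop x e c) s s' →
      ∃ τ, Spec N c (s'.setReg x i) τ (I (i + 1) (t + τ + 11)))
    (hT : ∀ t s', I m t s' → Frame (.loop x e c) s s' → e.size + 6 + t ≤ T) :
    Spec N (.loop x e c) s T (fun s' => ∃ t, I m t s') := by
  subst hm
  have key : ∀ i ≤ e.eval s, ∃ t, I i t (iterStore x c.den i s) ∧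
      (∀ j < i, c.ok N ((iterStore x c.den j s).setReg x j)) ∧
      ∑ j ∈ Finset.range i, (c.cost ((iterStore x c.den j s).setReg x j) + 11) ≤ t := by
    intro i
    induction i with
    | zero => exact fun _ => ⟨0, h0, by simp, by simp⟩
    | succ i ih =>
      intro hi
      obtain ⟨t, h1, h2, h3⟩ := ih (by omega)
      obtain ⟨τ, h4⟩ := hs i (by omega) t _ h1 (Frame.iter (fun s => frame_den c s) i s)
      refine ⟨t + τ + 11, h4.post, fun j hj => ?_, ?_⟩
      · rcases Nat.lt_succ_iff_lt_or_eq.1 hj with hj | rfl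
        exacts [h2 j hj, h4.ok]
      · rw [Finset.sum_range_succ]
        have := h4.cost
        omega
  obtain ⟨t, h1, h2, h3⟩ := key _ le_rfl
  have := hT t _ h1 (Frame.iter (fun s => frame_den c s) _ s)
  refine ⟨⟨hok, h2⟩, ?_, t, h1⟩
  rw [Cmd.cost]
  omega

/-- A bounded loop with an invariant and a uniform bound for the time of the body. -/
theorem loop {x : ℕ} {e : Ex} (I : ℕ → Store → Prop) (m τ : ℕ) (hm : e.eval s = m)
    (hok : e.ok N s) (h0 : I 0 s)
    (hs : ∀ i < m, ∀ s', I i s' → Frame (.loop x e c) s s' →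
      Spec N c (s'.setReg x i) τ (I (i + 1))) :
    Spec N (.loop x e c) s (e.size + 6 + m * (τ + 11)) (I m) := by
  have := loopAcc (T := e.size + 6 + m * (τ + 11)) (fun i t s' => I i s' ∧ t = i * (τ + 11))
    m hm hok ⟨h0, by simp⟩
    (fun i hi t s' hI hF => ⟨τ, (hs i hi s' hI.1 hF).mono le_rfl fun s'' h _ =>
      ⟨h, by rw [hI.2]; ring⟩⟩) (fun t s' h _ => by rw [h.2])
  exact this.mono le_rfl fun s' ⟨t, h, _⟩ _ => h

end Spec

/-- A specification of a command is a property of the runs of its machine program. -/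
theorem Spec.runs {w : ℕ} (hN : 1 < 2 ^ w) {c : Cmd} {s : Store} {T : ℕ} {Q : Store → Prop}
    (h : Spec (2 ^ w) c s T Q) (hs : Bdd (2 ^ w) s) (σ : Store) (hσ : Sim s σ) :
    ∃ t ≤ T, ∃ s' σ', Runs w t ⟨[c.code 0], σ⟩ ⟨[], σ'⟩ ∧ σ'.reg 0 = s'.reg 0 ∧ Q s' := by
  obtain ⟨_, σ', h1, h2, _⟩ := Cmd.code_correct hN c s hs h.ok 0 σ hσ []
  exact ⟨_, h.cost, _, σ', h1, h2.reg 0, h.post⟩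

/-! ### Notation for expressions -/

instance : Add Ex := ⟨.bin .add⟩
instance : Sub Ex := ⟨.bin .sub⟩
instance : Mul Ex := ⟨.bin .mul⟩
instance : Div Ex := ⟨.bin .div⟩
instance (k : ℕ) : OfNat Ex k := ⟨.lit k⟩

/-- The comparison `e < f`. -/
def Ex.lt (e f : Ex) : Ex := .bin .lt e f

/-- The comparison `e = f`. -/
def Ex.eq (e f : Ex) : Ex := .bin .eq e f

section

variable (s : Store) (N k a : ℕ) (e f : Ex)

@[simp] theorem Ex.eval_add : (e + f).eval s = e.eval s + f.eval s := rfl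
@[simp] theorem Ex.eval_sub : (e - f).eval s = e.eval s - f.eval s := rfl
@[simp] theorem Ex.eval_mul : (e * f).eval s = e.eval s * f.eval s := rfl
@[simp] theorem Ex.eval_div : (e / f).eval s = e.eval s / f.eval s := rfl
@[simp] theorem Ex.eval_lt' : (e.lt f).eval s = if e.eval s < f.eval s then 1 else 0 := rfl
@[simp] theorem Ex.eval_eq : (e.eq f).eval s = if e.eval s = f.eval s then 1 else 0 := rfl
@[simp] theorem Ex.eval_zero : (0 : Ex).eval s = 0 := rfl
@[simp] theorem Ex.eval_one : (1 : Ex).eval s = 1 := rfl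
@[simp] theorem Ex.eval_two : (2 : Ex).eval s = 2 := rfl
@[simp] theorem Ex.eval_sixteen : (16 : Ex).eval s = 16 := rfl
@[simp] theorem Ex.eval_var : (Ex.var k).eval s = s.reg k := rfl
@[simp] theorem Ex.eval_get : (Ex.get a e).eval s = s.arr a (e.eval s) := rfl

@[simp] theorem Ex.ok_add :
    (e + f).ok N s ↔ e.ok N s ∧ f.ok N s ∧ e.eval s + f.eval s < N := Iff.rfl
@[simp] theorem Ex.ok_sub : (e - f).ok N s ↔ e.ok N s ∧ f.ok N s := by
  show (_ ∧ _ ∧ True) ↔ _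
  simp
@[simp] theorem Ex.ok_mul :
    (e * f).ok N s ↔ e.ok N s ∧ f.ok N s ∧ e.eval s * f.eval s < N := Iff.rfl
@[simp] theorem Ex.ok_div : (e / f).ok N s ↔ e.ok N s ∧ f.ok N s := by
  show (_ ∧ _ ∧ True) ↔ _
  simp
@[simp] theorem Ex.ok_lt : (e.lt f).ok N s ↔ e.ok N s ∧ f.ok N s := by
  show (_ ∧ _ ∧ True) ↔ _
  simp
@[simp] theorem Ex.ok_eq : (e.eq f).ok N s ↔ e.ok N s ∧ f.ok N s := by
  show (_ ∧ _ ∧ True) ↔ _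
  simp
@[simp] theorem Ex.ok_zero : (0 : Ex).ok N s ↔ 0 < N := Iff.rfl
@[simp] theorem Ex.ok_one : (1 : Ex).ok N s ↔ 1 < N := Iff.rfl
@[simp] theorem Ex.ok_two : (2 : Ex).ok N s ↔ 2 < N := Iff.rfl
@[simp] theorem Ex.ok_sixteen : (16 : Ex).ok N s ↔ 16 < N := Iff.rfl
@[simp] theorem Ex.ok_var : (Ex.var k).ok N s ↔ True := Iff.rfl
@[simp] theorem Ex.ok_get : (Ex.get a e).ok N s ↔ e.ok N s := Iff.rfl

end

@[simp] theorem Ex.size_add (e f : Ex) : (e + f).size = e.size + f.size + 3 := rfl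
@[simp] theorem Ex.size_sub (e f : Ex) : (e - f).size = e.size + f.size + 3 := rfl
@[simp] theorem Ex.size_mul (e f : Ex) : (e * f).size = e.size + f.size + 3 := rfl
@[simp] theorem Ex.size_div (e f : Ex) : (e / f).size = e.size + f.size + 3 := rfl
@[simp] theorem Ex.size_lt (e f : Ex) : (e.lt f).size = e.size + f.size + 3 := rfl
@[simp] theorem Ex.size_eq (e f : Ex) : (e.eq f).size = e.size + f.size + 3 := rfl
@[simp] theorem Ex.size_zero : (0 : Ex).size = 1 := rfl
@[simp] theorem Ex.size_one : (1 : Ex).size = 1 := rfl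
@[simp] theorem Ex.size_two : (2 : Ex).size = 1 := rfl
@[simp] theorem Ex.size_sixteen : (16 : Ex).size = 1 := rfl
@[simp] theorem Ex.size_var (k : ℕ) : (Ex.var k).size = 3 := rfl
@[simp] theorem Ex.size_get (a : ℕ) (e : Ex) : (Ex.get a e).size = e.size + 2 := rfl

infixr:60 " ;; " => Cmd.seq
infix:62 " ≔ " => Cmd.assign
prefix:max "&" => Ex.var

/-! ### Words that are large in terms of `n` -/

/-- Words below `N` hold every number that is used for a graph with `n` vertices. -/
def Big (n N : ℕ) : Prop := 1000 * (n + 1) ^ 3 ≤ N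

namespace Big

variable {n N : ℕ}

theorem of_le (h : Big n N) {x : ℕ} (hx : x ≤ 999 * (n + 1) ^ 3) : x < N := by
  have : 0 < (n + 1) ^ 3 := by positivity
  unfold Big at h
  omega

theorem of_sq (h : Big n N) {x : ℕ} (hx : x ≤ 999 * (n + 1) ^ 2) : x < N :=
  h.of_le (hx.trans (Nat.mul_le_mul_left _ (Nat.pow_le_pow_right (by omega) (by omega))))

theorem lin (h : Big n N) {x : ℕ} (hx : x ≤ 999 * (n + 1)) : x < N :=
  h.of_sq (hx.trans (by nlinarith))

theorem const (h : Big n N) {x : ℕ} (hx : x ≤ 999) : x < N := h.lin (by omega)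

theorem zero_lt (h : Big n N) : 0 < N := h.const (by omega)

theorem one_lt (h : Big n N) : 1 < N := h.const (by omega)

theorem two_lt (h : Big n N) : 2 < N := h.const (by omega)

theorem sixteen_lt (h : Big n N) : 16 < N := h.const (by omega)

theorem mul (h : Big n N) {a b : ℕ} (ha : a ≤ n) (hb : b ≤ n) : a * b < N :=
  h.of_sq (by nlinarith [Nat.mul_le_mul ha hb])

theorem idx (h : Big n N) {a b c : ℕ} (ha : a ≤ n) (hb : b ≤ n) (hc : c ≤ n) : a * b + c < N :=
  h.of_sq (by nlinarith [Nat.mul_le_mul ha hb])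

end Big

theorem idx_inj {n u v u' v' : ℕ} (hv : v < n) (hv' : v' < n) :
    u * n + v = u' * n + v' ↔ u = u' ∧ v = v' := by
  refine ⟨fun h => ?_, fun h => by rw [h.1, h.2]⟩
  have h1 : u = u' := by
    have := congrArg (· / n) h
    simpa [Nat.mul_comm _ n, Nat.mul_add_div (show 0 < n by omega), Nat.div_eq_of_lt hv,
      Nat.div_eq_of_lt hv'] using this
  subst h1
  omega

theorem idx_lt_sq {n u v : ℕ} (hu : u < n) (hv : v < n) : u * n + v < n * n := by
  nlinarith

/-! ### Adjacency lists and breadth-first search orders -/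

/-- The rows of `nb` (with `dg u` entries for the vertex `u`, each row of length `n`) list the
neighbours in `Γ`. -/
structure IsAdjList (n : ℕ) (Γ : SimpleGraph ℕ) (dg nb : ℕ → ℕ) : Prop where
  deg_le : ∀ u < n, dg u ≤ n
  adj : ∀ u < n, ∀ j < dg u, Γ.Adj u (nb (u * n + j))
  complete : ∀ u v, Γ.Adj u v → ∃ j < dg u, nb (u * n + j) = v
  inj : ∀ u < n, ∀ i < dg u, ∀ j < dg u, nb (u * n + i) = nb (u * n + j) → i = j
  supp : ∀ u v, Γ.Adj u v → u < n

theorem IsAdjList.nb_lt {n : ℕ} {Γ : SimpleGraph ℕ} {dg nb : ℕ → ℕ} (h : IsAdjList n Γ dg nb)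
    {u j : ℕ} (hu : u < n) (hj : j < dg u) : nb (u * n + j) < n :=
  h.supp _ _ (h.adj u hu j hj).symm

/-- The queue `q` of length `l` lists vertices in the order of a breadth-first search from `c`;
`D` is one more than the distance on these vertices and `0` on the others, and `par` is the
predecessor. -/
structure BFSOrder (n : ℕ) (Γ : SimpleGraph ℕ) (c : ℕ) (D q par : ℕ → ℕ) (l : ℕ) : Prop where
  pos : 0 < l
  zero : q 0 = c
  lt : ∀ i < l, q i < n
  inj : ∀ i < l, ∀ j < l, q i = q j → i = j
  reach : ∀ i < l, Γ.Reachable c (q i)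
  D_q : ∀ i < l, D (q i) = Γ.dist c (q i) + 1
  D_zero : ∀ x < n, (∀ i < l, q i ≠ x) → D x = 0
  order : ∀ p < l, ∀ w, Γ.Reachable c w → Γ.dist c w < Γ.dist c (q p) → ∃ p' < p, q p' = w
  parent : ∀ i < l, i ≠ 0 → ∃ i' < i, par (q i) = q i' ∧ Γ.Adj (q i') (q i) ∧
    Γ.dist c (q i') + 1 = Γ.dist c (q i)

theorem SimpleGraph.Reachable.exists_adj_dist {V : Type*} {Γ : SimpleGraph V} {c x : V}
    (h : Γ.Reachable c x) (hx : c ≠ x) :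
    ∃ y, Γ.Reachable c y ∧ Γ.Adj y x ∧ Γ.dist c y + 1 = Γ.dist c x := by
  obtain ⟨p, hp⟩ := h.symm.exists_walk_length_eq_dist
  cases p with
  | nil => exact absurd rfl hx
  | @cons _ y _ hxy p =>
    have hy : Γ.Reachable c y := p.reachable.symm
    refine ⟨y, hy, hxy.symm, ?_⟩
    have h1 : Γ.dist c y ≤ p.length := by rw [Γ.dist_comm]; exact Γ.dist_le p
    have h2 : Γ.dist c x ≤ Γ.dist c y + 1 := by
      obtain ⟨p', hp'⟩ := hy.exists_walk_length_eq_dist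
      rw [← hp']
      exact (Γ.dist_le (p'.concat hxy.symm)).trans (by simp)
    rw [SimpleGraph.Walk.length_cons] at hp
    have : Γ.dist x c = Γ.dist c x := Γ.dist_comm
    omega

theorem SimpleGraph.Adj.dist_le_succ {V : Type*} {Γ : SimpleGraph V} {c x y : V}
    (hy : Γ.Reachable c y) (h : Γ.Adj y x) : Γ.dist c x ≤ Γ.dist c y + 1 := by
  obtain ⟨p', hp'⟩ := hy.exists_walk_length_eq_dist
  rw [← hp']
  exact (Γ.dist_le (p'.concat h)).trans (by simp)

/-- While the queue is shorter than `K`, it contains the neighbours of its first `h` members. -/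
def ScannedUpTo (Γ : SimpleGraph ℕ) (K : ℕ) (q : ℕ → ℕ) (l h : ℕ) : Prop :=
  l < K → ∀ i < h, i < l → ∀ v, Γ.Adj (q i) v → ∃ i' < l, q i' = v

namespace BFSOrder

variable {n : ℕ} {Γ : SimpleGraph ℕ} {c K : ℕ} {D q par : ℕ → ℕ} {l h : ℕ}

theorem start {c : ℕ} (hc : c < n) (hD : ∀ x < n, x ≠ c → D x = 0) (hDc : D c = 1)
    (hq : q 0 = c) : BFSOrder n Γ c D q par 1 where
  pos := one_pos
  zero := hq
  lt i hi := by obtain rfl : i = 0 := by omega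
                rwa [hq]
  inj i hi j hj _ := by omega
  reach i hi := by obtain rfl : i = 0 := by omega
                   rw [hq]
  D_q i hi := by obtain rfl : i = 0 := by omega
                 rw [hq, hDc, SimpleGraph.dist_self]
  D_zero x hx h := hD x hx (fun e => h 0 one_pos (hq.trans e.symm))
  order p hp w _ hw := by
    obtain rfl : p = 0 := by omega
    rw [hq, SimpleGraph.dist_self] at hw
    omega
  parent i hi h0 := by omega

/-- A vertex closer to the root than the head of the queue precedes it by `order`. One at the same
distance is the root itself or has a predecessor on a shortest path that is closer than the head,
hence already scanned; as the queue is not yet full, no neighbour of a scanned vertex is missing. -/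
theorem mem_of_dist_le (B : BFSOrder n Γ c D q par l) (hs : ScannedUpTo Γ K q l h) (hh : h < l)
    (hl : l < K) {w : ℕ} (hw : Γ.Reachable c w) (hd : Γ.dist c w ≤ Γ.dist c (q h)) :
    ∃ i < l, q i = w := by
  rcases lt_or_eq_of_le hd with hd | hd
  · obtain ⟨p, hp, e⟩ := B.order h hh w hw hd
    exact ⟨p, by omega, e⟩
  · by_cases hc : c = w
    · exact ⟨0, B.pos, B.zero.trans hc⟩
    · obtain ⟨y, hy, hyw, hyd⟩ := hw.exists_adj_dist hc
      obtain ⟨p, hp, rfl⟩ := B.order h hh y hy (by omega)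
      exact hs hl p hp (by omega) w hyw

/-- Since `D x = 0`, the vertex `x` is not in the queue, so by `mem_of_dist_le` it is farther away
than the head; being adjacent to the head, it is farther by exactly one. Every vertex closer than
`x` is then at most as far as the head, hence already queued, which preserves the order. -/
theorem push (B : BFSOrder n Γ c D q par l) (hs : ScannedUpTo Γ K q l h) (hh : h < l)
    (hl : l < K) {x : ℕ} (hx : Γ.Adj (q h) x) (hxn : x < n) (hD : D x = 0) :
    BFSOrder n Γ c (Function.update D x (D (q h) + 1)) (Function.update q l x)
      (Function.update par x (q h)) (l + 1) := by
  have hnew : ∀ i < l, q i ≠ x := fun i hi e => by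
    have := B.D_q i hi
    rw [e, hD] at this
    omega
  have hxr : Γ.Reachable c x := (B.reach h hh).trans hx.reachable
  have hxd : Γ.dist c x = Γ.dist c (q h) + 1 := by
    refine le_antisymm (hx.dist_le_succ (B.reach h hh)) (Nat.succ_le_of_lt (not_le.1 fun hle => ?_))
    obtain ⟨i, hi, e⟩ := B.mem_of_dist_le hs hh hl hxr hle
    exact hnew i hi e
  have hq : ∀ i < l, Function.update q l x i = q i := fun i hi =>
    Function.update_of_ne (by omega) _ _
  have hql : Function.update q l x l = x := Function.update_self _ _ _
  refine ⟨by omega, ?_, ?_, ?_, ?_, ?_, ?_, ?_, ?_⟩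
  · rw [hq 0 B.pos, B.zero]
  · intro i hi
    rcases Nat.lt_succ_iff_lt_or_eq.1 hi with hi | rfl
    · rw [hq i hi]; exact B.lt i hi
    · rwa [hql]
  · intro i hi j hj e
    rcases Nat.lt_succ_iff_lt_or_eq.1 hi with hi | rfl <;>
      rcases Nat.lt_succ_iff_lt_or_eq.1 hj with hj | rfl
    · rw [hq i hi, hq j hj] at e
      exact B.inj i hi j hj e
    · rw [hq i hi, hql] at e
      exact absurd e (hnew i hi)
    · rw [hq j hj, hql] at e
      exact absurd e.symm (hnew j hj)
    · rfl
  · intro i hi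
    rcases Nat.lt_succ_iff_lt_or_eq.1 hi with hi | rfl
    · rw [hq i hi]; exact B.reach i hi
    · rwa [hql]
  · intro i hi
    rcases Nat.lt_succ_iff_lt_or_eq.1 hi with hi | rfl
    · rw [hq i hi, Function.update_of_ne (hnew i hi), B.D_q i hi]
    · rw [hql, Function.update_self, B.D_q h hh, hxd]
  · intro y hy hne
    have h1 : y ≠ x := fun e => hne l (by omega) (hql.trans e.symm)
    rw [Function.update_of_ne h1]
    exact B.D_zero y hy fun i hi e => hne i (by omega) ((hq i hi).trans e)
  · intro p hp w hw hd
    rcases Nat.lt_succ_iff_lt_or_eq.1 hp with hp | rfl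
    · rw [hq p hp] at hd
      obtain ⟨p', hp', e⟩ := B.order p hp w hw hd
      exact ⟨p', hp', (hq p' (by omega)).trans e⟩
    · rw [hql, hxd] at hd
      obtain ⟨i, hi, e⟩ := B.mem_of_dist_le hs hh hl hw (by omega)
      exact ⟨i, hi, (hq i hi).trans e⟩
  · intro i hi h0
    rcases Nat.lt_succ_iff_lt_or_eq.1 hi with hi | rfl
    · obtain ⟨i', hi', e, ha, hd⟩ := B.parent i hi h0
      refine ⟨i', hi', ?_, ?_, ?_⟩
      · rw [hq i hi, hq i' (by omega), Function.update_of_ne (hnew i hi), e]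
      · rwa [hq i hi, hq i' (by omega)]
      · rwa [hq i hi, hq i' (by omega)]
    · refine ⟨h, hh, ?_, ?_, ?_⟩
      · rw [hql, hq h hh, Function.update_self]
      · rwa [hql, hq h hh]
      · rw [hql, hq h hh, hxd]

theorem scanned_push (hs : ScannedUpTo Γ K q l h) (x : ℕ) (hh : h < l) :
    ScannedUpTo Γ K (Function.update q l x) (l + 1) h := by
  intro hl i hi hil v hv
  rw [Function.update_of_ne (by omega)] at hv
  obtain ⟨i', hi', e⟩ := hs (by omega) i hi (by omega) v hv
  exact ⟨i', by omega, by rwa [Function.update_of_ne (by omega)]⟩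

/-- The search is complete unless it was cut off at `K` vertices. -/
theorem mem_of_reachable (B : BFSOrder n Γ c D q par l) (hs : ScannedUpTo Γ K q l l) (hl : l < K)
    {w : ℕ} (hw : Γ.Reachable c w) : ∃ i < l, q i = w := by
  obtain ⟨p⟩ := hw
  suffices H : ∀ {a b : ℕ} (p : Γ.Walk a b), (∃ i < l, q i = a) → ∃ i < l, q i = b from
    H p ⟨0, B.pos, B.zero⟩
  intro a b p
  induction p with
  | nil => exact id
  | cons hab p ih =>
    rintro ⟨i, hi, rfl⟩
    exact ih (hs hl i hi hi _ hab)

/-- The parent of an entry stands earlier in the queue and is closer by one. -/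
theorem dist_le_index (B : BFSOrder n Γ c D q par l) {i : ℕ} (hi : i < l) :
    Γ.dist c (q i) ≤ i := by
  induction i using Nat.strong_induction_on with
  | _ i ih =>
    by_cases h0 : i = 0
    · subst h0
      simp [B.zero]
    · obtain ⟨i', hi', _, _, hd⟩ := B.parent i hi h0
      have := ih i' hi' (by omega)
      omega

theorem length_le (B : BFSOrder n Γ c D q par l) : l ≤ n := by
  have : (Finset.range l).card ≤ (Finset.range n).card :=
    Finset.card_le_card_of_injOn q (fun i hi => by
      simpa using B.lt i (by simpa using hi))
      (fun i hi j hj e => B.inj i (by simpa using hi) j (by simpa using hj) e)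
  simpa using this

theorem mem_of_length_eq (B : BFSOrder n Γ c D q par n) {w : ℕ} (hw : w < n) :
    ∃ i < n, q i = w := by
  have h := Finset.surj_on_of_inj_on_of_card_le (s := Finset.range n) (t := Finset.range n)
    (fun i _ => q i) (fun i hi => by simpa using B.lt i (by simpa using hi))
    (fun i j hi hj e => B.inj i (by simpa using hi) j (by simpa using hj) e) le_rfl w
    (by simpa using hw)
  obtain ⟨i, hi, e⟩ := h
  exact ⟨i, by simpa using hi, e.symm⟩

/-- This turns a bound for the degrees of arbitrary sets of at most `K` vertices into a bound for
the work of a search, because the queue has no repetitions. -/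
theorem sum_le (B : BFSOrder n Γ c D q par l) (f : ℕ → ℕ) (E : ℕ)
    (hE : ∀ S ⊆ Finset.range n, S.card ≤ K → ∑ u ∈ S, f u ≤ E) (hl : l ≤ K) :
    ∑ i ∈ Finset.range l, f (q i) ≤ E := by
  have hi : Set.InjOn q (Finset.range l) := fun i hi j hj e =>
    B.inj i (by simpa using hi) j (by simpa using hj) e
  rw [← Finset.sum_image (f := f) hi]
  refine hE _ (fun x hx => ?_) ?_
  · obtain ⟨i, hi, rfl⟩ := Finset.mem_image.1 hx
    simpa using B.lt i (by simpa using hi)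
  · exact Finset.card_image_le.trans (by simpa using hl)

end BFSOrder

/-! ### Variables and arrays -/

notation "r_n" => 0
notation "r_s" => 101
notation "r_L" => 102
notation "r_K" => 103
notation "r_src" => 104
notation "r_tl" => 105
notation "r_h" => 106
notation "r_u" => 107
notation "r_m" => 108
notation "r_j" => 109
notation "r_x" => 110
notation "r_y" => 111
notation "a_adj" => 0
notation "a_dg" => 201
notation "a_nb" => 202
notation "a_D" => 203
notation "a_q" => 204
notation "a_par" => 205

/-! ### Building adjacency lists -/

/-- Adjacency lists of the graph in which `r_x` and `r_y` are adjacent if `e` is nonzero. -/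
def listsCmd (e : Ex) : Cmd :=
  .loop r_x &r_n (.put a_dg &r_x 0 ;;
    .loop r_y &r_n (.ite e
      (.put a_nb (&r_x * &r_n + .get a_dg &r_x) &r_y ;; .put a_dg &r_x (.get a_dg &r_x + 1))
      .skip))

/-- The row of the vertex `u` lists the neighbours below `m`. -/
structure IsAdjRow (n : ℕ) (Γ : SimpleGraph ℕ) (dg nb : ℕ → ℕ) (u m : ℕ) : Prop where
  deg_le : dg u ≤ m
  adj : ∀ j < dg u, Γ.Adj u (nb (u * n + j))
  lt : ∀ j < dg u, nb (u * n + j) < m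
  complete : ∀ v < m, Γ.Adj u v → ∃ j < dg u, nb (u * n + j) = v
  inj : ∀ i < dg u, ∀ j < dg u, nb (u * n + i) = nb (u * n + j) → i = j

theorem IsAdjRow.succ_of_not_adj {n : ℕ} {Γ : SimpleGraph ℕ} {dg nb : ℕ → ℕ} {u m : ℕ}
    (h : IsAdjRow n Γ dg nb u m) (hm : ¬ Γ.Adj u m) : IsAdjRow n Γ dg nb u (m + 1) where
  deg_le := h.deg_le.trans (Nat.le_succ m)
  adj := h.adj
  lt j hj := (h.lt j hj).trans (Nat.lt_succ_self m)
  complete v hv hu := by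
    rcases Nat.lt_succ_iff_lt_or_eq.1 hv with hv | rfl
    exacts [h.complete v hv hu, absurd hu hm]
  inj := h.inj

theorem IsAdjRow.succ_of_adj {n : ℕ} {Γ : SimpleGraph ℕ} {dg nb : ℕ → ℕ} {u m : ℕ}
    (h : IsAdjRow n Γ dg nb u m) (hm : Γ.Adj u m) :
    IsAdjRow n Γ (Function.update dg u (dg u + 1)) (Function.update nb (u * n + dg u) m) u
      (m + 1) := by
  have hd : Function.update dg u (dg u + 1) u = dg u + 1 := Function.update_self _ _ _
  have ho : ∀ j < dg u, Function.update nb (u * n + dg u) m (u * n + j) = nb (u * n + j) :=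
    fun j hj => Function.update_of_ne (by omega) _ _
  have hl : Function.update nb (u * n + dg u) m (u * n + dg u) = m := Function.update_self _ _ _
  have := h.deg_le
  refine ⟨by omega, ?_, ?_, ?_, ?_⟩ <;> rw [hd]
  · intro j hj
    rcases Nat.lt_succ_iff_lt_or_eq.1 hj with hj | rfl
    · rw [ho j hj]; exact h.adj j hj
    · rwa [hl]
  · intro j hj
    rcases Nat.lt_succ_iff_lt_or_eq.1 hj with hj | rfl
    · rw [ho j hj]; exact (h.lt j hj).trans (Nat.lt_succ_self m)
    · rw [hl]; exact Nat.lt_succ_self m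
  · intro v hv hu
    rcases Nat.lt_succ_iff_lt_or_eq.1 hv with hv | rfl
    · obtain ⟨j, hj, e⟩ := h.complete v hv hu
      exact ⟨j, by omega, by rw [ho j hj, e]⟩
    · exact ⟨dg u, by omega, hl⟩
  · intro i hi j hj e
    rcases Nat.lt_succ_iff_lt_or_eq.1 hi with hi | rfl <;>
      rcases Nat.lt_succ_iff_lt_or_eq.1 hj with hj | rfl
    · rw [ho i hi, ho j hj] at e
      exact h.inj i hi j hj e
    · rw [ho i hi, hl] at e
      exact absurd (h.lt i hi) (by omega)
    · rw [ho j hj, hl] at e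
      exact absurd (h.lt j hj) (by omega)
    · rfl

theorem IsAdjRow.congr {n : ℕ} {Γ : SimpleGraph ℕ} {dg nb dg' nb' : ℕ → ℕ} {u m : ℕ}
    (h : IsAdjRow n Γ dg nb u m) (hd : dg' u = dg u)
    (hb : ∀ j < dg u, nb' (u * n + j) = nb (u * n + j)) : IsAdjRow n Γ dg' nb' u m := by
  constructor <;> rw [hd]
  · exact h.deg_le
  · intro j hj; rw [hb j hj]; exact h.adj j hj
  · intro j hj; rw [hb j hj]; exact h.lt j hj
  · intro v hv hu
    obtain ⟨j, hj, e⟩ := h.complete v hv hu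
    exact ⟨j, hj, by rw [hb j hj, e]⟩
  · intro i hi j hj; rw [hb i hi, hb j hj]; exact h.inj i hi j hj

theorem IsAdjList.of_rows {n : ℕ} {Γ : SimpleGraph ℕ} {dg nb : ℕ → ℕ}
    (hΓ : ∀ u v, Γ.Adj u v → u < n) (h : ∀ u < n, IsAdjRow n Γ dg nb u n) :
    IsAdjList n Γ dg nb where
  deg_le u hu := (h u hu).deg_le
  adj u hu := (h u hu).adj
  complete u v huv := (h u (hΓ u v huv)).complete v (hΓ v u huv.symm) huv
  inj u hu := (h u hu).inj
  supp := hΓ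

theorem spec_listsCmd {N n : ℕ} (hN : Big n N) (e : Ex) (s : Store) (hn : s.reg r_n = n)
    (Γ : SimpleGraph ℕ) (hΓ : ∀ u v, Γ.Adj u v → u < n)
    (he : ∀ s' : Store, ∀ u < n, ∀ v < n, Frame (listsCmd e) s s' → s'.reg r_x = u →
      s'.reg r_y = v → e.ok N s' ∧ (e.eval s' ≠ 0 ↔ Γ.Adj u v)) :
    Spec N (listsCmd e) s (9 + n * (n * (e.size + 70) + 60)) (fun s' =>
      IsAdjList n Γ (s'.arr a_dg) (s'.arr a_nb)) := by
  refine Spec.mono (Spec.loop (fun u s' => ∀ u' < u, IsAdjRow n Γ (s'.arr a_dg) (s'.arr a_nb) u' n)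
    n (n * (e.size + 70) + 40) hn trivial (by simp) ?_) ?_ ?_
  · intro u hu s₁ hI hF
    refine Spec.mono (Spec.seq (Spec.put (Q := fun s' => s'.reg r_x = u ∧ s'.reg r_n = n ∧
      Frame (listsCmd e) s s' ∧ s'.arr a_dg u = 0 ∧
      ∀ u' < u, IsAdjRow n Γ (s'.arr a_dg) (s'.arr a_nb) u' n) trivial
      (by simpa using hN.const (by omega)) ?_) fun s₂ ⟨hx, hn2, hF2, hd2, hI2⟩ _ =>
      (Spec.loop (fun v s' => IsAdjRow n Γ (s'.arr a_dg) (s'.arr a_nb) u v ∧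
        ∀ u' < u, IsAdjRow n Γ (s'.arr a_dg) (s'.arr a_nb) u' n) n (e.size + 50) hn2 trivial
        ?_ ?_)) ?_ ?_
    · refine ⟨by simp, ?_, ?_, ?_, ?_⟩
      · simpa using (hF.reg r_n rfl).trans hn
      · exact (Frame.setReg hF rfl _).setArr rfl _ _
      · simp
      · intro u' hu'
        refine (hI u' hu').congr ?_ ?_
        · simp [show u' ≠ u by omega]
        · simp
    · exact ⟨⟨by simp [hd2], by simp [hd2], by simp [hd2], by simp, by simp [hd2]⟩, hI2⟩
    · intro v hv s₃ ⟨hrow, hI3⟩ hF3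
      have hx3 : s₃.reg r_x = u := (hF3.reg r_x rfl).trans hx
      have hn3 : s₃.reg r_n = n := (hF3.reg r_n rfl).trans hn2
      have hF4 : Frame (listsCmd e) s (s₃.setReg r_y v) := by
        refine Frame.setReg (hF2.trans (hF3.mono ?_ ?_)) rfl _ <;>
        · intro x; simp [listsCmd, Cmd.wr, Cmd.wa]
      obtain ⟨hok, hiff⟩ := he (s₃.setReg r_y v) u hu v hv hF4 (by simpa using hx3) (by simp)
      have hdg : s₃.arr a_dg u ≤ n := hrow.deg_le.trans hv.le
      refine (Spec.ite (T := 40) hok (fun hz => ?_) (fun hz => ?_)).le (by omega)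
      · have hadj := hiff.1 hz
        refine ⟨?_, by simp [Cmd.cost], ?_⟩
        · simp [Cmd.ok, Cmd.den, hx3, hn3]
          exact ⟨⟨hN.mul hu.le le_rfl, hN.idx hu.le le_rfl hdg⟩, hN.const (by omega),
            hN.lin (by omega)⟩
        · have e1 : (Cmd.den (.put a_nb (&r_x * &r_n + .get a_dg &r_x) &r_y ;;
              .put a_dg &r_x (.get a_dg &r_x + 1)) (s₃.setReg r_y v)).arr a_dg =
              Function.update (s₃.arr a_dg) u (s₃.arr a_dg u + 1) := by
            simp [Cmd.den, hx3]
          have e2 : (Cmd.den (.put a_nb (&r_x * &r_n + .get a_dg &r_x) &r_y ;;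
              .put a_dg &r_x (.get a_dg &r_x + 1)) (s₃.setReg r_y v)).arr a_nb =
              Function.update (s₃.arr a_nb) (u * n + s₃.arr a_dg u) v := by
            simp [Cmd.den, hx3, hn3]
          rw [e1, e2]
          refine ⟨hrow.succ_of_adj hadj, fun u' hu' => (hI3 u' hu').congr ?_ fun j hj => ?_⟩
          · rw [Function.update_of_ne (by omega)]
          · rw [Function.update_of_ne]
            have h1 := (hI3 u' hu').deg_le
            have h2 := hrow.deg_le
            rw [Ne, idx_inj (by omega) (by omega)]
            omega
      · exact (Spec.skip ⟨hrow.succ_of_not_adj fun hh => hiff.2 hh hz, hI3⟩).le (by omega)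
    · simp [Ex.size]
      ring_nf
      omega
    · intro s₃ ⟨hrow, hI3⟩ _ u' hu'
      rcases Nat.lt_succ_iff_lt_or_eq.1 hu' with hu' | rfl
      exacts [hI3 u' hu', hrow]
  · simp
    ring_nf
    omega
  · intro s' h _
    exact IsAdjList.of_rows hΓ h

/-! ### The search -/

/-- Breadth-first search from `r_src`, cut off at `r_K` vertices. -/
def bfsCmd : Cmd :=
  .loop r_x &r_n (.put a_D &r_x 0) ;;
  (.put a_D &r_src 1 ;; .put a_q 0 &r_src ;; r_tl ≔ 1) ;;
  .loop r_h &r_K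
    (.ite (.lt &r_h &r_tl)
      ((r_u ≔ .get a_q &r_h ;; r_m ≔ .get a_dg &r_u ;; .ite (.lt &r_K &r_m) (r_m ≔ &r_K) .skip) ;;
        .loop r_j &r_m (r_x ≔ .get a_nb (&r_u * &r_n + &r_j) ;;
          .ite (.lt &r_tl &r_K * .eq (.get a_D &r_x) 0)
            (.put a_D &r_x (.get a_D &r_u + 1) ;; .put a_par &r_x &r_u ;; .put a_q &r_tl &r_x ;;
              r_tl ≔ &r_tl + 1)
            .skip))
      .skip)

/-- At most `K` neighbours of each vertex are scanned: if there are more, the scanned ones alone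
fill the queue. The form of the hypothesis on `E` covers both uses. For a search cut off at `K = s`
one may take `s² ≤ 4n`, and for a full search, `K = n`, the sum of all degrees. -/
theorem spec_bfsCmd {N n : ℕ} (hN : Big n N) (s : Store) (hn : s.reg r_n = n) (K c E : ℕ)
    (hK : s.reg r_K = K) (hc : s.reg r_src = c) (hK1 : 1 ≤ K) (hKn : K ≤ n) (hcn : c < n)
    (Γ : SimpleGraph ℕ) (hΓ : IsAdjList n Γ (s.arr a_dg) (s.arr a_nb))
    (hE : ∀ S ⊆ Finset.range n, S.card ≤ K → ∑ u ∈ S, min (s.arr a_dg u) K ≤ E) :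
    Spec N bfsCmd s (120 * (n + E) + 120) (fun s' =>
      s'.reg r_tl ≤ K ∧
      BFSOrder n Γ c (s'.arr a_D) (s'.arr a_q) (s'.arr a_par) (s'.reg r_tl) ∧
      ScannedUpTo Γ K (s'.arr a_q) (s'.reg r_tl) (s'.reg r_tl)) := by
  refine Spec.le (Spec.seq (R := fun s' => ∀ x < n, s'.arr a_D x = 0)
    (T₁ := 18 * n + 9) (T₂ := 102 * n + 120 * E + 100) ?_ ?_) (by omega)
  · refine Spec.mono (Spec.loop (fun i s' => ∀ x < i, s'.arr a_D x = 0) n 7 hn trivial (by simp) ?_)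
      (by simp; omega) (fun s' h _ => h)
    intro i hi s₁ hI hF
    refine Spec.put trivial (by simpa using hN.const (by omega)) ?_
    intro x hx
    simp only [Store.arr_setArr, Store.arr_setReg, if_true, Ex.eval_var, Store.reg_setReg,
      Ex.eval_zero, Function.update_apply]
    split_ifs with h
    · rfl
    · exact hI x (by omega)
  intro s₁ hD0 hF1
  have hn1 : s₁.reg r_n = n := (hF1.reg r_n rfl).trans hn
  have hK1' : s₁.reg r_K = K := (hF1.reg r_K rfl).trans hK
  have hc1 : s₁.reg r_src = c := (hF1.reg r_src rfl).trans hc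
  have hdg1 : s₁.arr a_dg = s.arr a_dg := hF1.arr a_dg rfl
  have hnb1 : s₁.arr a_nb = s.arr a_nb := hF1.arr a_nb rfl
  refine Spec.le (Spec.seq (R := fun s' => s'.reg r_tl = 1 ∧
    s'.arr a_D = Function.update (s₁.arr a_D) c 1 ∧
    s'.arr a_q = Function.update (s₁.arr a_q) 0 c) (T₁ := 23) (T₂ := 102 * n + 120 * E + 76)
    ⟨?_, ?_, ?_⟩ ?_) (by omega)
  · simp [Cmd.ok, hN.zero_lt, hN.one_lt]
  · simp [Cmd.cost]
  · simp [Cmd.den, hc1]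
  intro s₂ ⟨htl2, hD2, hq2⟩ hF2
  have hn2 : s₂.reg r_n = n := (hF2.reg r_n rfl).trans hn1
  have hK2 : s₂.reg r_K = K := (hF2.reg r_K rfl).trans hK1'
  have hdg2 : s₂.arr a_dg = s.arr a_dg := (hF2.arr a_dg rfl).trans hdg1
  have hnb2 : s₂.arr a_nb = s.arr a_nb := (hF2.arr a_nb rfl).trans hnb1
  set dg := s.arr a_dg with hdg
  set nb := s.arr a_nb with hnb
  -- The time is charged to the scanned neighbours of the queue members processed so far. Rounds in
  -- which `h` has passed the end of the queue do nothing and are paid for by the term `90 * h`.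
  refine Spec.mono (Spec.loopAcc (T := 102 * n + 120 * E + 76) (fun h t s' => s'.reg r_tl ≤ K ∧
    BFSOrder n Γ c (s'.arr a_D) (s'.arr a_q) (s'.arr a_par) (s'.reg r_tl) ∧
    ScannedUpTo Γ K (s'.arr a_q) (s'.reg r_tl) h ∧
    t ≤ 110 * ∑ i ∈ Finset.range (min h (s'.reg r_tl)), min (dg (s'.arr a_q i)) K + 90 * h)
    K hK2 trivial ?_ ?_ ?_) le_rfl ?_
  · refine ⟨by omega, ?_, ?_, by simp⟩
    · rw [htl2, hD2, hq2]
      exact BFSOrder.start hcn (fun x hx hxc => by rw [Function.update_of_ne hxc, hD0 x hx])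
        (by simp) (by simp)
    · intro _ i hi
      omega
  · intro h hh t s₃ ⟨htl3, hB3, hS3, ht3⟩ hF3
    have hn3 : s₃.reg r_n = n := (hF3.reg r_n rfl).trans hn2
    have hK3 : s₃.reg r_K = K := (hF3.reg r_K rfl).trans hK2
    have hdg3 : s₃.arr a_dg = dg := (hF3.arr a_dg rfl).trans hdg2
    have hnb3 : s₃.arr a_nb = nb := (hF3.arr a_nb rfl).trans hnb2
    set q₀ := s₃.arr a_q with hq₀
    set l₀ := s₃.reg r_tl with hl₀
    by_cases hlt : h < l₀
    swap
    · refine ⟨12, (Spec.ite (T := 1) (by simp) ?_ ?_).le (by simp)⟩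
      · intro hz
        simp [← hl₀, hlt] at hz
      · intro _
        refine Spec.skip ⟨htl3, hB3, fun hl i hi hil => hS3 hl i (by
          have : i < l₀ := hil
          omega) hil, ?_⟩
        simp only [Store.arr_setReg, Store.reg_setReg, ← hl₀, ← hq₀]
        simp only [Nat.reduceEqDiff, reduceIte]
        rw [min_eq_right (by omega)] at ht3 ⊢
        omega
    set u := q₀ h with hu
    set m := min (dg u) K with hm
    have hun : u < n := hB3.lt h hlt
    have hdgn : dg u ≤ n := hΓ.deg_le u hun
    refine ⟨110 * m + 75, (Spec.ite (T := 110 * m + 60) (by simp) ?_ ?_).le (by simp; omega)⟩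
    swap
    · intro hz
      simp [← hl₀, hlt] at hz
    intro _
    refine Spec.le (Spec.seq (R := fun s' => s'.reg r_u = u ∧ s'.reg r_m = m ∧ s'.reg r_h = h)
      (T₁ := 38) (T₂ := 110 * m + 20) (Spec.flat rfl ?_ (by decide) ?_) ?_) (by omega)
    · simp [Cmd.ok]
    · simp only [Cmd.den, Ex.eval_get, Ex.eval_var, Store.reg_setReg, Store.arr_setReg, Ex.eval_lt']
      simp only [Nat.reduceEqDiff, reduceIte, ← hq₀, ← hu, hdg3, hK3]
      split_ifs with h1 <;> simp [hm] <;> grind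
    intro s₄ ⟨hu4, hm4, hh4⟩ hF4
    have hn4 : s₄.reg r_n = n := (hF4.reg r_n rfl).trans hn3
    have hK4 : s₄.reg r_K = K := (hF4.reg r_K rfl).trans hK3
    have hl4 : s₄.reg r_tl = l₀ := hF4.reg r_tl rfl
    have hdg4 : s₄.arr a_dg = dg := (hF4.arr a_dg rfl).trans hdg3
    have hnb4 : s₄.arr a_nb = nb := (hF4.arr a_nb rfl).trans hnb3
    have hq4 : s₄.arr a_q = q₀ := hF4.arr a_q rfl
    have hD4 : s₄.arr a_D = s₃.arr a_D := hF4.arr a_D rfl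
    have hp4 : s₄.arr a_par = s₃.arr a_par := hF4.arr a_par rfl
    refine Spec.mono (Spec.loop (fun j s' => s'.reg r_tl ≤ K ∧ l₀ ≤ s'.reg r_tl ∧
      (∀ i < l₀, s'.arr a_q i = q₀ i) ∧
      BFSOrder n Γ c (s'.arr a_D) (s'.arr a_q) (s'.arr a_par) (s'.reg r_tl) ∧
      ScannedUpTo Γ K (s'.arr a_q) (s'.reg r_tl) h ∧
      (s'.reg r_tl < K → ∀ j' < j, ∃ i < s'.reg r_tl, s'.arr a_q i = nb (u * n + j')))
      m 95 hm4 trivial ?_ ?_) (by simp; omega) ?_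
    · rw [hl4, hq4, hD4, hp4]
      exact ⟨htl3, le_rfl, fun _ _ => rfl, hB3, hS3, fun _ j' hj' => by omega⟩
    · intro j hj s₅ ⟨htl5, hl5, hq5, hB5, hS5, hv5⟩ hF5
      have hn5 : s₅.reg r_n = n := (hF5.reg r_n rfl).trans hn4
      have hK5 : s₅.reg r_K = K := (hF5.reg r_K rfl).trans hK4
      have hu5 : s₅.reg r_u = u := (hF5.reg r_u rfl).trans hu4
      have hnb5 : s₅.arr a_nb = nb := (hF5.arr a_nb rfl).trans hnb4
      have hjd : j < dg u := by omega
      set x := nb (u * n + j) with hx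
      have hadj : Γ.Adj u x := hΓ.adj u hun j hjd
      have hxn : x < n := hΓ.supp _ _ hadj.symm
      have hqh : s₅.arr a_q h = u := hq5 h hlt
      set l := s₅.reg r_tl with hl
      have hDu : s₅.arr a_D u ≤ n + 1 := by
        have h1 := hB5.D_q h (by omega)
        have h2 := hB5.dist_le_index (i := h) (by omega)
        rw [hqh] at h1 h2
        omega
      refine Spec.le (Spec.seq (R := fun s' => s' = (s₅.setReg r_j j).setReg r_x x)
        (Spec.assign ?_ ?_) (T₂ := 70) ?_) (by simp)
      · simpa [hu5, hn5] using ⟨hN.mul hun.le le_rfl, hN.idx hun.le le_rfl (by omega)⟩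
      · simp [hu5, hn5, hnb5, hx]
      rintro _ rfl -
      refine Spec.le (Spec.ite (T := 47) ?_ ?_ ?_) (by simp)
      · simp only [Ex.ok_mul, Ex.ok_lt, Ex.ok_var, Ex.ok_eq, Ex.ok_get, Ex.ok_zero, and_true,
          true_and, Ex.eval_lt', Ex.eval_eq]
        refine ⟨hN.const (by omega), hN.const ?_⟩
        split_ifs <;> omega
      · intro hz
        have hz' : l < K ∧ s₅.arr a_D x = 0 := by
          simpa [← hl, hK5, and_comm] using hz
        obtain ⟨hlK, hDx⟩ := hz'
        have hpush := hB5.push hS5 (by omega) hlK (by rwa [hqh]) hxn hDx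
        have hscan := BFSOrder.scanned_push hS5 x (show h < l by omega)
        refine Spec.flat rfl ?_ (by decide) ?_
        · simpa [Cmd.ok, Cmd.den, hu5, ← hl, hN.one_lt] using
            ⟨hN.lin (x := s₅.arr a_D u + 1) (by omega), hN.lin (x := l + 1) (by omega)⟩
        · simp only [Cmd.den, Ex.eval_var, Ex.eval_add, Ex.eval_get, Ex.eval_one, Store.reg_setReg,
            Store.arr_setReg, Store.arr_setArr, Store.reg_setArr]
          simp only [Nat.reduceEqDiff, reduceIte, ← hl, hu5]
          rw [hqh] at hpush
          refine ⟨by omega, by omega, ?_, hpush, hscan, ?_⟩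
          · intro i hi
            rw [Function.update_of_ne (by omega), hq5 i hi]
          · intro hlK' j' hj'
            rcases Nat.lt_succ_iff_lt_or_eq.1 hj' with hj' | rfl
            · obtain ⟨i, hi, e⟩ := hv5 hlK j' hj'
              exact ⟨i, by omega, by rwa [Function.update_of_ne (by omega)]⟩
            · exact ⟨l, by omega, by simp [hx]⟩
      · intro hz
        have hz' : l < K → s₅.arr a_D x ≠ 0 := by
          intro h1 h2
          simp [← hl, hK5, h2] at hz
          omega
        refine (Spec.skip ⟨htl5, hl5, hq5, hB5, hS5, ?_⟩).le (by omega)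
        intro hlK j' hj'
        rcases Nat.lt_succ_iff_lt_or_eq.1 hj' with hj' | rfl
        · exact hv5 hlK j' hj'
        · by_contra hne
          push Not at hne
          exact hz' hlK (hB5.D_zero x hxn hne)
    · intro s₅ ⟨htl5, hl5, hq5, hB5, hS5, hv5⟩ _
      have hqh : s₅.arr a_q h = u := hq5 h hlt
      refine ⟨htl5, hB5, ?_, ?_⟩
      · intro hlK i hi hil v hv
        rcases Nat.lt_succ_iff_lt_or_eq.1 hi with hi | rfl
        · exact hS5 hlK i hi hil v hv
        · rw [hqh] at hv
          obtain ⟨j, hj, rfl⟩ := hΓ.complete u v hv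
          rcases le_or_gt (dg u) K with hle | hgt
          · exact hv5 hlK j (by omega)
          -- When `u` has more than `K` neighbours, the `K` scanned ones are distinct members of the
          -- queue, which contradicts that it is shorter than `K`.
          · exfalso
            have hmK : m = K := by omega
            rw [hmK] at hv5
            choose! f hf using hv5 hlK
            have : (Finset.range K).card ≤ (Finset.range (s₅.reg r_tl)).card :=
              Finset.card_le_card_of_injOn f (fun j hj => by
                simpa using (hf j (by simpa using hj)).1) (fun a ha b hb e => by
                  have ha' : a < K := by simpa using ha
                  have hb' : b < K := by simpa using hb
                  have h1 := (hf a ha').2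
                  have h2 := (hf b hb').2
                  rw [e, h2] at h1
                  exact (hΓ.inj u hun b (by omega) a (by omega) h1).symm)
            simp at this
            omega
      · have e1 : min h l₀ = h := by omega
        have e2 : min (h + 1) (s₅.reg r_tl) = h + 1 := by omega
        rw [e1] at ht3
        rw [e2, Finset.sum_range_succ, hqh, Finset.sum_congr rfl (fun i hi => by
          rw [hq5 i (by have := Finset.mem_range.1 hi; omega)])]
        omega
  · intro t s' ⟨h1, h2, h3, h4⟩ _
    rw [min_eq_right h1] at h4
    have := h2.sum_le (fun u => min (dg u) K) E hE h1
    simp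
    omega
  · intro s' ⟨t, h1, h2, h3, h4⟩ _
    exact ⟨h1, h2, fun hl i hi hil => h3 hl i (by omega) hil⟩

/-! ### Greedy choice of centers -/

/-- The number of entries of a row before the first one, among the first `m`, that is marked. -/
def hitPos (A row : ℕ → ℕ) : ℕ → ℕ
  | 0 => 0
  | m + 1 => if hitPos A row m = m ∧ A (row m) = 0 then m + 1 else hitPos A row m

theorem hitPos_le (A row : ℕ → ℕ) (m : ℕ) : hitPos A row m ≤ m := by
  induction m with
  | zero => exact le_rfl
  | succ m ih => rw [hitPos]; split_ifs <;> omega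

theorem eq_zero_of_lt_hitPos {A row : ℕ → ℕ} {m j : ℕ} (h : j < hitPos A row m) :
    A (row j) = 0 := by
  induction m with
  | zero => simp [hitPos] at h
  | succ m ih =>
    rw [hitPos] at h
    split_ifs at h with hc
    · rcases Nat.lt_succ_iff_lt_or_eq.1 h with h | rfl
      exacts [ih (by omega), hc.2]
    · exact ih h

theorem ne_zero_at_hitPos {A row : ℕ → ℕ} {m : ℕ} (h : hitPos A row m < m) :
    A (row (hitPos A row m)) ≠ 0 := by
  induction m with
  | zero => omega
  | succ m ih =>
    rw [hitPos] at h ⊢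
    split_ifs at h ⊢ with hc
    · omega
    · rcases lt_or_eq_of_le (hitPos_le A row m) with hl | hl
      · exact ih hl
      · rw [hl]
        exact fun h0 => hc ⟨hl, h0⟩

section Potential

variable (n s : ℕ) (l : ℕ → ℕ → ℕ) (A : ℕ → ℕ)

/-- The sum of `f` over the positions in `S` at which the row contains `w`. -/
def hitSum (row : ℕ → ℕ) (w : ℕ) (S : Finset ℕ) (f : ℕ → ℕ) : ℕ :=
  ∑ j ∈ S, if row j = w then f j else 0

/-- The number of rows in which `w` occurs before the first center. -/
def clusterSize (w : ℕ) : ℕ :=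
  ∑ v ∈ Finset.range n, hitSum (l v) w (Finset.range (hitPos A (l v) s)) fun _ => 1

/-- The cluster of `w` is too large. -/
def IsLarge (w : ℕ) : Prop := 16 * n < clusterSize n s l A w * clusterSize n s l A w

instance : DecidablePred (IsLarge n s l A) := fun _ => inferInstanceAs (Decidable (_ < _))

/-- The number of members with large clusters at the positions from `j` on, before the first
center of the row of `v`; a row without a center counts in addition. -/
def lateCount (v j : ℕ) : ℕ :=
  (if hitPos A (l v) s = s then 1 else 0) +
    ∑ i ∈ Finset.Ico j (hitPos A (l v) s), if IsLarge n s l A (l v i) then 1 else 0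

/-- The decrease of the potential when `w` becomes a center. -/
def gain (w : ℕ) : ℕ :=
  ∑ v ∈ Finset.range n, hitSum (l v) w (Finset.range (hitPos A (l v) s)) (lateCount n s l A v)

/-- The potential that the greedy choice drives to `0`. -/
def potential : ℕ := ∑ v ∈ Finset.range n, lateCount n s l A v 0

/-- The rows consist of distinct vertices. -/
structure IsRows : Prop where
  lt : ∀ v < n, ∀ j < s, l v j < n
  inj : ∀ v < n, ∀ i < s, ∀ j < s, l v i = l v j → i = j

end Potential

section Potential

variable {n s : ℕ} {l : ℕ → ℕ → ℕ} {A : ℕ → ℕ}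

/-! ### Averaging for the greedy potential -/

theorem hitSum_le {row : ℕ → ℕ} (h : ∀ i < s, ∀ j < s, row i = row j → i = j) (w : ℕ)
    {S : Finset ℕ} (hS : S ⊆ Finset.range s) {f : ℕ → ℕ} {B : ℕ} (hf : ∀ j ∈ S, f j ≤ B) :
    hitSum row w S f ≤ B := by
  by_cases hw : ∃ j ∈ S, row j = w
  · obtain ⟨j, hj, rfl⟩ := hw
    rw [hitSum, Finset.sum_eq_single j]
    · simpa using hf j hj
    · intro i hi hij
      rw [if_neg fun e => hij (h i (by simpa using hS hi) j (by simpa using hS hj) e)]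
    · exact fun hh => absurd hj hh
  · push Not at hw
    rw [hitSum, Finset.sum_eq_zero fun j hj => if_neg (hw j hj)]
    exact Nat.zero_le _

theorem lateCount_le (v j : ℕ) : lateCount n s l A v j ≤ s + 1 := by
  have h1 : ∑ i ∈ Finset.Ico j (hitPos A (l v) s), (if IsLarge n s l A (l v i) then 1 else 0) ≤
      ∑ i ∈ Finset.Ico j (hitPos A (l v) s), 1 :=
    Finset.sum_le_sum fun i _ => by split_ifs <;> omega
  have h2 := hitPos_le A (l v) s
  simp only [Finset.sum_const, Nat.card_Ico, smul_eq_mul, mul_one] at h1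
  unfold lateCount
  split_ifs <;> omega

theorem potential_le : potential n s l A ≤ n * (s + 1) := by
  have := Finset.sum_le_sum (s := Finset.range n) (fun v _ => lateCount_le (n := n) (s := s)
    (l := l) (A := A) v 0)
  simpa [potential] using this

/-- Every position contributes to the sum over all vertices exactly once. -/
theorem sum_hitSum (hl : IsRows n s l) (F : ℕ → ℕ → ℕ) (g : ℕ → ℕ) :
    ∑ w ∈ Finset.range n, g w * ∑ v ∈ Finset.range n,
      hitSum (l v) w (Finset.range (hitPos A (l v) s)) (F v) =
    ∑ v ∈ Finset.range n, ∑ j ∈ Finset.range (hitPos A (l v) s), g (l v j) * F v j := by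
  simp only [Finset.mul_sum, hitSum]
  rw [Finset.sum_comm]
  refine Finset.sum_congr rfl fun v hv => ?_
  rw [Finset.sum_comm]
  refine Finset.sum_congr rfl fun j hj => ?_
  have hj' : j < s := (Finset.mem_range.1 hj).trans_le (hitPos_le _ _ _)
  rw [Finset.sum_eq_single (l v j)]
  · simp
  · intro w _ hw
    simp [Ne.symm hw]
  · intro hh
    exact absurd (Finset.mem_range.2 (hl.lt v (Finset.mem_range.1 hv) j hj')) hh

/-- In the expanded square every pair `i ≠ j` occurs twice and every diagonal term once, while the
right side counts all pairs `j ≤ i`, the diagonal included, twice. -/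
theorem sq_sum_le_two_mul_sum_Ico (f : ℕ → ℕ) (hf : ∀ i, f i ≤ 1) (p : ℕ) :
    (∑ i ∈ Finset.range p, f i) ^ 2 ≤
      2 * ∑ j ∈ Finset.range p, f j * ∑ i ∈ Finset.Ico j p, f i := by
  induction p with
  | zero => simp
  | succ p ih =>
    have h1 : ∑ j ∈ Finset.range p, f j * ∑ i ∈ Finset.Ico j (p + 1), f i =
        ∑ j ∈ Finset.range p, f j * ∑ i ∈ Finset.Ico j p, f i +
          (∑ j ∈ Finset.range p, f j) * f p := by
      rw [Finset.sum_mul, ← Finset.sum_add_distrib]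
      refine Finset.sum_congr rfl fun j hj => ?_
      rw [Finset.sum_Ico_succ_top (by have := Finset.mem_range.1 hj; omega)]
      ring
    rw [Finset.sum_range_succ, Finset.sum_range_succ, h1]
    simp only [Nat.Ico_succ_singleton, Finset.sum_singleton]
    have h2 : f p * f p = f p := by
      have := hf p
      interval_cases f p <;> rfl
    nlinarith

/-- A vertex of maximal gain is worth at least the fraction `1 / (2 * s)` of the potential. -/
theorem potential_le_of_gain_le (hl : IsRows n s l) (hs : n ≤ s * s) (hs4 : s * s ≤ 4 * n)
    (hs0 : 0 < s) {M : ℕ} (hM : ∀ w < n, gain n s l A w ≤ M) :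
    potential n s l A ≤ 2 * s * M := by
  set U := ∑ v ∈ Finset.range n, if hitPos A (l v) s = s then 1 else 0 with hU
  set b : ℕ → ℕ := fun v => ∑ i ∈ Finset.range (hitPos A (l v) s),
    if IsLarge n s l A (l v i) then 1 else 0 with hb
  set Φ := ∑ v ∈ Finset.range n, b v with hΦ
  have hpot : potential n s l A = U + Φ := by
    simp only [potential, lateCount, Finset.sum_add_distrib, hU, hΦ, hb, Finset.range_eq_Ico]
  -- In a row without a center all `s` positions count, each with `lateCount` at least `1`. Summing
  -- the gains over all vertices gives `s * U ≤ n * M`, and `n ≤ s * s`.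
  have hUM : U ≤ s * M := by
    have h1 := sum_hitSum (A := A) hl (lateCount n s l A) (fun _ => 1)
    simp only [one_mul] at h1
    have h2 : ∑ w ∈ Finset.range n, gain n s l A w ≤ n * M := by
      have := Finset.sum_le_sum fun w hw => hM w (Finset.mem_range.1 hw)
      simpa using this
    have h3 : s * U ≤ ∑ w ∈ Finset.range n, gain n s l A w := by
      simp only [gain]
      rw [h1, hU, Finset.mul_sum]
      refine Finset.sum_le_sum fun v _ => ?_
      split_ifs with hv
      · rw [hv]
        have : ∑ j ∈ Finset.range s, 1 ≤ ∑ j ∈ Finset.range s, lateCount n s l A v j :=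
          Finset.sum_le_sum fun j _ => by
            rw [lateCount, if_pos hv]; omega
        simpa using this
      · simp
    have h4 : s * U ≤ s * (s * M) := by nlinarith
    exact Nat.le_of_mul_le_mul_left h4 hs0
  -- Now only the gains of the `c` vertices with large clusters are summed. A row with `b v` such
  -- positions contributes at least `b v ^ 2 / 2`, so the squares add up to at most `2 * c * M`, and
  -- Cauchy-Schwarz bounds `Φ ^ 2` by `2 * n * c * M`.
  have hΦM : Φ ≤ s * M := by
    set g : ℕ → ℕ := fun w => if IsLarge n s l A w then 1 else 0 with hg
    have hg1 : ∀ w, g w ≤ 1 := fun w => by simp only [hg]; split_ifs <;> omega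
    set c := ∑ w ∈ Finset.range n, g w with hc
    have h1 : ∑ w ∈ Finset.range n, g w * gain n s l A w = _ :=
      sum_hitSum (A := A) hl (lateCount n s l A) g
    have h2 : ∑ w ∈ Finset.range n, g w * gain n s l A w ≤ c * M := by
      rw [hc, Finset.sum_mul]
      exact Finset.sum_le_sum fun w hw => Nat.mul_le_mul_left _ (hM w (Finset.mem_range.1 hw))
    have h3 : ∑ v ∈ Finset.range n, b v ^ 2 ≤ 2 * (c * M) := by
      refine le_trans ?_ (Nat.mul_le_mul_left 2 h2)
      rw [h1, Finset.mul_sum]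
      refine Finset.sum_le_sum fun v _ => ?_
      refine (sq_sum_le_two_mul_sum_Ico (fun i => g (l v i)) (fun i => hg1 _) _).trans ?_
      refine Nat.mul_le_mul_left 2 (Finset.sum_le_sum fun j _ => Nat.mul_le_mul_left _ ?_)
      rw [lateCount]
      exact Nat.le_add_left _ _
    have h4 : Φ ^ 2 ≤ n * ∑ v ∈ Finset.range n, b v ^ 2 := by
      have := sq_sum_le_card_mul_sum_sq (s := Finset.range n) (f := b)
      simpa using this
    have h5 : ∑ w ∈ Finset.range n, g w * clusterSize n s l A w = Φ := by
      have := sum_hitSum (A := A) hl (fun _ _ => 1) g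
      simp only [mul_one] at this
      exact this
    -- Double counting: `Φ` is the sum of the sizes of the large clusters. Each of them exceeds `2 *
    -- s`, because its square exceeds `16 * n ≥ 4 * s * s`. This removes `c` from the previous
    -- bound.
    have h6 : 2 * s * c ≤ Φ := by
      rw [← h5, hc, Finset.mul_sum]
      refine Finset.sum_le_sum fun w _ => ?_
      simp only [hg]
      split_ifs with hw
      · have : 16 * n < clusterSize n s l A w * clusterSize n s l A w := hw
        nlinarith
      · simp
    rcases Nat.eq_zero_or_pos Φ with h0 | h0
    · omega
    · have h7 : s * Φ ^ 2 ≤ n * (Φ * M) := by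
        calc s * Φ ^ 2 ≤ s * (n * (2 * (c * M))) :=
              Nat.mul_le_mul_left _ (h4.trans (Nat.mul_le_mul_left _ h3))
          _ = n * ((2 * s * c) * M) := by ring
          _ ≤ n * (Φ * M) := Nat.mul_le_mul_left _ (Nat.mul_le_mul_right _ h6)
      have h8 : (s * Φ) * Φ ≤ (s * Φ) * (s * M) := by
        calc (s * Φ) * Φ = s * Φ ^ 2 := by ring
          _ ≤ n * (Φ * M) := h7
          _ ≤ s * s * (Φ * M) := Nat.mul_le_mul_right _ hs
          _ = _ := by ring
      exact Nat.le_of_mul_le_mul_left h8 (Nat.mul_pos hs0 h0)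
  rw [hpot]
  clear_value U Φ
  linarith

/-! ### The effect of a new center -/

theorem hitPos_le_of_imp {A' row : ℕ → ℕ} (h : ∀ w, A w ≠ 0 → A' w ≠ 0) :
    hitPos A' row s ≤ hitPos A row s := by
  by_contra hh
  have h1 : hitPos A row s < s := (not_le.1 hh).trans_le (hitPos_le _ _ _)
  exact h _ (ne_zero_at_hitPos h1) (eq_zero_of_lt_hitPos (not_le.1 hh))

theorem hitPos_le_of_mem {row : ℕ → ℕ} {j : ℕ} (h : A (row j) ≠ 0) : hitPos A row s ≤ j := by
  by_contra hh
  exact h (eq_zero_of_lt_hitPos (not_le.1 hh))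

theorem clusterSize_mono {A' : ℕ → ℕ} (h : ∀ w, A w ≠ 0 → A' w ≠ 0) (w : ℕ) :
    clusterSize n s l A' w ≤ clusterSize n s l A w :=
  Finset.sum_le_sum fun v _ => Finset.sum_le_sum_of_subset (by
    simpa using hitPos_le_of_imp h)

/-- A new center decreases the potential by its gain. -/
theorem potential_add_gain_le (hl : IsRows n s l) {A' : ℕ → ℕ} {b : ℕ} (hb : A' b ≠ 0)
    (h : ∀ w, A w ≠ 0 → A' w ≠ 0) :
    potential n s l A' + gain n s l A b ≤ potential n s l A := by
  rw [potential, gain, potential, ← Finset.sum_add_distrib]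
  refine Finset.sum_le_sum fun v hv => ?_
  have hv' := Finset.mem_range.1 hv
  have hle : hitPos A' (l v) s ≤ hitPos A (l v) s := hitPos_le_of_imp h
  have hps := hitPos_le A (l v) s
  -- More centers can only shrink clusters, so no cluster becomes large later.
  have hW : ∀ w, (if IsLarge n s l A' w then 1 else 0) ≤ if IsLarge n s l A w then 1 else 0 := by
    intro w
    have : IsLarge n s l A' w → IsLarge n s l A w := fun hw =>
      lt_of_lt_of_le hw (Nat.mul_le_mul (clusterSize_mono h w) (clusterSize_mono h w))
    split_ifs <;> first | omega | tauto
  -- If the row contains `b` at a position `j` before its first center, the new first center stands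
  -- at `j` or earlier. All that `lateCount` counts from `j` on then disappears, including the unit
  -- for a row without a center. In other rows nothing increases.
  by_cases hw : ∃ j < hitPos A (l v) s, l v j = b
  · obtain ⟨j, hj, rfl⟩ := hw
    have h1 : hitSum (l v) (l v j) (Finset.range (hitPos A (l v) s)) (lateCount n s l A v) =
        lateCount n s l A v j := by
      rw [hitSum, Finset.sum_eq_single j]
      · simp
      · intro i hi hij
        exact if_neg fun e => hij (hl.inj v hv' i
          ((Finset.mem_range.1 hi).trans_le hps) j (hj.trans_le hps) e)
      · exact fun hh => absurd (Finset.mem_range.2 hj) hh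
    have h2 : hitPos A' (l v) s ≤ j := hitPos_le_of_mem hb
    rw [h1, lateCount, if_neg (by omega), lateCount, lateCount,
      ← Finset.sum_Ico_consecutive _ (Nat.zero_le j) hj.le]
    have h3 : ∑ i ∈ Finset.Ico 0 (hitPos A' (l v) s),
        (if IsLarge n s l A' (l v i) then 1 else 0) ≤
        ∑ i ∈ Finset.Ico 0 j, if IsLarge n s l A (l v i) then 1 else 0 :=
      (Finset.sum_le_sum fun i _ => hW _).trans
        (Finset.sum_le_sum_of_subset (Finset.Ico_subset_Ico_right h2))
    omega
  · push Not at hw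
    have h1 : hitSum (l v) b (Finset.range (hitPos A (l v) s)) (lateCount n s l A v) = 0 :=
      Finset.sum_eq_zero fun j hj => if_neg (hw j (Finset.mem_range.1 hj))
    have h3 : ∑ i ∈ Finset.Ico 0 (hitPos A' (l v) s),
        (if IsLarge n s l A' (l v i) then 1 else 0) ≤
        ∑ i ∈ Finset.Ico 0 (hitPos A (l v) s), if IsLarge n s l A (l v i) then 1 else 0 :=
      (Finset.sum_le_sum fun i _ => hW _).trans
        (Finset.sum_le_sum_of_subset (Finset.Ico_subset_Ico_right hle))
    rw [h1, lateCount, lateCount]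
    have h4 : (if hitPos A' (l v) s = s then 1 else 0) ≤
        if hitPos A (l v) s = s then 1 else 0 := by
      split_ifs <;> omega
    omega

/-- When the potential is `0`, every row contains a center and no cluster is large. -/
theorem of_potential_eq_zero (h : potential n s l A = 0) :
    (∀ v < n, hitPos A (l v) s < s) ∧ ∀ w, ¬ IsLarge n s l A w := by
  have h0 : ∀ v < n, lateCount n s l A v 0 = 0 := fun v hv =>
    Finset.sum_eq_zero_iff.1 h v (Finset.mem_range.2 hv)
  refine ⟨fun v hv => ?_, fun w hw => ?_⟩
  · have h1 := h0 v hv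
    have h2 := hitPos_le A (l v) s
    rw [lateCount] at h1
    split_ifs at h1 <;> omega
  -- At potential `0` a vertex with a large cluster would occur in no row before the first center,
  -- so that its cluster would be empty.
  · have h1 : clusterSize n s l A w = 0 := by
      refine Finset.sum_eq_zero fun v hv => Finset.sum_eq_zero fun j hj => if_neg ?_
      rintro rfl
      have h2 := h0 v (Finset.mem_range.1 hv)
      rw [lateCount, Nat.add_eq_zero_iff, Finset.sum_eq_zero_iff] at h2
      have h3 := h2.2 j (by simpa using hj)
      simp [hw] at h3
    have h2 : 16 * n < clusterSize n s l A w * clusterSize n s l A w := hw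
    rw [h1] at h2
    omega

/-! ### Geometric decay -/

theorem pow_add_mul_pow_le_succ_pow (m k : ℕ) : m ^ (k + 1) + (k + 1) * m ^ k ≤ (m + 1) ^ (k + 1) := by
  induction k with
  | zero => simp
  | succ k ih =>
    calc m ^ (k + 2) + (k + 2) * m ^ (k + 1)
        ≤ (m ^ (k + 1) + (k + 1) * m ^ k) * (m + 1) := by
          have : 0 ≤ (k + 1) * m ^ k := Nat.zero_le _
          ring_nf
          nlinarith
      _ ≤ (m + 1) ^ (k + 1) * (m + 1) := Nat.mul_le_mul_right _ ih
      _ = _ := by ring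

/-- This is `(1 + 1/m) ^ (m + 1) ≥ 2` by Bernoulli's inequality. With `m + 1 = 2 * s` it says that
`2 * s` greedy rounds at least halve the potential. -/
theorem two_mul_pow_le_succ_pow (m : ℕ) : 2 * m ^ (m + 1) ≤ (m + 1) ^ (m + 1) := by
  refine le_trans ?_ (pow_add_mul_pow_le_succ_pow m m)
  rw [pow_succ]
  nlinarith [Nat.zero_le (m ^ m)]

/-- A quantity that shrinks by the factor `1 - 1 / (2 * s)` in each of `2 * s * k` rounds
vanishes if it is initially below `2 ^ k`. -/
theorem eq_zero_of_geometric {s k P P₀ : ℕ} (hs : 0 < s) (h0 : P₀ < 2 ^ k)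
    (h : P * (2 * s) ^ (2 * s * k) ≤ P₀ * (2 * s - 1) ^ (2 * s * k)) : P = 0 := by
  by_contra hP
  obtain ⟨m, hm⟩ : ∃ m, 2 * s = m + 1 := ⟨2 * s - 1, by omega⟩
  rw [hm, Nat.add_sub_cancel] at h
  have h1 : 2 ^ k * m ^ ((m + 1) * k) ≤ (m + 1) ^ ((m + 1) * k) := by
    rw [pow_mul, pow_mul, ← mul_pow]
    exact Nat.pow_le_pow_left (two_mul_pow_le_succ_pow m) k
  have hm0 : 0 < m ^ ((m + 1) * k) := pow_pos (by omega) _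
  have h2 : P₀ * m ^ ((m + 1) * k) < 2 ^ k * m ^ ((m + 1) * k) := Nat.mul_lt_mul_of_pos_right h0 hm0
  have h3 : 1 * (m + 1) ^ ((m + 1) * k) ≤ P * (m + 1) ^ ((m + 1) * k) :=
    Nat.mul_le_mul_right _ (by omega)
  omega

end Potential

/-! ### The program for the choice of centers -/

notation "r_k" => 112
notation "r_b" => 113
notation "r_t" => 114
notation "a_ls" => 206
notation "a_dl" => 207
notation "a_in" => 208
notation "a_cs" => 209
notation "a_gn" => 210
notation "a_hp" => 211

/-- Row `v` of an array with rows of length `n`. -/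
def rowsOf (n : ℕ) (f : ℕ → ℕ) (v j : ℕ) : ℕ := f (v * n + j)

/-- Reset the counters. -/
def clearCmd : Cmd := .loop r_x &r_n (.put a_cs &r_x 0 ;; .put a_gn &r_x 0)

/-- Find the first center of every row and the sizes of the clusters. -/
def hitCmd : Cmd :=
  .loop r_u &r_n (.put a_hp &r_u 0 ;;
    .loop r_j &r_s (r_x ≔ .get a_ls (&r_u * &r_n + &r_j) ;;
      .ite (.eq (.get a_hp &r_u) &r_j * .eq (.get a_in &r_x) 0)
        (.put a_hp &r_u (&r_j + 1) ;; .put a_cs &r_x (.get a_cs &r_x + 1)) .skip))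

/-- Compute the gains. -/
def gainCmd : Cmd :=
  .loop r_u &r_n (r_k ≔ .eq (.get a_hp &r_u) &r_s ;;
    .loop r_j (.get a_hp &r_u)
      (r_x ≔ .get a_ls (&r_u * &r_n + (.get a_hp &r_u - 1 - &r_j)) ;;
      .ite (.lt (16 * &r_n) (.get a_cs &r_x * .get a_cs &r_x)) (r_k ≔ &r_k + 1) .skip ;;
      .put a_gn &r_x (.get a_gn &r_x + &r_k)))

/-- Make a vertex of maximal gain a center. -/
def pickCmd : Cmd :=
  r_b ≔ 0 ;;
  .loop r_x &r_n (.ite (.lt (.get a_gn &r_b) (.get a_gn &r_x)) (r_b ≔ &r_x) .skip) ;;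
  .put a_in &r_b 1

/-- One round of the greedy choice. -/
def roundCmd : Cmd := clearCmd ;; hitCmd ;; gainCmd ;; pickCmd

theorem spec_clearCmd {N n : ℕ} (hN : Big n N) (s : Store) (hn : s.reg r_n = n) :
    Spec N clearCmd s (30 * n + 10) (fun s' =>
      (∀ x < n, s'.arr a_cs x = 0) ∧ ∀ x < n, s'.arr a_gn x = 0) := by
  refine Spec.le (Spec.loop (fun i s' => (∀ x < i, s'.arr a_cs x = 0) ∧
    ∀ x < i, s'.arr a_gn x = 0) n 19 hn trivial (by simp) ?_) (by simp; omega)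
  intro i hi s₁ ⟨h1, h2⟩ hF
  refine Spec.flat rfl (by simp [Cmd.ok, hN.zero_lt]) (by decide) ?_
  simp only [Cmd.den, Ex.eval_var, Ex.eval_zero, Store.reg_setReg, Store.arr_setReg,
    Store.arr_setArr, Store.reg_setArr, Nat.reduceEqDiff, reduceIte]
  constructor <;>
  · intro x hx
    rw [Function.update_apply]
    split_ifs with h
    · rfl
    · first | exact h1 x (by omega) | exact h2 x (by omega)

/-- The part of the cluster of `w` among the first `u` rows. -/
def partialSize (s : ℕ) (l : ℕ → ℕ → ℕ) (A : ℕ → ℕ) (u w : ℕ) : ℕ :=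
  ∑ v ∈ Finset.range u, hitSum (l v) w (Finset.range (hitPos A (l v) s)) fun _ => 1

theorem sum_hitSum_le {n s : ℕ} {l : ℕ → ℕ → ℕ} (hl : IsRows n s l) (A : ℕ → ℕ)
    (F : ℕ → ℕ → ℕ) {B u : ℕ} (hu : u ≤ n) (hF : ∀ v j, F v j ≤ B) (w : ℕ) :
    ∑ v ∈ Finset.range u, hitSum (l v) w (Finset.range (hitPos A (l v) s)) (F v) ≤ u * B := by
  have : ∑ v ∈ Finset.range u, hitSum (l v) w (Finset.range (hitPos A (l v) s)) (F v) ≤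
      ∑ v ∈ Finset.range u, B := Finset.sum_le_sum fun v hv =>
    hitSum_le (hl.inj v (by have := Finset.mem_range.1 hv; omega)) w
      (by simpa using hitPos_le A (l v) s) fun j _ => hF v j
  simpa using this

theorem spec_hitCmd {N n s₀ : ℕ} (hN : Big n N) (s : Store) (hn : s.reg r_n = n)
    (hs : s.reg r_s = s₀) (hsn : s₀ ≤ n) (hl : IsRows n s₀ (rowsOf n (s.arr a_ls)))
    (h0 : ∀ x < n, s.arr a_cs x = 0) :
    Spec N hitCmd s (n * (s₀ * 100 + 40) + 10) (fun s' =>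
      (∀ v < n, s'.arr a_hp v = hitPos (s.arr a_in) (rowsOf n (s.arr a_ls) v) s₀) ∧
      ∀ w < n, s'.arr a_cs w = clusterSize n s₀ (rowsOf n (s.arr a_ls)) (s.arr a_in) w) := by
  set l := rowsOf n (s.arr a_ls) with hl'
  set A := s.arr a_in with hA
  refine Spec.mono (Spec.loop (fun u s' => (∀ v < u, s'.arr a_hp v = hitPos A (l v) s₀) ∧
    ∀ w < n, s'.arr a_cs w = partialSize s₀ l A u w) n (s₀ * 100 + 29) hn trivial
    ⟨by simp, fun w hw => by simp [partialSize, h0 w hw]⟩ ?_) (by simp; ring_nf; omega)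
    (fun s' h _ => h)
  intro u hu s₁ ⟨h1, h2⟩ hF1
  have hn1 : s₁.reg r_n = n := (hF1.reg r_n rfl).trans hn
  have hs1 : s₁.reg r_s = s₀ := (hF1.reg r_s rfl).trans hs
  have hls1 : s₁.arr a_ls = s.arr a_ls := hF1.arr a_ls rfl
  have hA1 : s₁.arr a_in = A := hF1.arr a_in rfl
  refine Spec.le (Spec.seq (R := fun s' => s' =
    (s₁.setReg r_u u).setArr a_hp u 0) (Spec.put (by simp) (by simpa using hN.zero_lt)
      (by simp)) (T₂ := s₀ * 100 + 18) ?_) (by simp; omega)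
  rintro _ rfl -
  refine Spec.mono (Spec.loop (fun j s' => (∀ v < u, s'.arr a_hp v = hitPos A (l v) s₀) ∧
    s'.arr a_hp u = hitPos A (l u) j ∧
    ∀ w < n, s'.arr a_cs w = partialSize s₀ l A u w +
      hitSum (l u) w (Finset.range (hitPos A (l u) j)) fun _ => 1) s₀ 89
    (by simpa using hs1) trivial ?_ ?_) (by simp; omega) ?_
  · refine ⟨fun v hv => ?_, ?_, fun w hw => ?_⟩
    · simpa [Function.update_apply, show v ≠ u by omega] using h1 v hv
    · simp [hitPos]
    · simpa [hitPos, hitSum] using h2 w hw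
  · intro j hj s₂ ⟨g1, g2, g3⟩ hF2
    have hn2 : s₂.reg r_n = n := (hF2.reg r_n rfl).trans (by simpa using hn1)
    have hu2 : s₂.reg r_u = u := (hF2.reg r_u rfl).trans (by simp)
    have hls2 : s₂.arr a_ls = s.arr a_ls := (hF2.arr a_ls rfl).trans (by simpa using hls1)
    have hA2 : s₂.arr a_in = A := (hF2.arr a_in rfl).trans (by simpa using hA1)
    set x := l u j with hx
    have hxn : x < n := hl.lt u hu j hj
    have hx2 : s.arr a_ls (u * n + j) = x := rfl
    refine Spec.le (Spec.seq (R := fun s' => s' = (s₂.setReg r_j j).setReg r_x x)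
      (Spec.assign ?_ ?_) (T₂ := 65) ?_) (by simp)
    · simpa [hu2, hn2] using ⟨hN.mul hu.le le_rfl, hN.idx hu.le le_rfl (by omega)⟩
    · simp [hu2, hn2, hls2, hx2]
    rintro _ rfl -
    have hcs : s₂.arr a_cs x ≤ n := by
      rw [g3 x hxn]
      have e1 := sum_hitSum_le hl A (fun _ _ => 1) hu.le (fun _ _ => le_rfl) x
      have e2 := hitSum_le (hl.inj u hu) x (S := Finset.range (hitPos A (l u) j))
        (by simpa using (hitPos_le A (l u) j).trans hj.le) (f := fun _ => 1) (fun _ _ => le_rfl)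
      have e3 : partialSize s₀ l A u x ≤ u * 1 := e1
      omega
    by_cases hc : hitPos A (l u) j = j ∧ A x = 0
    · have hstep : hitPos A (l u) (j + 1) = j + 1 := by rw [hitPos, if_pos hc]
      refine Spec.le (Spec.ite (T := 40) ?_ (fun _ => Spec.flat rfl ?_ (by decide) ?_) ?_) (by simp)
      · simp [hc.1, hu2, g2, hA2, hc.2, hN.zero_lt, hN.one_lt]
      · simpa [Cmd.ok, Cmd.den, hu2, hN.one_lt] using
          ⟨hN.lin (x := j + 1) (by omega), hN.lin (x := s₂.arr a_cs x + 1) (by omega)⟩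
      · simp only [Cmd.den, Ex.eval_var, Ex.eval_add, Ex.eval_get, Ex.eval_one, Store.reg_setReg,
            Store.arr_setReg, Store.arr_setArr, Store.reg_setArr, Nat.reduceEqDiff, reduceIte, hu2]
        refine ⟨fun v hv => ?_, ?_, fun w hw => ?_⟩
        · rw [Function.update_of_ne (by omega), g1 v hv]
        · rw [Function.update_self, hstep]
        · rw [hstep, Function.update_apply, hitSum, Finset.sum_range_succ]
          have h3 := g3 w hw
          rw [hc.1, hitSum] at h3
          split_ifs with hwx hwx' hwx'
          · rw [← hwx, h3]; ring
          · exact absurd hwx.symm hwx'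
          · exact absurd hwx'.symm hwx
          · rw [h3]; ring
      · intro hz
        simp [hc.1, hu2, g2, hA2, hc.2] at hz
    · have hstep : hitPos A (l u) (j + 1) = hitPos A (l u) j := by rw [hitPos, if_neg hc]
      refine Spec.le (Spec.ite (T := 40) ?_ ?_ (fun _ => (Spec.skip ?_).le (by omega))) (by simp)
      · simp only [Ex.ok_mul, Ex.ok_var, Ex.ok_eq, Ex.ok_get, Ex.ok_zero, and_true,
          true_and, Ex.eval_eq]
        refine ⟨hN.zero_lt, hN.const ?_⟩
        split_ifs <;> omega
      · intro hz
        refine absurd ?_ hc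
        simpa [hu2, g2, hA2, and_comm] using hz
      · simp only [Store.arr_setReg]
        rw [hstep]
        exact ⟨g1, g2, g3⟩
  · intro s' ⟨g1, g2, g3⟩ _
    refine ⟨fun v hv => ?_, fun w hw => ?_⟩
    · rcases Nat.lt_succ_iff_lt_or_eq.1 hv with hv | rfl
      exacts [g1 v hv, g2]
    · rw [g3 w hw, partialSize, partialSize, Finset.sum_range_succ]

/-- Each row is traversed backwards from its first center, or from its end if it has none. The
counter `r_k` is then the suffix count `lateCount` at the current position, and all gains are found
in one pass of `O(n * s)` steps. -/
theorem spec_gainCmd {N n s₀ : ℕ} (hN : Big n N) (s : Store) (hn : s.reg r_n = n)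
    (hs : s.reg r_s = s₀) (hsn : s₀ ≤ n) (A : ℕ → ℕ)
    (hl : IsRows n s₀ (rowsOf n (s.arr a_ls)))
    (h0 : ∀ x < n, s.arr a_gn x = 0)
    (hhp : ∀ v < n, s.arr a_hp v = hitPos A (rowsOf n (s.arr a_ls) v) s₀)
    (hcs : ∀ w < n, s.arr a_cs w = clusterSize n s₀ (rowsOf n (s.arr a_ls)) A w) :
    Spec N gainCmd s (n * (s₀ * 110 + 60) + 10) (fun s' =>
      ∀ w < n, s'.arr a_gn w = gain n s₀ (rowsOf n (s.arr a_ls)) A w) := by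
  set l := rowsOf n (s.arr a_ls) with hl'
  refine Spec.mono (Spec.loop (fun u s' => ∀ w < n, s'.arr a_gn w =
    ∑ v ∈ Finset.range u, hitSum (l v) w (Finset.range (hitPos A (l v) s₀))
      (lateCount n s₀ l A v)) n (s₀ * 110 + 49) hn trivial
    (fun w hw => by simp [h0 w hw]) ?_) (by simp; ring_nf; omega)
    (fun s' h _ => h)
  intro u hu s₁ h1 hF1
  have hn1 : s₁.reg r_n = n := (hF1.reg r_n rfl).trans hn
  have hs1 : s₁.reg r_s = s₀ := (hF1.reg r_s rfl).trans hs
  have hls1 : s₁.arr a_ls = s.arr a_ls := hF1.arr a_ls rfl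
  have hhp1 : s₁.arr a_hp = s.arr a_hp := hF1.arr a_hp rfl
  have hcs1 : s₁.arr a_cs = s.arr a_cs := hF1.arr a_cs rfl
  set p := hitPos A (l u) s₀ with hp
  have hps : p ≤ s₀ := hitPos_le _ _ _
  have hpu : s.arr a_hp u = p := hhp u hu
  refine Spec.le (Spec.seq (R := fun s' => s' =
    (s₁.setReg r_u u).setReg r_k (if p = s₀ then 1 else 0)) (Spec.assign (by simp)
      (by simp [hhp1, hpu, hs1])) (T₂ := s₀ * 110 + 18) ?_) (by simp; omega)
  rintro _ rfl -
  refine Spec.mono (Spec.loop (fun j s' => s'.reg r_k = lateCount n s₀ l A u (p - j) ∧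
    ∀ w < n, s'.arr a_gn w = ∑ v ∈ Finset.range u, hitSum (l v) w
      (Finset.range (hitPos A (l v) s₀)) (lateCount n s₀ l A v) +
      hitSum (l u) w (Finset.Ico (p - j) p) (lateCount n s₀ l A u)) p 99
    (by simp [hhp1, hpu]) trivial ?_ ?_) (by simp; omega) ?_
  · refine ⟨?_, fun w hw => ?_⟩
    · simp [lateCount, ← hp]
    · simpa [hitSum] using h1 w hw
  · intro j hj s₂ ⟨g1, g2⟩ hF2
    have hn2 : s₂.reg r_n = n := (hF2.reg r_n rfl).trans (by simpa using hn1)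
    have hu2 : s₂.reg r_u = u := (hF2.reg r_u rfl).trans (by simp)
    have hls2 : s₂.arr a_ls = s.arr a_ls := (hF2.arr a_ls rfl).trans (by simpa using hls1)
    have hhp2 : s₂.arr a_hp = s.arr a_hp := (hF2.arr a_hp rfl).trans (by simpa using hhp1)
    have hcs2 : s₂.arr a_cs = s.arr a_cs := (hF2.arr a_cs rfl).trans (by simpa using hcs1)
    have hi : p - 1 - j < p := by omega
    set i := p - 1 - j with hij
    have hj1 : p - (j + 1) = i := by omega
    have hj2 : p - j = i + 1 := by omega
    set x := l u i with hx
    have hxn : x < n := hl.lt u hu i (by omega)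
    have hx2 : s.arr a_ls (u * n + i) = x := rfl
    refine Spec.le (Spec.seq (R := fun s' => s' = (s₂.setReg r_j j).setReg r_x x)
      (Spec.assign ?_ ?_) (T₂ := 65) ?_) (by simp)
    · simpa [hu2, hn2, hhp2, hpu, hN.one_lt, ← hij] using
        ⟨hN.mul hu.le le_rfl, hN.idx hu.le le_rfl (by omega : i ≤ n)⟩
    · simp [hu2, hn2, hls2, hx2, hhp2, hpu, ← hij]
    rintro _ rfl -
    have hcn : s.arr a_cs x ≤ n := by
      rw [hcs x hxn]
      simpa [clusterSize] using sum_hitSum_le hl A (fun _ _ => 1) le_rfl (fun _ _ => le_rfl) x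
    have hk1 : s₂.reg r_k ≤ s₀ + 1 := g1 ▸ lateCount_le u (p - j)
    have hlate : lateCount n s₀ l A u i =
        (if IsLarge n s₀ l A x then 1 else 0) + lateCount n s₀ l A u (i + 1) := by
      simp only [lateCount]
      rw [Finset.sum_eq_sum_Ico_succ_bot (hp ▸ hi)]
      ring
    have hlarge : 16 * n < s.arr a_cs x * s.arr a_cs x ↔ IsLarge n s₀ l A x := by
      rw [hcs x hxn]
      rfl
    refine Spec.le (Spec.seq (T₁ := 45) (R := fun s' =>
      s' = ((s₂.setReg r_j j).setReg r_x x).setReg r_k (lateCount n s₀ l A u i))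
      (T₂ := 19) ?_ ?_) (by omega)
    · refine Spec.le (Spec.ite (T := 11) ?_ (fun hz => ?_) (fun hz => ?_)) (by simp)
      · simpa [hn2, hcs2, hN.sixteen_lt] using
          ⟨hN.lin (x := 16 * n) (by omega), hN.mul hcn hcn⟩
      · have hz' : IsLarge n s₀ l A x := hlarge.1 (by simpa [hn2, hcs2] using hz)
        refine Spec.assign ?_ ?_
        · simpa [hN.one_lt] using hN.lin (x := s₂.reg r_k + 1) (by omega)
        · rw [hlate, if_pos hz', ← hj2, ← g1]
          simp [Nat.add_comm]
      · have hz' : ¬ IsLarge n s₀ l A x := fun hh => by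
          have := hlarge.2 hh
          simp [hn2, hcs2] at hz
          omega
        refine (Spec.skip ?_).le (by omega)
        rw [hlate, if_neg hz', ← hj2, ← g1, Nat.zero_add]
        simp only [Store.setReg]
        congr 1
        funext y
        simp only [Function.update_apply]
        split_ifs <;> simp_all
    rintro _ rfl -
    refine Spec.le (Spec.put (by simp) ?_ ?_) (by simp)
    · have hg : s₂.arr a_gn x ≤ u * (s₀ + 1) + (s₀ + 1) := by
        rw [g2 x hxn]
        refine Nat.add_le_add (sum_hitSum_le hl A _ hu.le (fun _ _ => lateCount_le _ _) x) ?_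
        refine hitSum_le (hl.inj u hu) x (fun t ht => ?_) fun _ _ => lateCount_le _ _
        have := Finset.mem_Ico.1 ht
        simp
        omega
      have hle : lateCount n s₀ l A u i ≤ s₀ + 1 := lateCount_le u i
      have : s₂.arr a_gn x + lateCount n s₀ l A u i < N := hN.of_sq (by nlinarith)
      simpa using this
    · refine ⟨by simp [hj1], fun w hw => ?_⟩
      have h3 := g2 w hw
      rw [hj1, hitSum, Finset.sum_eq_sum_Ico_succ_bot hi, ← hj2]
      simp only [Store.arr_setArr, Store.arr_setReg, reduceIte, Store.reg_setReg, Ex.eval_var,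
        Ex.eval_add, Ex.eval_get, Nat.reduceEqDiff]
      rw [Function.update_apply]
      rw [hitSum] at h3
      split_ifs with hwx hwx' hwx'
      · rw [← hwx, h3]; ring
      · exact absurd hwx.symm hwx'
      · exact absurd hwx'.symm hwx
      · rw [h3]; ring
  · intro s' ⟨g1, g2⟩ _ w hw
    rw [g2 w hw, Finset.sum_range_succ, Nat.sub_self, ← Finset.range_eq_Ico]

theorem spec_pickCmd {N n : ℕ} (hN : Big n N) (s : Store) (hn : s.reg r_n = n) (h0 : 0 < n) :
    Spec N pickCmd s (40 * n + 30) (fun s' => ∃ b < n,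
      (∀ w < n, s.arr a_gn w ≤ s.arr a_gn b) ∧
      s'.arr a_in = Function.update (s.arr a_in) b 1) := by
  refine Spec.le (Spec.seq (R := fun s' => s' = s.setReg r_b 0)
    (Spec.assign (by simpa using hN.zero_lt) (by simp)) (T₂ := 33 * n + 20) ?_) (by simp; omega)
  rintro _ rfl -
  refine Spec.le (Spec.seq (R := fun s' => s'.reg r_b < n ∧ s'.arr = s.arr ∧
    ∀ w < n, s.arr a_gn w ≤ s.arr a_gn (s'.reg r_b)) (T₁ := 33 * n + 9) (T₂ := 7)
    (Spec.mono (Spec.loop (fun i s' => s'.reg r_b < n ∧ s'.arr = s.arr ∧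
      ∀ w < i, s.arr a_gn w ≤ s.arr a_gn (s'.reg r_b)) n 22 (by simpa using hn) trivial
      (by simpa using h0) ?_) ?_ fun s' h _ => h) ?_) (by omega)
  · intro i hi s₁ ⟨h1, h2, h3⟩ hF
    refine Spec.flat rfl (by simp [Cmd.ok]) (by decide) ?_
    simp only [Cmd.den, Ex.eval_var, Ex.eval_get, Ex.eval_lt', Store.reg_setReg, Store.arr_setReg,
      Nat.reduceEqDiff, reduceIte, h2]
    split_ifs with hc hc' hc'
    · refine ⟨by simpa using hi, by simp [h2], fun w hw => ?_⟩
      simp only [Store.reg_setReg, reduceIte]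
      rcases Nat.lt_succ_iff_lt_or_eq.1 hw with hw | rfl
      exacts [(h3 w hw).trans hc.le, le_rfl]
    · simp at hc'
    · simp at hc'
    · refine ⟨by simpa using h1, by simp [h2], fun w hw => ?_⟩
      simp only [Store.reg_setReg, Nat.reduceEqDiff, reduceIte]
      rcases Nat.lt_succ_iff_lt_or_eq.1 hw with hw | rfl
      exacts [h3 w hw, not_lt.1 hc]
  · simp
    omega
  · intro s₁ ⟨h1, h2, h3⟩ _
    refine Spec.put (by simp) (by simpa using hN.one_lt) ⟨s₁.reg r_b, h1, h3, ?_⟩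
    simp [h2]

/-- With `P`, `P'` the potentials before and after the round and `g` the maximal gain, `P' + g ≤ P ≤
2 * s * g`; multiplying the first inequality by `2 * s` gives the contraction without division. -/
theorem spec_roundCmd {N n s₀ : ℕ} (hN : Big n N) (s : Store) (hn : s.reg r_n = n)
    (hs : s.reg r_s = s₀) (hs0 : 0 < s₀) (hsn : s₀ ≤ n) (hs1 : n ≤ s₀ * s₀)
    (hs4 : s₀ * s₀ ≤ 4 * n) (hl : IsRows n s₀ (rowsOf n (s.arr a_ls))) :
    Spec N roundCmd s (n * (s₀ * 210 + 170) + 70) (fun s' => ∃ b < n,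
      s'.arr a_in = Function.update (s.arr a_in) b 1 ∧
      potential n s₀ (rowsOf n (s.arr a_ls)) (s'.arr a_in) * (2 * s₀) ≤
        potential n s₀ (rowsOf n (s.arr a_ls)) (s.arr a_in) * (2 * s₀ - 1)) := by
  refine Spec.le (Spec.seq (spec_clearCmd hN s hn) (T₂ := n * (s₀ * 210 + 140) + 55) ?_) (by
    ring_nf; omega)
  intro s₁ ⟨hc1, hg1⟩ hF1
  have hls1 : s₁.arr a_ls = s.arr a_ls := hF1.arr a_ls rfl
  have hA1 : s₁.arr a_in = s.arr a_in := hF1.arr a_in rfl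
  have hn1 : s₁.reg r_n = n := (hF1.reg r_n rfl).trans hn
  have hs1' : s₁.reg r_s = s₀ := (hF1.reg r_s rfl).trans hs
  refine Spec.le (Spec.seq (spec_hitCmd hN s₁ hn1 hs1' hsn (hls1 ▸ hl) hc1)
    (T₂ := n * (s₀ * 110 + 100) + 42) ?_) (by ring_nf; omega)
  rw [hls1, hA1]
  intro s₂ ⟨hh2, hc2⟩ hF2
  have hls2 : s₂.arr a_ls = s.arr a_ls := (hF2.arr a_ls rfl).trans hls1
  have hA2 : s₂.arr a_in = s.arr a_in := (hF2.arr a_in rfl).trans hA1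
  have hn2 : s₂.reg r_n = n := (hF2.reg r_n rfl).trans hn1
  have hs2 : s₂.reg r_s = s₀ := (hF2.reg r_s rfl).trans hs1'
  have hg2 : s₂.arr a_gn = s₁.arr a_gn := hF2.arr a_gn rfl
  refine Spec.le (Spec.seq (spec_gainCmd hN s₂ hn2 hs2 hsn (s.arr a_in) (hls2 ▸ hl)
    (fun x hx => by rw [hg2, hg1 x hx]) (fun v hv => by rw [hls2, hh2 v hv])
    (fun w hw => by rw [hls2, hc2 w hw])) (T₂ := 40 * n + 30) ?_) (by ring_nf; omega)
  rw [hls2]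
  intro s₃ hg3 hF3
  have hA3 : s₃.arr a_in = s.arr a_in := (hF3.arr a_in rfl).trans hA2
  have hn3 : s₃.reg r_n = n := (hF3.reg r_n rfl).trans hn2
  refine (spec_pickCmd hN s₃ hn3 (by omega)).mono le_rfl ?_
  rintro s₄ ⟨b, hb, hmax, e⟩ _
  rw [hA3] at e
  refine ⟨b, hb, e, ?_⟩
  set l := rowsOf n (s.arr a_ls)
  have h1 := potential_le_of_gain_le hl hs1 hs4 hs0 (A := s.arr a_in)
    (M := gain n s₀ l (s.arr a_in) b) (fun w hw => by
      rw [← hg3 w hw, ← hg3 b hb]; exact hmax w hw)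
  have h2 := potential_add_gain_le hl (A := s.arr a_in) (A' := s₄.arr a_in) (b := b)
    (by rw [e]; simp) (fun w hw => by
      rw [e, Function.update_apply]
      split_ifs <;> simp [hw])
  obtain ⟨m, hm⟩ : ∃ m, 2 * s₀ = m + 1 := ⟨2 * s₀ - 1, by omega⟩
  rw [hm] at h1 ⊢
  rw [Nat.add_sub_cancel]
  nlinarith

/-! ### An additive spanner from clusters of decreasing degree -/

/-- The edges of `G` that are not between two marked vertices. -/
def unmarkedPart {V : Type*} (G : SimpleGraph V) (μ : V → Prop) : SimpleGraph V where
  Adj u v := G.Adj u v ∧ ¬ (μ u ∧ μ v)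
  symm := ⟨fun _ _ h => ⟨h.1.symm, fun hh => h.2 ⟨hh.2, hh.1⟩⟩⟩
  loopless := ⟨fun _ h => h.1.ne rfl⟩

theorem unmarkedPart_le {V : Type*} (G : SimpleGraph V) (μ : V → Prop) : unmarkedPart G μ ≤ G :=
  fun _ _ h => h.1

/-- Vertices are clustered around centers whose shortest paths in the old unmarked part are added
to `H`. Then shortest paths stay in the unmarked part or are replaced up to an error of `2`. -/
theorem spanner_step {V : Type*} {G H H' : SimpleGraph V} {μ μ' cen : V → Prop}
    (hH : H ≤ H') (hμ : ∀ x, μ' x → μ x ∨ ∃ c, cen c ∧ G.Adj c x)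
    (hc : ∀ c, cen c → ∀ x, H'.edist c x ≤ (unmarkedPart G μ).edist c x)
    (h : ∀ u v, (unmarkedPart G μ).edist u v ≤ G.edist u v ∨ H.edist u v ≤ G.edist u v + 2)
    (u v : V) :
    (unmarkedPart G μ').edist u v ≤ G.edist u v ∨ H'.edist u v ≤ G.edist u v + 2 := by
  classical
  rcases h u v with h | h
  swap
  · exact Or.inr ((SimpleGraph.edist_anti hH).trans h)
  by_cases hr : (unmarkedPart G μ).Reachable u v
  swap
  · rw [SimpleGraph.edist_eq_top_of_not_reachable hr, top_le_iff] at h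
    rw [h]
    exact Or.inl le_top
  obtain ⟨p, hp⟩ := hr.exists_walk_length_eq_edist
  by_cases hz : ∃ z ∈ p.support, μ' z ∧ ¬ μ z
  · right
    obtain ⟨z, hzp, hz', hzμ⟩ := hz
    obtain ⟨c, hcc, hcz⟩ := (hμ z hz').resolve_left hzμ
    -- The edge from the cluster center to `z` survives in the old unmarked part because `z` was
    -- unmarked there, so the search tree of `c` reaches both ends of the path with one extra step
    -- each.
    have hadj : (unmarkedPart G μ).Adj c z := ⟨hcz, fun hh => hzμ hh.2⟩
    have h1 : (unmarkedPart G μ).edist c u ≤ 1 + (p.takeUntil z hzp).length := by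
      refine (SimpleGraph.edist_le (SimpleGraph.Walk.cons hadj
        (p.takeUntil z hzp).reverse)).trans ?_
      rw [SimpleGraph.Walk.length_cons, SimpleGraph.Walk.length_reverse]
      push_cast
      rw [add_comm]
    have h2 : (unmarkedPart G μ).edist c v ≤ 1 + (p.dropUntil z hzp).length := by
      refine (SimpleGraph.edist_le (SimpleGraph.Walk.cons hadj (p.dropUntil z hzp))).trans ?_
      rw [SimpleGraph.Walk.length_cons]
      push_cast
      rw [add_comm]
    have h3 : (p.takeUntil z hzp).length + (p.dropUntil z hzp).length = p.length := by
      rw [← SimpleGraph.Walk.length_append, SimpleGraph.Walk.take_spec]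
    calc H'.edist u v ≤ H'.edist u c + H'.edist c v := SimpleGraph.edist_triangle
      _ = H'.edist c u + H'.edist c v := by rw [SimpleGraph.edist_comm]
      _ ≤ (1 + (p.takeUntil z hzp).length) + (1 + (p.dropUntil z hzp).length) :=
          add_le_add ((hc c hcc u).trans h1) ((hc c hcc v).trans h2)
      _ = (p.length : ℕ∞) + 2 := by rw [← h3]; push_cast; ring
      _ ≤ G.edist u v + 2 := by rw [hp]; exact add_le_add_left h 2
  -- No vertex of the path is newly marked, so every edge of the path still has an unmarked end.
  · left
    push Not at hz
    have ht : ∀ e ∈ p.edges, e ∈ (unmarkedPart G μ').edgeSet := by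
      intro e he
      induction e with
      | _ a b =>
        have hab : (unmarkedPart G μ).Adj a b := p.adj_of_mem_edges he
        refine ⟨hab.1, fun hh => hab.2 ⟨?_, ?_⟩⟩
        · exact hz a (p.fst_mem_support_of_mem_edges he) hh.1
        · exact hz b (p.snd_mem_support_of_mem_edges he) hh.2
    refine (SimpleGraph.edist_le (p.transfer _ ht)).trans ?_
    rw [SimpleGraph.Walk.length_transfer, hp]
    exact h

/-! ### Adjacency matrices and edge counts -/

open Classical in
/-- The rows of `f`, of length `n`, are the adjacency matrix of the graph `Γ` on the numbers
below `n`. -/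
structure IsMatrix (n : ℕ) (f : ℕ → ℕ) (Γ : SimpleGraph ℕ) : Prop where
  eq : ∀ u < n, ∀ v < n, f (u * n + v) = if Γ.Adj u v then 1 else 0
  supp : ∀ u v, Γ.Adj u v → u < n

open Classical in
/-- The number of ordered pairs of adjacent vertices below `n`. -/
noncomputable def pairCount (n : ℕ) (Γ : SimpleGraph ℕ) : ℕ :=
  ∑ u ∈ Finset.range n, ∑ v ∈ Finset.range n, if Γ.Adj u v then 1 else 0

open Classical in
/-- The number of unmarked neighbours of `u`. -/
noncomputable def unmarkedDeg (n : ℕ) (Γ : SimpleGraph ℕ) (mk : ℕ → ℕ) (u : ℕ) : ℕ :=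
  ∑ v ∈ Finset.range n, if Γ.Adj u v ∧ mk v = 0 then 1 else 0

theorem IsMatrix.ne_zero_iff {n : ℕ} {f : ℕ → ℕ} {Γ : SimpleGraph ℕ} (h : IsMatrix n f Γ)
    {u v : ℕ} (hu : u < n) (hv : v < n) : f (u * n + v) ≠ 0 ↔ Γ.Adj u v := by
  rw [h.eq u hu v hv]
  split_ifs <;> simp_all

theorem IsMatrix.le_one {n : ℕ} {f : ℕ → ℕ} {Γ : SimpleGraph ℕ} (h : IsMatrix n f Γ)
    {u v : ℕ} (hu : u < n) (hv : v < n) : f (u * n + v) ≤ 1 := by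
  rw [h.eq u hu v hv]
  split_ifs <;> simp

theorem IsMatrix.insert {n : ℕ} {f : ℕ → ℕ} {Γ : SimpleGraph ℕ} (h : IsMatrix n f Γ) {x y : ℕ}
    (hx : x < n) (hy : y < n) (hxy : x ≠ y) :
    IsMatrix n (Function.update (Function.update f (x * n + y) 1) (y * n + x) 1)
      (Γ ⊔ SimpleGraph.edge x y) := by
  constructor
  · intro u hu v hv
    simp only [Function.update_apply, idx_inj hv hx, idx_inj hv hy, h.eq u hu v hv,
      SimpleGraph.sup_adj, SimpleGraph.edge_adj]
    split_ifs <;> first | rfl | (exfalso; grind)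
  · intro u v huv
    rcases huv with huv | huv
    · exact h.supp u v huv
    · rw [SimpleGraph.edge_adj] at huv
      rcases huv.1 with ⟨rfl, rfl⟩ | ⟨rfl, rfl⟩ <;> assumption

theorem pairCount_sup_edge (n : ℕ) (Γ : SimpleGraph ℕ) (x y : ℕ) :
    pairCount n (Γ ⊔ SimpleGraph.edge x y) ≤ pairCount n Γ + 2 := by
  classical
  have h1 : ∀ u v (_ : Decidable ((Γ ⊔ SimpleGraph.edge x y).Adj u v)),
      (if (Γ ⊔ SimpleGraph.edge x y).Adj u v then 1 else 0) ≤
      (if Γ.Adj u v then 1 else 0) + ((if v = y then (if u = x then 1 else 0) else 0) +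
        if v = x then (if u = y then 1 else 0) else 0) := by
    intro u v _
    simp only [SimpleGraph.sup_adj, SimpleGraph.edge_adj]
    split_ifs <;> first | omega | (exfalso; grind)
  have h2 : ∀ a b : ℕ, ∑ u ∈ Finset.range n, ∑ v ∈ Finset.range n,
      (if v = a then (if u = b then 1 else 0) else 0) ≤ 1 := by
    intro a b
    simp only [Finset.sum_ite_eq']
    split_ifs <;> simp
    split_ifs <;> omega
  unfold pairCount
  refine (Finset.sum_le_sum fun u _ => Finset.sum_le_sum fun v _ => h1 u v _).trans ?_
  simp only [Finset.sum_add_distrib]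
  have := h2 y x
  have := h2 x y
  omega

theorem pairCount_sup (n : ℕ) (Γ Γ' : SimpleGraph ℕ) :
    pairCount n (Γ ⊔ Γ') ≤ pairCount n Γ + pairCount n Γ' := by
  classical
  unfold pairCount
  simp only [← Finset.sum_add_distrib]
  refine Finset.sum_le_sum fun u _ => Finset.sum_le_sum fun v _ => ?_
  simp only [SimpleGraph.sup_adj]
  split_ifs <;> first | omega | (exfalso; grind)

theorem IsAdjList.sum_deg_le {n : ℕ} {Γ : SimpleGraph ℕ} {dg nb : ℕ → ℕ}
    (h : IsAdjList n Γ dg nb) : ∑ u ∈ Finset.range n, dg u ≤ pairCount n Γ := by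
  classical
  refine Finset.sum_le_sum fun u hu => ?_
  have hu' := Finset.mem_range.1 hu
  have : (Finset.range (dg u)).card ≤ ((Finset.range n).filter (Γ.Adj u)).card := by
    refine Finset.card_le_card_of_injOn (fun j => nb (u * n + j)) (fun j hj => ?_)
      (fun i hi j hj e => h.inj u hu' i (by simpa using hi) j (by simpa using hj) e)
    have hj' : j < dg u := by simpa using hj
    simpa using ⟨h.nb_lt hu' hj', h.adj u hu' j hj'⟩
  rw [Finset.card_filter] at this
  simpa using this

/-- Each edge of the unmarked part has an unmarked end and is counted among the unmarked neighbours
of the other end. Ordered pairs are charged according to which end is unmarked, whence the factor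
`2`. -/
theorem pairCount_unmarkedPart_le {n d : ℕ} {Γ : SimpleGraph ℕ} {mk : ℕ → ℕ}
    (h : ∀ u < n, unmarkedDeg n Γ mk u ≤ d) :
    pairCount n (unmarkedPart Γ fun x => mk x ≠ 0) ≤ 2 * n * d := by
  classical
  have h1 : ∑ u ∈ Finset.range n, unmarkedDeg n Γ mk u ≤ n * d := by
    have := Finset.sum_le_sum fun u hu => h u (Finset.mem_range.1 hu)
    simpa using this
  have h2 : pairCount n (unmarkedPart Γ fun x => mk x ≠ 0) ≤
      ∑ u ∈ Finset.range n, unmarkedDeg n Γ mk u + ∑ u ∈ Finset.range n, unmarkedDeg n Γ mk u := by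
    have h3 : ∑ u ∈ Finset.range n, unmarkedDeg n Γ mk u =
        ∑ u ∈ Finset.range n, ∑ v ∈ Finset.range n, if Γ.Adj u v ∧ mk u = 0 then 1 else 0 := by
      unfold unmarkedDeg
      rw [Finset.sum_comm]
      exact Finset.sum_congr rfl fun u _ => Finset.sum_congr rfl fun v _ => by rw [Γ.adj_comm]
    have h4 : ∀ u v (_ : Decidable ((unmarkedPart Γ fun x => mk x ≠ 0).Adj u v)),
        (if (unmarkedPart Γ fun x => mk x ≠ 0).Adj u v then 1 else 0) ≤
        (if Γ.Adj u v ∧ mk v = 0 then 1 else 0) + if Γ.Adj u v ∧ mk u = 0 then 1 else 0 := by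
      intro u v _
      have : (unmarkedPart Γ fun x => mk x ≠ 0).Adj u v → Γ.Adj u v ∧ (mk u = 0 ∨ mk v = 0) :=
        fun h => ⟨h.1, by have := h.2; tauto⟩
      split_ifs <;> first | omega | (exfalso; tauto)
    nth_rw 2 [h3]
    unfold unmarkedDeg pairCount
    simp only [← Finset.sum_add_distrib]
    exact Finset.sum_le_sum fun u _ => Finset.sum_le_sum fun v _ => h4 u v _
  nlinarith

/-! ### The program for the spanner -/

notation "r_th" => 115
notation "r_c" => 116
notation "a_mk" => 212
notation "a_cen" => 213
notation "a_H" => 214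

/-- The test for an edge that is not between two marked vertices. -/
def unmarkedEx : Ex :=
  .get a_adj (&r_x * &r_n + &r_y) * (1 - .get a_mk &r_x * .get a_mk &r_y)

/-- Choose centers with many unmarked neighbours and mark their neighbours. -/
def clusterCmd : Cmd :=
  .loop r_c &r_n (r_k ≔ 0 ;;
    .loop r_x &r_n (.ite (.get a_adj (&r_c * &r_n + &r_x) * .eq (.get a_mk &r_x) 0)
      (r_k ≔ &r_k + 1) .skip) ;;
    .ite (.lt &r_k &r_th) (.put a_cen &r_c 0)
      (.put a_cen &r_c 1 ;;
        .loop r_x &r_n (.ite (.get a_adj (&r_c * &r_n + &r_x)) (.put a_mk &r_x 1) .skip)))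

/-- Add the edges of the search tree to the spanner. -/
def treeCmd : Cmd :=
  .loop r_x &r_n (.ite (.lt 1 (.get a_D &r_x))
    (r_y ≔ .get a_par &r_x ;; .put a_H (&r_x * &r_n + &r_y) 1 ;;
      .put a_H (&r_y * &r_n + &r_x) 1) .skip)

/-- Add search trees from all centers to the spanner. -/
def treesCmd : Cmd :=
  r_K ≔ &r_n ;;
  .loop r_c &r_n (.ite (.get a_cen &r_c) (r_src ≔ &r_c ;; bfsCmd ;; treeCmd) .skip)

/-- One level of the construction. -/
def levelCmd : Cmd := r_th ≔ &r_th / 2 ;; listsCmd unmarkedEx ;; clusterCmd ;; treesCmd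

/-- Add the remaining edges to the spanner. -/
def restCmd : Cmd :=
  .loop r_x &r_n (.loop r_y &r_n (.ite unmarkedEx (.put a_H (&r_x * &r_n + &r_y) 1) .skip))

/-- What the choice of the centers of one level achieves. -/
structure IsClustering (n : ℕ) (Γ : SimpleGraph ℕ) (th : ℕ) (mk mk' cen : ℕ → ℕ) (m : ℕ) :
    Prop where
  le_one : ∀ x < n, mk' x ≤ 1
  mono : ∀ x < n, mk x ≠ 0 → mk' x ≠ 0
  near : ∀ x < n, mk' x ≠ 0 → mk x ≠ 0 ∨ ∃ c < m, cen c ≠ 0 ∧ Γ.Adj c x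
  deg : ∀ c < m, unmarkedDeg n Γ mk' c ≤ th
  cen_le : ∀ c < m, cen c ≤ 1
  count : (∑ c ∈ Finset.range m, cen c) * th ≤ ∑ x ∈ Finset.range n, mk' x

theorem unmarkedDeg_anti {n : ℕ} {Γ : SimpleGraph ℕ} {mk mk' : ℕ → ℕ}
    (h : ∀ x < n, mk x ≠ 0 → mk' x ≠ 0) (u : ℕ) :
    unmarkedDeg n Γ mk' u ≤ unmarkedDeg n Γ mk u := by
  classical
  refine Finset.sum_le_sum fun x hx => ?_
  have := h x (Finset.mem_range.1 hx)
  split_ifs <;> first | omega | (exfalso; grind)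

/-- A chosen vertex has at least `th` unmarked neighbours, all of which it marks; this gives
`count`, and afterwards its unmarked degree is `0`. A rejected vertex has fewer than `th` unmarked
neighbours, and later marks only lower that number. -/
theorem spec_clusterCmd {N n : ℕ} (hN : Big n N) (s : Store) (hn : s.reg r_n = n)
    (Γ : SimpleGraph ℕ) (hΓ : IsMatrix n (s.arr a_adj) Γ) (th : ℕ) (hth : s.reg r_th = th)
    (hmk : ∀ x < n, s.arr a_mk x ≤ 1) :
    Spec N clusterCmd s (n * (n * 150 + 100) + 10) (fun s' =>
      IsClustering n Γ th (s.arr a_mk) (s'.arr a_mk) (s'.arr a_cen) n) := by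
  classical
  set mk₀ := s.arr a_mk with hmk₀
  refine Spec.mono (Spec.loop (fun m s' => IsClustering n Γ th mk₀ (s'.arr a_mk) (s'.arr a_cen) m)
    n (n * 150 + 70) hn trivial ?_ ?_) (by simp; ring_nf; omega) (fun s' h _ => h)
  · exact ⟨hmk, fun _ _ h => h, fun _ _ h => Or.inl h, by simp, by simp, by simp⟩
  intro c hc s₁ hI hF1
  have hn1 : s₁.reg r_n = n := (hF1.reg r_n rfl).trans hn
  have hth1' : s₁.reg r_th = th := (hF1.reg r_th rfl).trans hth
  have hadj1 : s₁.arr a_adj = s.arr a_adj := hF1.arr a_adj rfl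
  refine Spec.le (Spec.seq (R := fun s' => s' = (s₁.setReg r_c c).setReg r_k 0)
    (Spec.assign (by simpa using hN.zero_lt) (by simp)) (T₂ := n * 150 + 60) ?_) (by simp; omega)
  rintro _ rfl -
  set mk := s₁.arr a_mk with hmk1
  refine Spec.le (Spec.seq (R := fun s' => s'.reg r_k = unmarkedDeg n Γ mk c)
    (T₁ := n * 70 + 9) (T₂ := n * 70 + 45)
    (Spec.mono (Spec.loop (fun i s' => s'.reg r_k =
      ∑ v ∈ Finset.range i, if Γ.Adj c v ∧ mk v = 0 then 1 else 0) n 59 (by simpa using hn1) trivial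
      (by simp) ?_) (by simp; omega) (fun s' h _ => h)) ?_) (by omega)
  · intro x hx s₂ h2 hF2
    have hn2 : s₂.reg r_n = n := (hF2.reg r_n rfl).trans (by simpa using hn1)
    have hc2 : s₂.reg r_c = c := (hF2.reg r_c rfl).trans (by simp)
    have hadj2 : s₂.arr a_adj = s.arr a_adj := (hF2.arr a_adj rfl).trans (by simpa using hadj1)
    have hmk2 : s₂.arr a_mk = mk := (hF2.arr a_mk rfl).trans (by simp [hmk1])
    have h01 := hΓ.le_one hc hx
    have hkn : s₂.reg r_k ≤ x := by
      rw [h2]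
      refine (Finset.sum_le_sum fun v _ => show _ ≤ 1 by split_ifs <;> omega).trans (by simp)
    rw [Finset.sum_range_succ, ← h2]
    refine Spec.le (Spec.ite (T := 11) ?_ (fun hz => ?_) (fun hz => ?_)) (by simp)
    · simp only [Ex.ok_mul, Ex.ok_add, Ex.ok_var, Ex.ok_eq, Ex.ok_get, Ex.ok_zero,
          true_and, Ex.eval_eq, Ex.eval_mul, Ex.eval_add, Ex.eval_var, Ex.eval_get,
          Store.reg_setReg, Nat.reduceEqDiff, reduceIte, hn2, hc2, Store.arr_setReg, hadj2,
          OfNat.zero_ne_ofNat]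
      refine ⟨⟨hN.mul hc.le le_rfl, hN.idx hc.le le_rfl hx.le⟩, hN.zero_lt, hN.const ?_⟩
      split_ifs <;> omega
    · have hz' : mk x = 0 ∧ Γ.Adj c x := by
        simpa [hn2, hc2, hadj2, hmk2, and_comm, hΓ.eq c hc x hx] using hz
      refine Spec.assign ?_ ?_
      · simpa [hN.one_lt] using hN.lin (x := s₂.reg r_k + 1) (by omega)
      · simp [hz'.1, hz'.2]
    · have hz' : ¬ (Γ.Adj c x ∧ mk x = 0) := by
        rintro ⟨h1, h2⟩
        simp [hn2, hc2, hadj2, hmk2, hΓ.eq c hc x hx, h1, h2] at hz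
      refine (Spec.skip ?_).le (by omega)
      simp [hz']
  intro s₂ hk2 hF2
  have hn2 : s₂.reg r_n = n := (hF2.reg r_n rfl).trans (by simpa using hn1)
  have hc2 : s₂.reg r_c = c := (hF2.reg r_c rfl).trans (by simp)
  have hth2 : s₂.reg r_th = th := (hF2.reg r_th rfl).trans (by simpa using hth1')
  have hadj2 : s₂.arr a_adj = s.arr a_adj := (hF2.arr a_adj rfl).trans (by simpa using hadj1)
  have hmk2 : s₂.arr a_mk = mk := (hF2.arr a_mk rfl).trans (by simp [hmk1])
  have hcen2 : s₂.arr a_cen = s₁.arr a_cen := (hF2.arr a_cen rfl).trans (by simp)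
  refine Spec.le (Spec.ite (T := n * 70 + 30) (by simp) (fun hz => ?_) (fun hz => ?_)) (by simp; omega)
  · have hz' : unmarkedDeg n Γ mk c < th := by simpa [hk2, hth2] using hz
    refine (Spec.put (by simp) (by simpa using hN.zero_lt) ?_).le (by simp)
    simp only [Store.arr_setArr, Ex.eval_var, Ex.eval_zero, Nat.reduceEqDiff, reduceIte, hc2, hmk2,
      hcen2]
    refine ⟨hI.le_one, hI.mono, ?_, ?_, ?_, ?_⟩
    · intro x hx hx'
      rcases hI.near x hx hx' with h | ⟨c', h1, h2, h3⟩
      · exact Or.inl h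
      · exact Or.inr ⟨c', by omega, by rwa [Function.update_of_ne (by omega)], h3⟩
    · intro c' hc'
      rcases Nat.lt_succ_iff_lt_or_eq.1 hc' with hc' | rfl
      exacts [hI.deg c' hc', hz'.le]
    · intro c' hc'
      rw [Function.update_apply]
      split_ifs with h
      · omega
      · exact hI.cen_le c' (by omega)
    · rw [Finset.sum_range_succ, Function.update_self, Finset.sum_update_of_notMem (by simp)]
      simpa using hI.count
  · have hz' : th ≤ unmarkedDeg n Γ mk c := by simpa [hk2, hth2] using hz
    refine Spec.le (Spec.seq (R := fun s' => s' = s₂.setArr a_cen c 1)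
      (Spec.put (by simp) (by simpa using hN.one_lt) (by simp [hc2]))
      (T₂ := n * 50 + 9) ?_) (by simp; omega)
    rintro _ rfl -
    refine Spec.mono (Spec.loop (fun i s' => ∀ x < n, s'.arr a_mk x =
      if x < i ∧ Γ.Adj c x then 1 else mk x) n 35 (by simpa using hn2) trivial
      (fun x hx => by simp [hmk2]) ?_) (by simp; omega) ?_
    · intro x hx s₃ h3 hF3
      have hn3 : s₃.reg r_n = n := (hF3.reg r_n rfl).trans (by simpa using hn2)
      have hc3 : s₃.reg r_c = c := (hF3.reg r_c rfl).trans (by simpa using hc2)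
      have hadj3 : s₃.arr a_adj = s.arr a_adj := (hF3.arr a_adj rfl).trans (by simpa using hadj2)
      refine Spec.le (Spec.ite (T := 10) ?_ (fun hz => ?_) (fun hz => ?_)) (by simp)
      · simpa [hn3, hc3] using ⟨hN.mul hc.le le_rfl, hN.idx hc.le le_rfl hx.le⟩
      · have ha : Γ.Adj c x := by
          simpa [hn3, hc3, hadj3, hΓ.eq c hc x hx] using hz
        refine (Spec.put (by simp) (by simpa using hN.one_lt) ?_).le (by simp)
        intro y hy
        simp only [Store.arr_setArr, Ex.eval_var, Ex.eval_one, reduceIte, Store.reg_setReg,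
          Store.arr_setReg, Function.update_apply, h3 y hy]
        split_ifs <;> first | rfl | (exfalso; grind)
      · have ha : ¬ Γ.Adj c x := fun ha => by
          simp [hn3, hc3, hadj3, hΓ.eq c hc x hx, ha] at hz
        refine (Spec.skip ?_).le (by omega)
        intro y hy
        simp only [Store.arr_setReg, h3 y hy]
        split_ifs <;> first | rfl | (exfalso; grind)
    · intro s₃ h3 hF3
      have hcen3 : s₃.arr a_cen = Function.update (s₁.arr a_cen) c 1 :=
        (hF3.arr a_cen rfl).trans (by simp [hcen2])
      have h3' : ∀ x < n, s₃.arr a_mk x = if Γ.Adj c x then 1 else mk x := fun x hx => by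
        rw [h3 x hx]
        simp [hx]
      rw [hcen3]
      refine ⟨?_, ?_, ?_, ?_, ?_, ?_⟩
      · intro x hx
        have := hI.le_one x hx
        rw [h3' x hx]
        split_ifs <;> omega
      · intro x hx hx0
        have := hI.mono x hx hx0
        rw [h3' x hx]
        split_ifs <;> omega
      · intro x hx hx'
        rw [h3' x hx] at hx'
        by_cases ha : Γ.Adj c x
        · exact Or.inr ⟨c, by omega, by simp, ha⟩
        · rw [if_neg ha] at hx'
          rcases hI.near x hx hx' with h | ⟨c', h1, h2, h3⟩
          · exact Or.inl h
          · exact Or.inr ⟨c', by omega, by rwa [Function.update_of_ne (by omega)], h3⟩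
      · intro c' hc'
        rcases Nat.lt_succ_iff_lt_or_eq.1 hc' with hc' | rfl
        · refine (unmarkedDeg_anti (fun x hx hx0 => ?_) c').trans (hI.deg c' hc')
          rw [h3' x hx]
          split_ifs <;> omega
        · refine (Finset.sum_eq_zero fun x hx => if_neg ?_).le.trans (Nat.zero_le _)
          rintro ⟨ha, h0⟩
          rw [h3' x (Finset.mem_range.1 hx), if_pos ha] at h0
          omega
      · intro c' hc'
        rw [Function.update_apply]
        split_ifs with h
        · exact le_rfl
        · exact hI.cen_le c' (by omega)
      · rw [Finset.sum_range_succ, Function.update_self, Finset.sum_update_of_notMem (by simp)]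
        -- Marks are `0` or `1`, so marking the neighbours of `c` raises their sum by exactly the
        -- number of its unmarked neighbours.
        have h4 : ∑ x ∈ Finset.range n, s₃.arr a_mk x =
            ∑ x ∈ Finset.range n, mk x + unmarkedDeg n Γ mk c := by
          rw [unmarkedDeg, ← Finset.sum_add_distrib]
          refine Finset.sum_congr rfl fun x hx => ?_
          have := hI.le_one x (Finset.mem_range.1 hx)
          rw [h3' x (Finset.mem_range.1 hx)]
          by_cases hx0 : mk x = 0 <;> by_cases ha : Γ.Adj c x <;> simp [hx0, ha]
          omega
        have := hI.count
        rw [h4, Nat.add_mul, Nat.one_mul]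
        omega

/-! ### Correctness of the program for the spanner -/

theorem unmarkedPart_congr {n : ℕ} {Γ : SimpleGraph ℕ} (hΓ : ∀ u v, Γ.Adj u v → u < n)
    {μ μ' : ℕ → Prop} (h : ∀ x < n, μ x ↔ μ' x) : unmarkedPart Γ μ = unmarkedPart Γ μ' := by
  ext u v
  refine and_congr_right fun huv => ?_
  rw [h u (hΓ u v huv), h v (hΓ v u huv.symm)]

theorem unmarkedEx_correct {N n : ℕ} (hN : Big n N) {Γ : SimpleGraph ℕ} {s : Store}
    (hΓ : IsMatrix n (s.arr a_adj) Γ) (hmk : ∀ x < n, s.arr a_mk x ≤ 1) (hn : s.reg r_n = n)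
    {u v : ℕ} (hu : u < n) (hv : v < n) (hx : s.reg r_x = u) (hy : s.reg r_y = v) :
    unmarkedEx.ok N s ∧
      (unmarkedEx.eval s ≠ 0 ↔ (unmarkedPart Γ fun x => s.arr a_mk x ≠ 0).Adj u v) := by
  have h1 := hmk u hu
  have h2 := hmk v hv
  have h3 := hΓ.le_one hu hv
  have h4 : s.arr a_mk u * s.arr a_mk v ≤ 1 * 1 := Nat.mul_le_mul h1 h2
  have h5 : s.arr a_adj (u * n + v) * (1 - s.arr a_mk u * s.arr a_mk v) ≤ 1 * 1 :=
    Nat.mul_le_mul h3 (by omega)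
  constructor
  · simp only [unmarkedEx, Ex.ok_mul, Ex.ok_get, Ex.ok_add, Ex.ok_var, Ex.ok_sub, Ex.ok_one,
      Ex.eval_mul, Ex.eval_get, Ex.eval_add, Ex.eval_var, Ex.eval_sub, Ex.eval_one, true_and,
      hx, hy, hn]
    exact ⟨⟨hN.mul hu.le le_rfl, hN.idx hu.le le_rfl hv.le⟩, ⟨hN.one_lt, hN.const (by omega)⟩,
      hN.const (by omega)⟩
  · simp only [unmarkedEx, Ex.eval_mul, Ex.eval_get, Ex.eval_add, Ex.eval_var, Ex.eval_sub,
      Ex.eval_one, hx, hy, hn, mul_ne_zero_iff, hΓ.ne_zero_iff hu hv]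
    refine and_congr_right fun _ => ?_
    have e1 : s.arr a_mk u = 0 ∨ s.arr a_mk u = 1 := by omega
    have e2 : s.arr a_mk v = 0 ∨ s.arr a_mk v = 1 := by omega
    rcases e1 with e1 | e1 <;> rcases e2 with e2 | e2 <;> simp [e1, e2]

/-- Since `D` is the distance plus one on visited vertices and `0` elsewhere, the test `1 < D`
selects the visited vertices other than the root, which are those with a valid parent. -/
theorem spec_treeCmd {N n : ℕ} (hN : Big n N) (s : Store) (hn : s.reg r_n = n)
    {Γ H : SimpleGraph ℕ} (hM : IsMatrix n (s.arr a_H) H) (hH : H ≤ Γ)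
    (hΓ : ∀ u v, Γ.Adj u v → u < n)
    (hp : ∀ x < n, 1 < s.arr a_D x → Γ.Adj (s.arr a_par x) x) :
    Spec N treeCmd s (n * 90 + 9) (fun s' => ∃ H', IsMatrix n (s'.arr a_H) H' ∧ H ≤ H' ∧
      H' ≤ Γ ∧ (∀ x < n, 1 < s.arr a_D x → H'.Adj (s.arr a_par x) x) ∧
      pairCount n H' ≤ pairCount n H + 2 * n) := by
  refine Spec.mono (Spec.loop (fun i s' => ∃ H', IsMatrix n (s'.arr a_H) H' ∧ H ≤ H' ∧
      H' ≤ Γ ∧ (∀ x < i, 1 < s.arr a_D x → H'.Adj (s.arr a_par x) x) ∧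
      pairCount n H' ≤ pairCount n H + 2 * i) n 70 hn trivial
      ⟨H, hM, le_rfl, hH, by simp, by simp⟩ ?_) (by simp; omega) (fun s' h _ => h)
  rintro x hx s₁ ⟨H', h1, h2, h3, h4, h5⟩ hF
  have hn1 : s₁.reg r_n = n := (hF.reg r_n rfl).trans hn
  have hD1 : s₁.arr a_D = s.arr a_D := hF.arr a_D rfl
  have hp1 : s₁.arr a_par = s.arr a_par := hF.arr a_par rfl
  refine Spec.le (Spec.ite (T := 55) ?_ (fun hz => ?_) (fun hz => ?_)) (by simp)
  · simpa using hN.one_lt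
  · have hz' : 1 < s.arr a_D x := by simpa [hD1] using hz
    have ha := hp x hx hz'
    set y := s.arr a_par x with hy
    have hyn : y < n := hΓ y x ha
    refine Spec.flat rfl ?_ (by decide) ?_
    · simp only [Cmd.ok, Cmd.den, Ex.ok_get, Ex.ok_var, Ex.ok_add, Ex.ok_mul, Ex.ok_one, true_and,
        Ex.eval_mul, Ex.eval_var, Ex.eval_get, Ex.eval_one, Store.reg_setReg, Store.arr_setReg,
        Store.reg_setArr, Nat.reduceEqDiff, reduceIte, hn1, hp1, ← hy, OfNat.zero_ne_ofNat]
      exact ⟨⟨⟨hN.mul hx.le le_rfl, hN.idx hx.le le_rfl hyn.le⟩, hN.one_lt⟩,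
        ⟨hN.mul hyn.le le_rfl, hN.idx hyn.le le_rfl hx.le⟩, hN.one_lt⟩
    · simp only [Cmd.den, Ex.eval_get, Ex.eval_var, Ex.eval_add, Ex.eval_mul, Ex.eval_one,
        Store.reg_setReg, Store.arr_setReg, Store.arr_setArr, Store.reg_setArr, Nat.reduceEqDiff,
        reduceIte, hn1, hp1, ← hy, OfNat.zero_ne_ofNat]
      refine ⟨H' ⊔ SimpleGraph.edge x y, h1.insert hx hyn ha.ne', h2.trans le_sup_left,
        sup_le h3 ((SimpleGraph.edge_le_iff _).2 (Or.inr ha.symm)), ?_, ?_⟩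
      · intro x' hx' hd
        rcases Nat.lt_succ_iff_lt_or_eq.1 hx' with hx' | rfl
        · exact Or.inl (h4 x' hx' hd)
        · refine Or.inr ?_
          rw [SimpleGraph.edge_adj]
          exact ⟨Or.inr ⟨rfl, rfl⟩, ha.ne⟩
      · have := pairCount_sup_edge n H' x y
        omega
  · have hz' : ¬ 1 < s.arr a_D x := by simpa [hD1] using hz
    refine (Spec.skip ⟨H', h1, h2, h3, ?_, by omega⟩).le (by omega)
    intro x' hx' hd
    rcases Nat.lt_succ_iff_lt_or_eq.1 hx' with hx' | rfl
    exacts [h4 x' hx' hd, absurd hd hz']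

namespace BFSOrder

variable {n : ℕ} {Γ : SimpleGraph ℕ} {c : ℕ} {D q par : ℕ → ℕ} {l : ℕ}

theorem adj_par (B : BFSOrder n Γ c D q par l) {x : ℕ} (hx : x < n) (hD : 1 < D x) :
    Γ.Adj (par x) x := by
  by_cases h : ∃ i < l, q i = x
  · obtain ⟨i, hi, rfl⟩ := h
    obtain ⟨i', hi', e, ha, hd⟩ := B.parent i hi (by
      rintro rfl
      rw [B.D_q 0 hi, B.zero, SimpleGraph.dist_self] at hD
      omega)
    rwa [e]
  · push Not at h
    rw [B.D_zero x hx h] at hD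
    omega

/-- A graph that contains the search tree preserves the distances from the root. -/
theorem edist_le (B : BFSOrder n Γ c D q par l)
    (hl : ∀ w, Γ.Reachable c w → ∃ i < l, q i = w) {H : SimpleGraph ℕ}
    (hH : ∀ x < n, 1 < D x → H.Adj (par x) x) (x : ℕ) : H.edist c x ≤ Γ.edist c x := by
  by_cases hx : Γ.Reachable c x
  swap
  · rw [SimpleGraph.edist_eq_top_of_not_reachable hx]
    exact le_top
  obtain ⟨i, hi, rfl⟩ := hl x hx
  rw [← hx.coe_dist_eq_edist]
  clear hx
  induction i using Nat.strong_induction_on with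
  | _ i ih =>
    by_cases h0 : i = 0
    · subst h0
      simp [B.zero]
    · obtain ⟨i', hi', e, ha, hd⟩ := B.parent i hi h0
      have h1 := hH (q i) (B.lt i hi) (by rw [B.D_q i hi]; omega)
      rw [e] at h1
      calc H.edist c (q i) ≤ H.edist c (q i') + H.edist (q i') (q i) := SimpleGraph.edist_triangle
        _ ≤ Γ.dist c (q i') + 1 := add_le_add (ih i' hi' (by omega))
          (SimpleGraph.edist_eq_one_iff_adj.2 h1).le
        _ = Γ.dist c (q i) := by rw [← hd]; push_cast; rfl

/-- A search cut off at `n` vertices misses nothing: either the queue stayed shorter and is closed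
under neighbours, or it holds all `n` vertices. -/
theorem complete (B : BFSOrder n Γ c D q par l) (hs : ScannedUpTo Γ n q l l)
    (hΓ : ∀ u v, Γ.Adj u v → u < n) (hc : c < n) (w : ℕ) (hw : Γ.Reachable c w) :
    ∃ i < l, q i = w := by
  rcases B.length_le.lt_or_eq with hl | hl
  · exact B.mem_of_reachable hs hl hw
  · subst hl
    by_cases h : c = w
    · exact B.mem_of_length_eq (h ▸ hc)
    · obtain ⟨y, _, hy, _⟩ := hw.exists_adj_dist h
      exact B.mem_of_length_eq (hΓ w y hy.symm)

end BFSOrder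

/-- Only the rounds at cluster centers run a search, so the time is accumulated as a multiple of the
number of centers seen so far instead of being bounded uniformly per round. -/
theorem spec_treesCmd {N n : ℕ} (hN : Big n N) (s : Store) (hn : s.reg r_n = n)
    {F Γ H : SimpleGraph ℕ} (hM : IsMatrix n (s.arr a_H) H) (hH : H ≤ Γ) (hF : F ≤ Γ)
    (hΓ : ∀ u v, Γ.Adj u v → u < n) (hL : IsAdjList n F (s.arr a_dg) (s.arr a_nb))
    {E : ℕ} (hE : ∑ u ∈ Finset.range n, s.arr a_dg u ≤ E) (hcen : ∀ c < n, s.arr a_cen c ≤ 1) :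
    Spec N treesCmd s (n * 20 + (∑ c ∈ Finset.range n, s.arr a_cen c) * (210 * n + 120 * E + 140) +
      20) (fun s' => ∃ H', IsMatrix n (s'.arr a_H) H' ∧ H ≤ H' ∧ H' ≤ Γ ∧
      (∀ c < n, s.arr a_cen c ≠ 0 → ∀ x, H'.edist c x ≤ F.edist c x) ∧
      pairCount n H' ≤ pairCount n H + 2 * n * ∑ c ∈ Finset.range n, s.arr a_cen c) := by
  refine Spec.le (Spec.seq (R := fun s' => s' = s.setReg r_K n) (Spec.assign trivial (by simp [hn]))
    (T₂ := n * 20 + (∑ c ∈ Finset.range n, s.arr a_cen c) * (210 * n + 120 * E + 140) + 9) ?_)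
    (by simp; omega)
  rintro _ rfl -
  refine Spec.mono (Spec.loopAcc (fun i t s' => (∃ H', IsMatrix n (s'.arr a_H) H' ∧ H ≤ H' ∧
      H' ≤ Γ ∧ (∀ c < i, s.arr a_cen c ≠ 0 → ∀ x, H'.edist c x ≤ F.edist c x) ∧
      pairCount n H' ≤ pairCount n H + 2 * n * ∑ c ∈ Finset.range i, s.arr a_cen c) ∧
      t ≤ i * 20 + (∑ c ∈ Finset.range i, s.arr a_cen c) * (210 * n + 120 * E + 140)) n
      (by simpa using hn) trivial
      ⟨⟨H, by simpa using hM, le_rfl, hH, by simp, by simp⟩, by simp⟩ ?_ ?_) le_rfl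
      (fun s' ⟨_, h, _⟩ _ => h)
  · rintro c hc t s₁ ⟨⟨H', h1, h2, h3, h4, h5⟩, ht⟩ hF1
    have hn1 : s₁.reg r_n = n := (hF1.reg r_n rfl).trans (by simpa using hn)
    have hK1 : s₁.reg r_K = n := (hF1.reg r_K rfl).trans (by simp)
    have hcen1 : s₁.arr a_cen = s.arr a_cen := (hF1.arr a_cen rfl).trans (by simp)
    have hdg1 : s₁.arr a_dg = s.arr a_dg := (hF1.arr a_dg rfl).trans (by simp)
    have hnb1 : s₁.arr a_nb = s.arr a_nb := (hF1.arr a_nb rfl).trans (by simp)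
    by_cases hcc : s.arr a_cen c = 0
    · refine ⟨8, (Spec.ite (T := 1) (by simp) (fun hz => ?_) (fun hz => ?_)).le (by simp)⟩
      · simp [hcen1, hcc] at hz
      · refine (Spec.skip ⟨⟨H', h1, h2, h3, ?_, ?_⟩, ?_⟩).le (by omega)
        · intro c' hc' hc0
          rcases Nat.lt_succ_iff_lt_or_eq.1 hc' with hc' | rfl
          exacts [h4 c' hc' hc0, absurd hcc hc0]
        · rwa [Finset.sum_range_succ, hcc]
        · rw [Finset.sum_range_succ, hcc, Nat.add_zero (∑ x ∈ Finset.range c, s.arr a_cen x)]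
          omega
    · have hc1 : s.arr a_cen c = 1 := by have := hcen c hc; omega
      refine ⟨210 * n + 120 * E + 148,
        (Spec.ite (T := 210 * n + 120 * E + 141) (by simp) (fun hz => ?_) (fun hz => ?_)).le
          (by simp; omega)⟩
      swap
      · simp [hcen1, hcc] at hz
      refine Spec.le (Spec.seq (R := fun s' => s' = (s₁.setReg r_c c).setReg r_src c)
        (Spec.assign trivial (by simp)) (T₂ := 210 * n + 120 * E + 131) ?_) (by simp; omega)
      rintro _ rfl -
      refine Spec.le (Spec.seq (spec_bfsCmd hN _ (by simpa using hn1) n c E (by simpa using hK1)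
        (by simp) (by omega) le_rfl hc F (by simpa [hdg1, hnb1] using hL) ?_)
        (T₂ := n * 90 + 9) ?_) (by omega)
      · intro S hS _
        refine le_trans ?_ hE
        refine (Finset.sum_le_sum fun u _ => min_le_left _ _).trans ?_
        simp only [Store.arr_setReg, hdg1]
        exact Finset.sum_le_sum_of_subset hS
      · rintro s₂ ⟨_, hB, hS⟩ hF2
        have hn2 : s₂.reg r_n = n := (hF2.reg r_n rfl).trans (by simpa using hn1)
        have hH2 : s₂.arr a_H = s₁.arr a_H := (hF2.arr a_H rfl).trans (by simp)
        refine Spec.mono (spec_treeCmd hN s₂ hn2 (hH2 ▸ h1) h3 hΓ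
          fun x hx hd => hF (hB.adj_par hx hd)) le_rfl ?_
        rintro s₃ ⟨H'', g1, g2, g3, g4, g5⟩ _
        refine ⟨⟨H'', g1, h2.trans g2, g3, ?_, ?_⟩, ?_⟩
        · intro c' hc' hc0 x
          rcases Nat.lt_succ_iff_lt_or_eq.1 hc' with hc' | rfl
          · exact (SimpleGraph.edist_anti g2).trans (h4 c' hc' hc0 x)
          · exact hB.edist_le (hB.complete hS (fun u v h => hΓ u v (hF h)) hc) g4 x
        · rw [Finset.sum_range_succ, hc1, Nat.mul_add]
          omega
        · rw [Finset.sum_range_succ, hc1,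
            Nat.succ_mul (∑ x ∈ Finset.range c, s.arr a_cen x)]
          omega
  · rintro t s' ⟨_, ht⟩ _
    simp
    omega

/-- The state between two levels of the construction: the unmarked degrees are at most `th`, and
distances are preserved by the unmarked part or, up to `2`, by the spanner built so far. -/
structure LevelInv (n : ℕ) (Γ : SimpleGraph ℕ) (th : ℕ) (mk fH : ℕ → ℕ) : Prop where
  le_one : ∀ x < n, mk x ≤ 1
  deg : ∀ u < n, unmarkedDeg n Γ mk u ≤ th
  spanner : ∃ H, IsMatrix n fH H ∧ H ≤ Γ ∧ pairCount n H * th ≤ 4 * n * n ∧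
    ∀ u v, (unmarkedPart Γ fun x => mk x ≠ 0).edist u v ≤ Γ.edist u v ∨
      H.edist u v ≤ Γ.edist u v + 2

/-- The time balances for every threshold. The old unmarked degrees are at most `2 * th`, so a
search in the old unmarked part costs `O(n * th)`; there are `k` searches with `k * th ≤ n`,
together `O(n * n)`. -/
theorem spec_levelCmd {N n : ℕ} (hN : Big n N) (s : Store) (hn : s.reg r_n = n)
    (Γ : SimpleGraph ℕ) (hΓ : IsMatrix n (s.arr a_adj) Γ) (th : ℕ) (hth : s.reg r_th = 2 * th)
    (hth1 : 1 ≤ th) (hn0 : 1 ≤ n) (hI : LevelInv n Γ (2 * th) (s.arr a_mk) (s.arr a_H)) :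
    Spec N levelCmd s (n * n * 2500) (fun s' => s'.reg r_th = th ∧
      LevelInv n Γ th (s'.arr a_mk) (s'.arr a_H)) := by
  set mk := s.arr a_mk with hmk
  set F := unmarkedPart Γ fun x => mk x ≠ 0 with hF
  have hFΓ : F ≤ Γ := unmarkedPart_le _ _
  have hFs : ∀ u v, F.Adj u v → u < n := fun u v h => hΓ.supp u v (hFΓ h)
  refine Spec.le (Spec.seq (R := fun s' => s' = s.setReg r_th th)
    (Spec.assign (by simpa using hN.two_lt) (by simp [hth]))
    (T₂ := n * n * 2460) ?_) (by simp; nlinarith)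
  rintro _ rfl -
  refine Spec.le (Spec.seq (spec_listsCmd hN unmarkedEx (s.setReg r_th th) (by simpa using hn) F
    hFs ?_) (T₂ := n * n * 2280) ?_) (by simp [unmarkedEx]; nlinarith)
  · intro s' u hu v hv hF' hx hy
    have e1 : s'.arr a_adj = s.arr a_adj := (hF'.arr a_adj rfl).trans (by simp)
    have e2 : s'.arr a_mk = mk := (hF'.arr a_mk rfl).trans (by simp [hmk])
    have := unmarkedEx_correct hN (s := s') (e1 ▸ hΓ) (e2 ▸ hI.le_one)
      ((hF'.reg r_n rfl).trans (by simpa using hn)) hu hv hx hy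
    rwa [e2] at this
  intro s₂ hL hF2
  have hn2 : s₂.reg r_n = n := (hF2.reg r_n rfl).trans (by simpa using hn)
  have hth2 : s₂.reg r_th = th := (hF2.reg r_th rfl).trans (by simp)
  have hadj2 : s₂.arr a_adj = s.arr a_adj := (hF2.arr a_adj rfl).trans (by simp)
  have hmk2 : s₂.arr a_mk = mk := (hF2.arr a_mk rfl).trans (by simp [hmk])
  have hH2 : s₂.arr a_H = s.arr a_H := (hF2.arr a_H rfl).trans (by simp)
  refine Spec.le (Spec.seq (spec_clusterCmd hN s₂ hn2 Γ (hadj2 ▸ hΓ) th hth2 (by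
    rw [hmk2]; exact hI.le_one)) (T₂ := n * n * 2000) ?_) (by nlinarith)
  rw [hmk2]
  intro s₃ hC hF3
  have hn3 : s₃.reg r_n = n := (hF3.reg r_n rfl).trans hn2
  have hth3 : s₃.reg r_th = th := (hF3.reg r_th rfl).trans hth2
  have hdg3 : s₃.arr a_dg = s₂.arr a_dg := hF3.arr a_dg rfl
  have hnb3 : s₃.arr a_nb = s₂.arr a_nb := hF3.arr a_nb rfl
  have hH3 : s₃.arr a_H = s.arr a_H := (hF3.arr a_H rfl).trans hH2
  obtain ⟨H, hM, hHΓ, hHc, hsp⟩ := hI.spanner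
  have hcnt : (∑ c ∈ Finset.range n, s₃.arr a_cen c) * th ≤ n := by
    refine hC.count.trans ((Finset.sum_le_sum fun x hx =>
      hC.le_one x (Finset.mem_range.1 hx)).trans (by simp))
  have hE : ∑ u ∈ Finset.range n, s₃.arr a_dg u ≤ 4 * n * th := by
    rw [hdg3]
    refine hL.sum_deg_le.trans ((pairCount_unmarkedPart_le hI.deg).trans_eq (by ring))
  set k := ∑ c ∈ Finset.range n, s₃.arr a_cen c with hk
  have hkn : k ≤ n := (Nat.le_mul_of_pos_right k hth1).trans hcnt
  refine Spec.mono (spec_treesCmd hN s₃ hn3 (hH3 ▸ hM) hHΓ hFΓ (fun u v => hΓ.supp u v)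
    (by rw [hdg3, hnb3]; exact hL) hE hC.cen_le) ?_ ?_
  · rw [← hk]
    clear_value k
    have e1 : k * (210 * n + 120 * (4 * n * th) + 140) =
      210 * (k * n) + 480 * (n * (k * th)) + 140 * k := by ring
    have e2 : k * n ≤ n * n := Nat.mul_le_mul_right n hkn
    have e3 : n * (k * th) ≤ n * n := Nat.mul_le_mul_left n hcnt
    have e4 : n ≤ n * n := Nat.le_mul_of_pos_right n hn0
    omega
  · rintro s₄ ⟨H', g1, g2, g3, g4, g5⟩ hF4
    rw [← hk] at g5
    have hmk4 : s₄.arr a_mk = s₃.arr a_mk := hF4.arr a_mk rfl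
    refine ⟨(hF4.reg r_th rfl).trans hth3, hmk4 ▸ hC.le_one, hmk4 ▸ hC.deg, H', g1, g3, ?_, ?_⟩
    · clear_value k
      -- Halving the threshold turns the old bound into `2 * n * n`, and the `k` new trees, each
      -- with at most `2 * n` ordered pairs, add at most the same amount again. The constant `4` is
      -- therefore reproduced at every level.
      have e1 : (pairCount n H + 2 * n * k) * th = pairCount n H * th + 2 * (n * (k * th)) := by ring
      have e2 : n * (k * th) ≤ n * n := Nat.mul_le_mul_left n hcnt
      have e3 : pairCount n H * (2 * th) = 2 * (pairCount n H * th) := by ring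
      have e4 := Nat.mul_le_mul_right th g5
      have e5 : 4 * n * n = 4 * (n * n) := by ring
      omega
    · intro u v
      -- The mark arrays are controlled only below `n`, whereas `spanner_step` speaks of all natural
      -- numbers. Restricting the marks to indices below `n` does not change the unmarked part,
      -- since all edges lie there.
      have e := fun (f : ℕ → ℕ) => unmarkedPart_congr (n := n) (Γ := Γ) (fun u v => hΓ.supp u v)
        (μ := fun x => f x ≠ 0) (μ' := fun x => x < n ∧ f x ≠ 0) (fun x hx => by simp [hx])
      rw [hmk4, e]
      refine spanner_step (μ := fun x => x < n ∧ mk x ≠ 0)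
        (cen := fun c => c < n ∧ s₃.arr a_cen c ≠ 0) g2 ?_ ?_ ?_ u v
      · rintro x ⟨hx, hx0⟩
        rcases hC.near x hx hx0 with h | ⟨c, h1, h2, h3⟩
        exacts [Or.inl ⟨hx, h⟩, Or.inr ⟨c, ⟨h1, h2⟩, h3⟩]
      · rintro c ⟨hc, hc0⟩ x
        rw [← e]
        exact g4 c hc hc0 x
      · rw [← e]
        exact hsp

notation "r_i" => 117

/-- All levels of the construction, with thresholds from `r_th` downwards. -/
def spannerCmd : Cmd := .loop r_i &r_L levelCmd ;; restCmd

theorem spec_restCmd {N n : ℕ} (hN : Big n N) (s : Store) (hn : s.reg r_n = n)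
    {Γ H : SimpleGraph ℕ} (hΓ : IsMatrix n (s.arr a_adj) Γ) (hmk : ∀ x < n, s.arr a_mk x ≤ 1)
    (hM : IsMatrix n (s.arr a_H) H) (hn0 : 1 ≤ n) :
    Spec N restCmd s (n * n * 120) (fun s' =>
      IsMatrix n (s'.arr a_H) (H ⊔ unmarkedPart Γ fun x => s.arr a_mk x ≠ 0)) := by
  classical
  set F := unmarkedPart Γ fun x => s.arr a_mk x ≠ 0 with hF
  have hFs : ∀ u v, F.Adj u v → u < n := fun u v h => hΓ.supp u v h.1
  refine Spec.mono (Spec.loop (fun i s' => ∀ u < n, ∀ v < n, s'.arr a_H (u * n + v) =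
    if H.Adj u v ∨ (u < i ∧ F.Adj u v) then 1 else 0) n (n * 75 + 9) hn trivial
    (fun u hu v hv => by rw [hM.eq u hu v hv]; simp) ?_) (by simp; nlinarith) ?_
  · intro x hx s₁ h1 hF1
    have hn1 : s₁.reg r_n = n := (hF1.reg r_n rfl).trans hn
    refine Spec.mono (Spec.loop (fun j s' => ∀ u < n, ∀ v < n, s'.arr a_H (u * n + v) =
      if H.Adj u v ∨ ((u < x ∨ u = x ∧ v < j) ∧ F.Adj u v) then 1 else 0) n 64 (by simpa using hn1)
      trivial (fun u hu v hv => by simp [h1 u hu v hv]) ?_) (by simp; omega) ?_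
    · intro y hy s₂ h2 hF2
      have hn2 : s₂.reg r_n = n := (hF2.reg r_n rfl).trans (by simpa using hn1)
      have hx2 : s₂.reg r_x = x := (hF2.reg r_x rfl).trans (by simp)
      have hadj2 : s₂.arr a_adj = s.arr a_adj := (hF2.arr a_adj rfl).trans (hF1.arr a_adj rfl)
      have hmk2 : s₂.arr a_mk = s.arr a_mk := (hF2.arr a_mk rfl).trans (hF1.arr a_mk rfl)
      obtain ⟨hok, hiff⟩ := unmarkedEx_correct hN (s := s₂.setReg r_y y) (Γ := Γ)
        (by simpa [hadj2] using hΓ) (by simpa [hmk2] using hmk) (by simpa using hn2) hx hy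
        (by simpa using hx2) (by simp)
      have hiff' : unmarkedEx.eval (s₂.setReg r_y y) ≠ 0 ↔ F.Adj x y := by
        simpa only [Store.arr_setReg, hmk2] using hiff
      refine Spec.le (Spec.ite (T := 20) hok (fun hz => ?_) (fun hz => ?_)) (by simp [unmarkedEx])
      · have ha := hiff'.1 hz
        refine (Spec.put ?_ (by simpa using hN.one_lt) ?_).le (by simp)
        · simpa [hx2, hn2] using ⟨hN.mul hx.le le_rfl, hN.idx hx.le le_rfl hy.le⟩
        · intro u hu v hv
          simp only [Store.arr_setArr, Ex.eval_add, Ex.eval_mul, Ex.eval_var, Ex.eval_one,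
            Store.reg_setReg, Store.arr_setReg, Nat.reduceEqDiff, reduceIte, hx2, hn2,
            OfNat.zero_ne_ofNat, Function.update_apply, idx_inj hv hy, h2 u hu v hv]
          split_ifs <;> first | rfl | (exfalso; grind)
      · have ha : ¬ F.Adj x y := fun ha => hiff'.2 ha hz
        refine (Spec.skip ?_).le (by omega)
        intro u hu v hv
        simp only [Store.arr_setReg, h2 u hu v hv]
        split_ifs <;> first | rfl | (exfalso; grind)
    · intro s₂ h2 _ u hu v hv
      rw [h2 u hu v hv]
      split_ifs <;> first | rfl | (exfalso; grind)
  · intro s' h _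
    refine ⟨fun u hu v hv => ?_, ?_⟩
    · simp only [h u hu v hv, SimpleGraph.sup_adj, hu, true_and]
    · rintro u v (h | h)
      exacts [hM.supp u v h, hFs u v h]

/-- At the start nothing is marked, the unmarked part is the whole graph, and `s₀ * 2 ^ L ≥ n`
bounds all degrees. At threshold `s₀` the trees have at most `4 * n * n / s₀ ≤ 4 * n * s₀` ordered
pairs, and the remaining unmarked part, added as a whole, has at most `2 * n * s₀`. -/
theorem spec_spannerCmd {N n : ℕ} (hN : Big n N) (s : Store) (hn : s.reg r_n = n)
    (Γ : SimpleGraph ℕ) (hΓ : IsMatrix n (s.arr a_adj) Γ) (s₀ L : ℕ)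
    (hth : s.reg r_th = s₀ * 2 ^ L) (hL : s.reg r_L = L) (hs0 : 1 ≤ s₀) (hs1 : n ≤ s₀ * s₀)
    (hnL : n ≤ 2 ^ L) (hn0 : 1 ≤ n) (hmk : ∀ x < n, s.arr a_mk x = 0)
    (hH : ∀ i < n * n, s.arr a_H i = 0) :
    Spec N spannerCmd s (n * n * (2520 * L + 130)) (fun s' => ∃ H, IsMatrix n (s'.arr a_H) H ∧
      H ≤ Γ ∧ (∀ u v, H.edist u v ≤ Γ.edist u v + 2) ∧ pairCount n H ≤ 6 * n * s₀) := by
  classical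
  have hn1 : 1 ≤ n * n := Nat.mul_pos hn0 hn0
  refine Spec.le (Spec.seq (Spec.loop (fun i s' => s'.reg r_th = s₀ * 2 ^ (L - i) ∧
    LevelInv n Γ (s₀ * 2 ^ (L - i)) (s'.arr a_mk) (s'.arr a_H)) L (n * n * 2500) hL trivial ?_ ?_)
    (T₂ := n * n * 120) ?_) (by
      simp only [Ex.size_var]
      nlinarith)
  · refine ⟨hth, fun x hx => by rw [hmk x hx]; omega, fun u hu => ?_, ⊥, ⟨?_, ?_⟩, bot_le, ?_, ?_⟩
    · refine (Finset.sum_le_sum fun v _ => show _ ≤ 1 by split_ifs <;> omega).trans ?_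
      simp only [Finset.sum_const, Finset.card_range, smul_eq_mul, mul_one, Nat.sub_zero]
      exact hnL.trans (Nat.le_mul_of_pos_left _ hs0)
    · intro u hu v hv
      rw [hH _ (idx_lt_sq hu hv)]
      simp
    · simp
    · simp [pairCount]
    · intro u v
      refine Or.inl (le_of_eq ?_)
      congr 1
      ext a b
      refine ⟨fun h => h.1, fun h => ⟨h, fun hh => hh.1 (hmk a (hΓ.supp a b h))⟩⟩
  · rintro i hi s₁ ⟨h1, h2⟩ hF
    have e : s₀ * 2 ^ (L - i) = 2 * (s₀ * 2 ^ (L - (i + 1))) := by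
      rw [show L - i = (L - (i + 1)) + 1 by omega, pow_succ]
      ring
    rw [e] at h1 h2
    exact spec_levelCmd hN (s₁.setReg r_i i) (by simpa using (hF.reg r_n rfl).trans hn) Γ
      (by simpa [hF.arr a_adj rfl] using hΓ) _ (by simpa using h1)
      (Nat.mul_pos hs0 (by positivity)) hn0 (by simpa using h2)
  · rintro s₁ ⟨_, hI⟩ hF
    rw [Nat.sub_self, pow_zero, mul_one] at hI
    obtain ⟨H, hM, hHΓ, hc, hsp⟩ := hI.spanner
    refine Spec.mono (spec_restCmd hN s₁ ((hF.reg r_n rfl).trans hn)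
      (by simpa [hF.arr a_adj rfl] using hΓ) hI.le_one hM hn0) le_rfl ?_
    intro s₂ h2 _
    refine ⟨_, h2, sup_le hHΓ (unmarkedPart_le _ _), fun u v => ?_, ?_⟩
    · rcases hsp u v with h | h
      · exact (SimpleGraph.edist_anti le_sup_right).trans (h.trans le_self_add)
      · exact (SimpleGraph.edist_anti le_sup_left).trans h
    · refine (pairCount_sup n _ _).trans ?_
      have e1 := pairCount_unmarkedPart_le hI.deg
      have e2 : pairCount n H ≤ 4 * n * s₀ := by
        refine Nat.le_of_mul_le_mul_right (hc.trans ?_) hs0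
        calc 4 * n * n ≤ 4 * n * (s₀ * s₀) := Nat.mul_le_mul_left _ hs1
          _ = 4 * n * s₀ * s₀ := by ring
      have e3 : 6 * n * s₀ = 4 * n * s₀ + 2 * n * s₀ := by ring
      omega

/-! ### Square roots, logarithms and balls -/

notation "r_v" => 118

/-- The least `r_s` with `r_n ≤ r_s ^ 2`. -/
def sqrtCmd : Cmd :=
  r_s ≔ 0 ;; .loop r_i &r_n (.ite (.lt (&r_s * &r_s) &r_n) (r_s ≔ &r_s + 1) .skip)

theorem spec_sqrtCmd {N n : ℕ} (hN : Big n N) (s : Store) (hn : s.reg r_n = n) (hn0 : 1 ≤ n) :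
    Spec N sqrtCmd s (n * 60 + 20) (fun s' => 1 ≤ s'.reg r_s ∧ s'.reg r_s ≤ n ∧
      n ≤ s'.reg r_s * s'.reg r_s ∧ s'.reg r_s * s'.reg r_s ≤ 4 * n) := by
  refine Spec.le (Spec.seq (R := fun s' => s' = s.setReg r_s 0) (Spec.assign
    (by simpa using hN.zero_lt) (by simp)) (T₂ := n * 60 + 9) ?_) (by simp; omega)
  rintro _ rfl -
  -- While its square is below `n`, the candidate equals the number of rounds, so `n` rounds
  -- suffice. The second condition, that the predecessor was still too small, yields the upper bound
  -- `4 * n` for the square.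
  refine Spec.mono (Spec.loop (fun i s' => s'.reg r_s ≤ i ∧
    (s'.reg r_s = 0 ∨ (s'.reg r_s - 1) * (s'.reg r_s - 1) < n) ∧
    (s'.reg r_s * s'.reg r_s < n → s'.reg r_s = i)) n 49 (by simpa using hn) trivial (by simp) ?_)
    (by simp; omega) ?_
  · intro i hi s₁ ⟨h1, h2, h3⟩ hF
    have hn1 : s₁.reg r_n = n := (hF.reg r_n rfl).trans (by simpa using hn)
    set a := s₁.reg r_s with ha
    refine Spec.le (Spec.ite (T := 15) ?_ (fun hz => ?_) (fun hz => ?_)) (by simp)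
    · simpa [← ha] using hN.mul (show a ≤ n by omega) (show a ≤ n by omega)
    · have hz' : a * a < n := by simpa [← ha, hn1] using hz
      refine (Spec.assign ?_ ?_).le (by simp)
      · simpa [← ha, hN.one_lt] using hN.lin (x := a + 1) (by omega)
      · have := h3 hz'
        simp [← ha, this] at hz' ⊢
        exact hz'
    · have hz' : ¬ a * a < n := by simpa [← ha, hn1] using hz
      refine (Spec.skip ?_).le (by omega)
      simp only [Store.reg_setReg, Nat.reduceEqDiff, reduceIte, ← ha]
      exact ⟨by omega, h2, fun h => absurd h hz'⟩
  · rintro s' ⟨h1, h2, h3⟩ _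
    set a := s'.reg r_s
    clear_value a
    have h4 : n ≤ a * a := by
      by_contra h
      obtain rfl := h3 (by omega)
      exact h (Nat.le_mul_of_pos_right _ hn0)
    have h5 : 1 ≤ a := by
      by_contra h
      obtain rfl : a = 0 := by omega
      omega
    refine ⟨h5, h1, h4, ?_⟩
    obtain ⟨b, rfl⟩ : ∃ b, a = b + 1 := ⟨a - 1, by omega⟩
    rcases h2 with h2 | h2
    · omega
    · rw [Nat.add_sub_cancel] at h2
      nlinarith

/-- The least `r_L` with `r_n < 2 ^ r_L`; this power times `r_s` is the first threshold. -/
def logCmd : Cmd :=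
  (r_L ≔ 0 ;; r_th ≔ 1) ;;
  .loop r_i &r_n (.ite (.lt &r_n &r_th) .skip (r_th ≔ 2 * &r_th ;; r_L ≔ &r_L + 1)) ;;
  r_th ≔ &r_s * &r_th

theorem spec_logCmd {N n : ℕ} (hN : Big n N) (s : Store) (hn : s.reg r_n = n) (hn0 : 1 ≤ n)
    (hs : s.reg r_s ≤ n) :
    Spec N logCmd s (n * 60 + 50) (fun s' => n < 2 ^ s'.reg r_L ∧ 2 ^ s'.reg r_L ≤ 2 * n ∧
      s'.reg r_th = s.reg r_s * 2 ^ s'.reg r_L) := by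
  refine Spec.le (Spec.seq (R := fun s' => s' = (s.setReg r_L 0).setReg r_th 1)
    (Spec.flat rfl (by simp [Cmd.ok, hN.zero_lt, hN.one_lt]) le_rfl (by simp [Cmd.den]))
    (T₂ := n * 60 + 35) ?_) (by simp [Cmd.bound]; omega)
  rintro _ rfl -
  refine Spec.le (Spec.seq (Spec.loop (fun i s' => s'.reg r_th = 2 ^ s'.reg r_L ∧
    s'.reg r_L ≤ i ∧ s'.reg r_th ≤ 2 * n ∧ (s'.reg r_th ≤ n → s'.reg r_L = i)) n 49
    (by simpa using hn) trivial (by simp; omega) ?_) (T₂ := 15) ?_) (by simp; omega)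
  · intro i hi s₁ ⟨h1, h2, h3, h4⟩ hF
    have hn1 : s₁.reg r_n = n := (hF.reg r_n rfl).trans (by simpa using hn)
    refine Spec.le (Spec.ite (T := 30) (by simp) (fun hz => ?_) (fun hz => ?_)) (by simp)
    · have hz' : n < s₁.reg r_th := by simpa [hn1] using hz
      refine (Spec.skip ?_).le (by omega)
      simp only [Store.reg_setReg, Nat.reduceEqDiff, reduceIte]
      exact ⟨h1, by omega, h3, fun h => by omega⟩
    · have hz' : s₁.reg r_th ≤ n := by simpa [hn1] using hz
      have h5 := h4 hz'
      refine Spec.flat rfl ?_ (by decide) ?_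
      · simpa [Cmd.ok, Cmd.den, hN.one_lt, hN.two_lt] using
          ⟨hN.lin (x := 2 * s₁.reg r_th) (by omega), hN.lin (x := s₁.reg r_L + 1) (by omega)⟩
      · simp [Cmd.den, h1, h5, pow_succ] at hz' ⊢
        omega
  · rintro s₁ ⟨h1, h2, h3, h4⟩ hF
    have hs1 : s₁.reg r_s = s.reg r_s := (hF.reg r_s rfl).trans (by simp)
    refine (Spec.assign ?_ ?_).le (by simp)
    · simp only [Ex.ok_mul, Ex.ok_var, true_and, Ex.eval_var, hs1]
      refine hN.of_sq ((Nat.mul_le_mul hs h3).trans ?_)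
      nlinarith
    · simp only [Store.reg_setReg, Nat.reduceEqDiff, reduceIte, Ex.eval_mul, Ex.eval_var, hs1, h1,
        and_true]
      rw [h1] at h3 h4
      refine ⟨not_le.1 fun h => ?_, h3⟩
      have := h4 h
      rw [this] at h
      exact absurd h (not_le.2 Nat.lt_two_pow_self)

/-- The adjacency list of `r_adj` and, for every vertex, the list of the `r_s` vertices that are
closest to it, with distances. -/
def ballsCmd : Cmd :=
  listsCmd (.get a_adj (&r_x * &r_n + &r_y)) ;; r_K ≔ &r_s ;;
  .loop r_v &r_n (r_src ≔ &r_v ;; bfsCmd ;;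
    .loop r_j &r_s (r_x ≔ .get a_q &r_j ;; .put a_ls (&r_v * &r_n + &r_j) &r_x ;;
      .put a_dl (&r_v * &r_n + &r_x) (.get a_D &r_x)))

/-- The row of the vertex `v` in `ls` lists the `s` vertices closest to `v`, and the row in `dl`
holds their distances from `v`, increased by one. -/
structure IsBall (n s : ℕ) (Γ : SimpleGraph ℕ) (ls dl : ℕ → ℕ) (v : ℕ) : Prop where
  lt : ∀ j < s, ls (v * n + j) < n
  inj : ∀ i < s, ∀ j < s, ls (v * n + i) = ls (v * n + j) → i = j
  order : ∀ p < s, ∀ w < n, Γ.dist v w < Γ.dist v (ls (v * n + p)) → ∃ p' < p, ls (v * n + p') = w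
  dist_le : ∀ p < s, Γ.dist v (ls (v * n + p)) ≤ p
  dl_mem : ∀ p < s, dl (v * n + ls (v * n + p)) = Γ.dist v (ls (v * n + p)) + 1
  dl_zero : ∀ w < n, (∀ p < s, ls (v * n + p) ≠ w) → dl (v * n + w) = 0

theorem IsBall.congr {n s : ℕ} {Γ : SimpleGraph ℕ} {ls dl ls' dl' : ℕ → ℕ} {v : ℕ}
    (h : IsBall n s Γ ls dl v) (h1 : ∀ j < s, ls' (v * n + j) = ls (v * n + j))
    (h2 : ∀ w < n, dl' (v * n + w) = dl (v * n + w)) : IsBall n s Γ ls' dl' v := by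
  constructor
  · intro j hj; rw [h1 j hj]; exact h.lt j hj
  · intro i hi j hj; rw [h1 i hi, h1 j hj]; exact h.inj i hi j hj
  · intro p hp w hw hd
    rw [h1 p hp] at hd
    obtain ⟨p', hp', e⟩ := h.order p hp w hw hd
    exact ⟨p', hp', (h1 p' (by omega)).trans e⟩
  · intro p hp; rw [h1 p hp]; exact h.dist_le p hp
  · intro p hp
    rw [h1 p hp, h2 _ (h.lt p hp), h.dl_mem p hp]
  · intro w hw hne
    rw [h2 w hw]
    exact h.dl_zero w hw fun p hp e => hne p hp ((h1 p hp).trans e)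

/-- Cut off at `s₀` vertices with `s₀` scanned neighbours each, a search inspects at most `s₀ * s₀ ≤
4 * n` neighbours, however dense the graph is; all `n` searches take `O(n * n)` steps. -/
theorem spec_ballsCmd {N n : ℕ} (hN : Big n N) (s : Store) (hn : s.reg r_n = n)
    {Γ : SimpleGraph ℕ} (hΓ : IsMatrix n (s.arr a_adj) Γ)
    (hc : ∀ u < n, ∀ v < n, Γ.Reachable u v) (s₀ : ℕ) (hs : s.reg r_s = s₀) (hs0 : 1 ≤ s₀)
    (hsn : s₀ ≤ n) (hs4 : s₀ * s₀ ≤ 4 * n) (hdl : ∀ i < n * n, s.arr a_dl i = 0) :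
    Spec N ballsCmd s (n * n * 1500) (fun s' =>
      ∀ v < n, IsBall n s₀ Γ (s'.arr a_ls) (s'.arr a_dl) v) := by
  refine Spec.le (Spec.seq (spec_listsCmd hN _ s hn Γ hΓ.supp ?_) (T₂ := n * n * 1200) ?_)
    (by simp; nlinarith)
  · intro s' u hu v hv hF hx hy
    have hn' : s'.reg r_n = n := (hF.reg r_n rfl).trans hn
    have ha' : s'.arr a_adj = s.arr a_adj := hF.arr a_adj rfl
    simp only [Ex.ok_get, Ex.ok_add, Ex.ok_mul, Ex.ok_var, true_and, Ex.eval_mul, Ex.eval_add,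
      Ex.eval_var, Ex.eval_get, hx, hy, hn', ha', hΓ.ne_zero_iff hu hv, and_true]
    exact ⟨hN.mul hu.le le_rfl, hN.idx hu.le le_rfl hv.le⟩
  intro s₁ hL1 hF1
  have hn1 : s₁.reg r_n = n := (hF1.reg r_n rfl).trans hn
  have hs1 : s₁.reg r_s = s₀ := (hF1.reg r_s rfl).trans hs
  have hdl1 : s₁.arr a_dl = s.arr a_dl := hF1.arr a_dl rfl
  refine Spec.le (Spec.seq (R := fun s' => s' = s₁.setReg r_K s₀) (Spec.assign trivial
    (by simp [hs1])) (T₂ := n * n * 1180) ?_) (by simp; nlinarith)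
  rintro _ rfl -
  refine Spec.mono (Spec.loop (fun u s' => (∀ v < u, IsBall n s₀ Γ (s'.arr a_ls) (s'.arr a_dl) v) ∧
    ∀ v < n, u ≤ v → ∀ w < n, s'.arr a_dl (v * n + w) = 0) n (n * 700 + 200)
    (by simpa using hn1) trivial ⟨by simp, fun v hv _ w hw => by
      simpa [hdl1] using hdl _ (idx_lt_sq hv hw)⟩ ?_) (by simp; nlinarith)
    (fun s' h _ => h.1)
  intro v hv s₂ ⟨hB2, hz2⟩ hF2
  have hn2 : s₂.reg r_n = n := (hF2.reg r_n rfl).trans (by simpa using hn1)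
  have hs2 : s₂.reg r_s = s₀ := (hF2.reg r_s rfl).trans (by simpa using hs1)
  have hK2 : s₂.reg r_K = s₀ := (hF2.reg r_K rfl).trans (by simp)
  have hdg2 : s₂.arr a_dg = s₁.arr a_dg := (hF2.arr a_dg rfl).trans (by simp)
  have hnb2 : s₂.arr a_nb = s₁.arr a_nb := (hF2.arr a_nb rfl).trans (by simp)
  refine Spec.le (Spec.seq (R := fun s' => s' = (s₂.setReg r_v v).setReg r_src v)
    (Spec.assign trivial (by simp)) (T₂ := n * 700 + 190) ?_) (by simp; omega)
  rintro _ rfl -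
  refine Spec.le (Spec.seq (spec_bfsCmd hN _ (by simpa using hn2) s₀ v (4 * n) (by simpa using hK2)
    (by simp) hs0 hsn hv Γ (by simpa [hdg2, hnb2] using hL1) ?_) (T₂ := n * 80 + 9) ?_) (by omega)
  · intro S _ hS
    refine (Finset.sum_le_sum fun u _ => min_le_right _ _).trans ?_
    simp only [Finset.sum_const, smul_eq_mul]
    exact (Nat.mul_le_mul_right s₀ hS).trans hs4
  rintro s₃ ⟨htl, hB, hS⟩ hF3
  have hn3 : s₃.reg r_n = n := (hF3.reg r_n rfl).trans (by simpa using hn2)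
  have hs3 : s₃.reg r_s = s₀ := (hF3.reg r_s rfl).trans (by simpa using hs2)
  have hv3 : s₃.reg r_v = v := (hF3.reg r_v rfl).trans (by simp)
  have hls3 : s₃.arr a_ls = s₂.arr a_ls := (hF3.arr a_ls rfl).trans (by simp)
  have hdl3 : s₃.arr a_dl = s₂.arr a_dl := (hF3.arr a_dl rfl).trans (by simp)
  -- A queue shorter than the cut-off is a complete search, which by connectedness contains all `n ≥
  -- s₀` vertices.
  have htl' : s₃.reg r_tl = s₀ := by
    refine le_antisymm htl (not_lt.1 fun hlt => ?_)
    have h1 : (Finset.range n).card ≤ (Finset.range (s₃.reg r_tl)).card := by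
      have h2 : ∀ w < n, ∃ i < s₃.reg r_tl, s₃.arr a_q i = w := fun w hw =>
        hB.mem_of_reachable hS hlt (hc v hv w hw)
      choose! f hf using h2
      refine Finset.card_le_card_of_injOn f (fun w hw => ?_) (fun a ha b hb e => ?_)
      · simpa using (hf w (by simpa using hw)).1
      · have h3 := (hf a (by simpa using ha)).2
        rw [e, (hf b (by simpa using hb)).2] at h3
        exact h3.symm
    simp only [Finset.card_range] at h1
    omega
  rw [htl'] at hB
  refine Spec.mono (Spec.loop (fun j s' => (∀ j' < j, s'.arr a_ls (v * n + j') = s₃.arr a_q j') ∧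
    (∀ v' < n, v' ≠ v → (∀ i < n, s'.arr a_ls (v' * n + i) = s₂.arr a_ls (v' * n + i)) ∧
      ∀ w < n, s'.arr a_dl (v' * n + w) = s₂.arr a_dl (v' * n + w)) ∧
    (∀ j' < j, s'.arr a_dl (v * n + s₃.arr a_q j') = Γ.dist v (s₃.arr a_q j') + 1) ∧
    ∀ w < n, (∀ j' < j, s₃.arr a_q j' ≠ w) → s'.arr a_dl (v * n + w) = 0) s₀ 69 hs3 trivial ?_ ?_)
    (by simp; nlinarith) ?_
  · refine ⟨by simp, fun v' _ _ => by simp [hls3, hdl3], by simp, fun w hw _ => ?_⟩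
    rw [hdl3]
    exact hz2 v hv le_rfl w hw
  · rintro j hj s₄ ⟨h1, h2, h3, h4⟩ hF4
    have hn4 : s₄.reg r_n = n := (hF4.reg r_n rfl).trans hn3
    have hv4 : s₄.reg r_v = v := (hF4.reg r_v rfl).trans hv3
    have hq4 : s₄.arr a_q = s₃.arr a_q := hF4.arr a_q rfl
    have hD4 : s₄.arr a_D = s₃.arr a_D := hF4.arr a_D rfl
    set x := s₃.arr a_q j with hx
    have hxn : x < n := hB.lt j hj
    refine Spec.flat rfl ?_ (by decide) ?_
    · simp only [Cmd.ok, Cmd.den, Ex.ok_get, Ex.ok_var, Ex.ok_add, Ex.ok_mul, true_and,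
        Ex.eval_mul, Ex.eval_var, Ex.eval_get, Store.reg_setReg, Store.arr_setReg,
        Store.reg_setArr, Nat.reduceEqDiff, reduceIte, hn4, hv4, hq4, ← hx, and_true,
        OfNat.zero_ne_ofNat]
      exact ⟨⟨hN.mul hv.le le_rfl, hN.idx hv.le le_rfl (by omega)⟩,
        hN.mul hv.le le_rfl, hN.idx hv.le le_rfl hxn.le⟩
    · simp only [Cmd.den, Ex.eval_get, Ex.eval_var, Ex.eval_add, Ex.eval_mul,
        Store.reg_setReg, Store.arr_setReg, Store.arr_setArr, Store.reg_setArr, Nat.reduceEqDiff,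
        reduceIte, hn4, hv4, hq4, hD4, ← hx, OfNat.zero_ne_ofNat]
      refine ⟨?_, ?_, ?_, ?_⟩
      · intro j' hj'
        rcases Nat.lt_succ_iff_lt_or_eq.1 hj' with hj' | rfl
        · rw [Function.update_of_ne (by omega), h1 j' hj']
        · rw [Function.update_self]
      · intro v' hv' hne
        refine ⟨fun i hi => ?_, fun w hw => ?_⟩
        · rw [Function.update_of_ne (by rw [Ne, idx_inj hi (by omega)]; tauto)]
          exact (h2 v' hv' hne).1 i hi
        · rw [Function.update_of_ne (by rw [Ne, idx_inj hw (by omega)]; tauto)]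
          exact (h2 v' hv' hne).2 w hw
      · intro j' hj'
        rcases Nat.lt_succ_iff_lt_or_eq.1 hj' with hj' | rfl
        · rw [Function.update_of_ne, h3 j' hj']
          intro e
          have := hB.inj j' (by omega) j hj (by omega)
          omega
        · rw [← hx, Function.update_self, hx, hB.D_q j' hj]
      · intro w hw hne
        rw [Function.update_of_ne, h4 w hw fun j' hj' => hne j' (by omega)]
        have := hne j (by omega)
        omega
  · rintro s₄ ⟨h1, h2, h3, h4⟩ hF4
    refine ⟨?_, fun v' hv' hle w hw => ?_⟩
    · intro v' hv'
      rcases Nat.lt_succ_iff_lt_or_eq.1 hv' with hv' | rfl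
      · have := h2 v' (by omega) (by omega)
        exact (hB2 v' hv').congr (fun j hj => this.1 j (by omega)) this.2
      · refine ⟨?_, ?_, ?_, ?_, ?_, ?_⟩
        · intro j hj; rw [h1 j hj]; exact hB.lt j hj
        · intro i hi j hj; rw [h1 i hi, h1 j hj]; exact hB.inj i hi j hj
        · intro p hp w hw hd
          rw [h1 p hp] at hd
          obtain ⟨p', hp', e⟩ := hB.order p hp w (hc v' hv w hw) hd
          exact ⟨p', hp', (h1 p' (by omega)).trans e⟩
        · intro p hp; rw [h1 p hp]; exact hB.dist_le_index hp
        · intro p hp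
          rw [h1 p hp, h3 p hp]
        · intro w hw hne
          exact h4 w hw fun p hp e => hne p hp ((h1 p hp).trans e)
    · rw [(h2 v' hv' (by omega)).2 w hw]
      exact hz2 v' hv' (by omega) w hw

/-! ### All rounds of the choice of centers -/

/-- The choice of the centers. -/
def roundsCmd : Cmd := .loop r_i (2 * &r_s * (2 * &r_L + 1)) roundCmd

theorem sum_update_one_le (A : ℕ → ℕ) (n b : ℕ) :
    ∑ x ∈ Finset.range n, Function.update A b 1 x ≤ ∑ x ∈ Finset.range n, A x + 1 := by
  by_cases hb : b ∈ Finset.range n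
  · rw [Finset.sum_update_of_mem hb, add_comm]
    exact Nat.add_le_add_right (Finset.sum_le_sum_of_subset Finset.sdiff_subset) 1
  · rw [Finset.sum_update_of_notMem hb]
    omega

/-- The centers are few vertices, every row contains one, and all clusters are small. -/
structure IsHittingSet (n s R : ℕ) (l : ℕ → ℕ → ℕ) (A : ℕ → ℕ) : Prop where
  le_one : ∀ x, A x ≤ 1
  supp : ∀ x, A x ≠ 0 → x < n
  card : ∑ x ∈ Finset.range n, A x ≤ R
  hit : ∀ v < n, hitPos A (l v) s < s
  small : ∀ w, ¬ IsLarge n s l A w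

/-- The `2 * s₀ * (2 * L + 1)` rounds cost `O(n * s₀)` each, and `s₀ * s₀ ≤ 4 * n` makes this `O(n *
n * L)`. The number of rounds also bounds the number of centers. -/
theorem spec_roundsCmd {N n s₀ L : ℕ} (hN : Big n N) (s : Store) (hn : s.reg r_n = n)
    (hs : s.reg r_s = s₀) (hL : s.reg r_L = L) (hs0 : 0 < s₀) (hsn : s₀ ≤ n)
    (hs1 : n ≤ s₀ * s₀) (hs4 : s₀ * s₀ ≤ 4 * n) (hL1 : n < 2 ^ L) (hL2 : 2 ^ L ≤ 2 * n)
    (hl : IsRows n s₀ (rowsOf n (s.arr a_ls))) (hA : ∀ x, s.arr a_in x = 0) :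
    Spec N roundsCmd s (n * n * L * 20000) (fun s' =>
      IsHittingSet n s₀ (2 * s₀ * (2 * L + 1)) (rowsOf n (s.arr a_ls)) (s'.arr a_in)) := by
  have hLn : L < 2 * n := Nat.lt_two_pow_self.trans_le hL2
  have hL0 : 1 ≤ L := by
    by_contra h
    obtain rfl : L = 0 := by omega
    simp at hL1
    omega
  set l := rowsOf n (s.arr a_ls) with hl'
  have hb1 : 2 * s₀ ≤ 2 * n := by omega
  have hb2 : 2 * s₀ * (2 * L + 1) ≤ 2 * n * (4 * n) := Nat.mul_le_mul hb1 (by omega)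
  refine Spec.mono (Spec.loop (fun i s' => (∀ x, s'.arr a_in x ≤ 1) ∧
    (∀ x, s'.arr a_in x ≠ 0 → x < n) ∧ ∑ x ∈ Finset.range n, s'.arr a_in x ≤ i ∧
    potential n s₀ l (s'.arr a_in) * (2 * s₀) ^ i ≤
      potential n s₀ l (s.arr a_in) * (2 * s₀ - 1) ^ i) (2 * s₀ * (2 * L + 1))
      (n * (s₀ * 210 + 170) + 70) (by simp [hs, hL]) ?_ ?_ ?_) ?_ ?_
  · simp only [Ex.ok_mul, Ex.ok_add, Ex.ok_var, Ex.ok_one, Ex.ok_two, Ex.eval_mul, Ex.eval_two,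
      Ex.eval_var, Ex.eval_add, Ex.eval_one, hs, hL, true_and]
    refine ⟨⟨hN.two_lt, hN.lin (by omega)⟩, ⟨⟨hN.two_lt, hN.lin (by omega)⟩, hN.one_lt,
      hN.lin (by omega)⟩, hN.of_sq (hb2.trans ?_)⟩
    nlinarith
  · simp [hA]
  · rintro i hi s₁ ⟨h1, h2, h3, h4⟩ hF
    have hls1 : s₁.arr a_ls = s.arr a_ls := hF.arr a_ls rfl
    refine Spec.mono (spec_roundCmd hN (s₁.setReg r_i i)
      (by simpa using (hF.reg r_n rfl).trans hn) (by simpa using (hF.reg r_s rfl).trans hs)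
      hs0 hsn hs1 hs4 (by simpa [hls1] using hl)) le_rfl ?_
    rintro s₂ ⟨b, hb, e, hp⟩ _
    simp only [Store.arr_setReg, hls1] at e hp
    rw [← hl'] at hp
    refine ⟨?_, ?_, ?_, ?_⟩
    · intro x
      rw [e, Function.update_apply]
      split_ifs
      exacts [le_rfl, h1 x]
    · intro x hx
      rw [e, Function.update_apply] at hx
      split_ifs at hx with hxb
      exacts [hxb ▸ hb, h2 x hx]
    · rw [e]
      exact (sum_update_one_le _ _ _).trans (by omega)
    · calc potential n s₀ l (s₂.arr a_in) * (2 * s₀) ^ (i + 1)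
          = potential n s₀ l (s₂.arr a_in) * (2 * s₀) * (2 * s₀) ^ i := by rw [pow_succ]; ring
        _ ≤ potential n s₀ l (s₁.arr a_in) * (2 * s₀ - 1) * (2 * s₀) ^ i :=
            Nat.mul_le_mul_right _ hp
        _ = potential n s₀ l (s₁.arr a_in) * (2 * s₀) ^ i * (2 * s₀ - 1) := by ring
        _ ≤ potential n s₀ l (s.arr a_in) * (2 * s₀ - 1) ^ i * (2 * s₀ - 1) :=
            Nat.mul_le_mul_right _ h4
        _ = _ := by rw [pow_succ]; ring
  · have e0 : s₀ ≤ s₀ * s₀ := Nat.le_mul_of_pos_right _ hs0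
    have e1 : (2 * s₀ * (2 * L + 1)) * (n * (s₀ * 210 + 170) + 70 + 11) ≤
        (6 * s₀ * L) * (461 * (n * s₀)) := by
      refine Nat.mul_le_mul (by nlinarith) ?_
      have : n ≤ n * s₀ := Nat.le_mul_of_pos_right _ hs0
      have : n * (s₀ * 210 + 170) = 210 * (n * s₀) + 170 * n := by ring
      omega
    have e2 : (6 * s₀ * L) * (461 * (n * s₀)) = 2766 * (n * L) * (s₀ * s₀) := by ring
    have e3 : 2766 * (n * L) * (s₀ * s₀) ≤ 2766 * (n * L) * (4 * n) := Nat.mul_le_mul_left _ hs4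
    have e4 : 2766 * (n * L) * (4 * n) = 11064 * (n * n * L) := by ring
    have e5 : 1 ≤ n * n * L := Nat.mul_pos (Nat.mul_pos (by omega) (by omega)) hL0
    simp only [Ex.size_mul, Ex.size_add, Ex.size_two, Ex.size_one, Ex.size_var]
    omega
  · rintro s₁ ⟨h1, h2, h3, h4⟩ _
    -- The initial potential is at most `n * (s₀ + 1) ≤ 2 * n * n < 2 ^ (2 * L + 1)`, and every `2 *
    -- s₀` rounds halve it.
    have hpot : potential n s₀ l (s₁.arr a_in) = 0 := by
      refine eq_zero_of_geometric hs0 ?_ h4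
      refine (potential_le (n := n) (s := s₀) (l := l) (A := s.arr a_in)).trans_lt ?_
      calc n * (s₀ + 1) ≤ n * (2 * n) := Nat.mul_le_mul_left _ (by omega)
        _ < 2 ^ L * (2 * 2 ^ L) := Nat.mul_lt_mul_of_lt_of_le hL1 (by omega) (by positivity)
        _ = 2 ^ (2 * L + 1) := by ring
    obtain ⟨h5, h6⟩ := of_potential_eq_zero hpot
    exact ⟨h1, h2, h3, h5, h6⟩

/-! ### The distances to the centers -/

notation "r_w" => 119
notation "r_d" => 120
notation "r_e" => 121
notation "a_dA" => 215
notation "a_M" => 216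
notation "a_T" => 217

/-- Compute the distances to the closest centers. -/
def distCmd : Cmd :=
  .loop r_v &r_n (r_k ≔ 0 ;;
    .loop r_j &r_s (r_x ≔ .get a_ls (&r_v * &r_n + &r_j) ;;
      .ite (.get a_in &r_x * .eq &r_k 0)
        (.put a_dA &r_v (.get a_dl (&r_v * &r_n + &r_x) - 1) ;; r_k ≔ 1) .skip))

/-- The first center of each row is the one that matters, as rows are sorted by distance. The
register `r_k` records that it has been passed; the subtraction of `1` undoes the shift in the
stored distances. -/
theorem spec_distCmd {N n s₀ : ℕ} (hN : Big n N) (s : Store) (hn : s.reg r_n = n)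
    (hs : s.reg r_s = s₀) (hsn : s₀ ≤ n) {Γ : SimpleGraph ℕ}
    (hB : ∀ v < n, IsBall n s₀ Γ (s.arr a_ls) (s.arr a_dl) v) (hA : ∀ x, s.arr a_in x ≤ 1)
    (hh : ∀ v < n, hitPos (s.arr a_in) (rowsOf n (s.arr a_ls) v) s₀ < s₀) :
    Spec N distCmd s (n * (n * 120 + 60) + 10) (fun s' => ∀ v < n, s'.arr a_dA v =
      Γ.dist v (s.arr a_ls (v * n + hitPos (s.arr a_in) (rowsOf n (s.arr a_ls) v) s₀))) := by
  set ls := s.arr a_ls with hls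
  set A := s.arr a_in with hA'
  set l := rowsOf n ls with hl
  refine Spec.mono (Spec.loop (fun u s' => ∀ v < u, s'.arr a_dA v =
    Γ.dist v (ls (v * n + hitPos A (l v) s₀))) n (n * 120 + 40) hn trivial (by simp) ?_)
    (by simp; ring_nf; omega) (fun s' h _ => h)
  intro v hv s₁ h1 hF1
  have hn1 : s₁.reg r_n = n := (hF1.reg r_n rfl).trans hn
  have hs1 : s₁.reg r_s = s₀ := (hF1.reg r_s rfl).trans hs
  have hls1 : s₁.arr a_ls = ls := hF1.arr a_ls rfl
  have hdl1 : s₁.arr a_dl = s.arr a_dl := hF1.arr a_dl rfl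
  have hA1 : s₁.arr a_in = A := hF1.arr a_in rfl
  refine Spec.le (Spec.seq (R := fun s' => s' = (s₁.setReg r_v v).setReg r_k 0)
    (Spec.assign (by simpa using hN.zero_lt) (by simp)) (T₂ := n * 120 + 20) ?_) (by simp; omega)
  rintro _ rfl -
  refine Spec.mono (Spec.loop (fun j s' => (∀ v' < v, s'.arr a_dA v' =
    Γ.dist v' (ls (v' * n + hitPos A (l v') s₀))) ∧
    s'.reg r_k = (if hitPos A (l v) j < j then 1 else 0) ∧
    (hitPos A (l v) j < j → s'.arr a_dA v = Γ.dist v (ls (v * n + hitPos A (l v) j)))) s₀ 109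
    (by simpa using hs1) trivial (by simpa using h1) ?_)
    (by simp; nlinarith) ?_
  · rintro j hj s₂ ⟨g1, g2, g3⟩ hF2
    have hn2 : s₂.reg r_n = n := (hF2.reg r_n rfl).trans (by simpa using hn1)
    have hv2 : s₂.reg r_v = v := (hF2.reg r_v rfl).trans (by simp)
    have hls2 : s₂.arr a_ls = ls := (hF2.arr a_ls rfl).trans (by simpa using hls1)
    have hdl2 : s₂.arr a_dl = s.arr a_dl := (hF2.arr a_dl rfl).trans (by simpa using hdl1)
    have hA2 : s₂.arr a_in = A := (hF2.arr a_in rfl).trans (by simpa using hA1)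
    set x := ls (v * n + j) with hx
    have hxn : x < n := (hB v hv).lt j hj
    have hAx : A x ≤ 1 := hA x
    have hlx : l v j = x := rfl
    have hle := hitPos_le A (l v) j
    refine Spec.le (Spec.seq (R := fun s' => s' = (s₂.setReg r_j j).setReg r_x x)
      (Spec.assign ?_ ?_) (T₂ := 80) ?_) (by simp)
    · simpa [hv2, hn2] using ⟨hN.mul hv.le le_rfl, hN.idx hv.le le_rfl (by omega)⟩
    · simp [hv2, hn2, hls2, hx]
    rintro _ rfl -
    refine Spec.le (Spec.ite (T := 60) ?_ (fun hz => ?_) (fun hz => ?_)) (by simp)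
    · simp only [Ex.ok_mul, Ex.ok_get, Ex.ok_var, Ex.ok_eq, Ex.ok_zero, true_and, Ex.eval_get,
        Ex.eval_var, Ex.eval_eq, Store.arr_setReg, Store.reg_setReg, Nat.reduceEqDiff, reduceIte,
        hA2, Ex.eval_zero]
      refine ⟨hN.zero_lt, hN.const ?_⟩
      split_ifs <;> omega
    · have hz' : A x ≠ 0 ∧ s₂.reg r_k = 0 := by
        simpa [hA2, and_comm] using hz
      have hj0 : hitPos A (l v) j = j := by
        have := hz'.2
        rw [g2] at this
        split_ifs at this
        omega
      have hj1 : hitPos A (l v) (j + 1) = j := by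
        rw [hitPos, if_neg (by rw [hlx]; exact fun h => hz'.1 h.2), hj0]
      rw [hj1]
      refine Spec.flat rfl ?_ (by decide) ?_
      · simp only [Cmd.ok, Cmd.den, Ex.ok_get, Ex.ok_var, Ex.ok_add, Ex.ok_mul, Ex.ok_sub,
          Ex.ok_one, true_and, Ex.eval_mul, Ex.eval_var, Store.reg_setReg, Nat.reduceEqDiff,
          reduceIte, hn2, hv2, OfNat.zero_ne_ofNat]
        exact ⟨⟨⟨hN.mul hv.le le_rfl, hN.idx hv.le le_rfl hxn.le⟩, hN.one_lt⟩, hN.one_lt⟩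
      · simp only [Cmd.den, Ex.eval_get, Ex.eval_var, Ex.eval_add, Ex.eval_mul, Ex.eval_one,
          Ex.eval_sub, Store.reg_setReg, Store.arr_setReg, Store.arr_setArr, Store.reg_setArr,
          Nat.reduceEqDiff, reduceIte, hn2, hv2, hdl2, OfNat.zero_ne_ofNat]
        refine ⟨fun v' hv' => ?_, by simp, fun _ => ?_⟩
        · rw [Function.update_of_ne (by omega), g1 v' hv']
        · rw [Function.update_self, hx, (hB v hv).dl_mem j hj, Nat.add_sub_cancel]
    · have hz' : A x = 0 ∨ s₂.reg r_k ≠ 0 := by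
        by_contra h
        push Not at h
        simp [hA2, h.1, h.2] at hz
      refine (Spec.skip ?_).le (by omega)
      simp only [Store.reg_setReg, Store.arr_setReg, Nat.reduceEqDiff, reduceIte]
      by_cases hlt : hitPos A (l v) j < j
      · have e : hitPos A (l v) (j + 1) = hitPos A (l v) j := by
          rw [hitPos, if_neg (by omega)]
        rw [e]
        refine ⟨g1, ?_, fun _ => g3 hlt⟩
        rw [g2, if_pos hlt, if_pos (by omega)]
      · rw [if_neg hlt] at g2
        have e : hitPos A (l v) (j + 1) = j + 1 := by
          rw [hitPos, if_pos ⟨by omega, by rw [hlx]; exact hz'.resolve_right (by omega)⟩]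
        rw [e]
        simp only [lt_irrefl, reduceIte, false_imp_iff, and_true]
        exact ⟨g1, g2⟩
  · rintro s₂ ⟨g1, _, g3⟩ _ v' hv'
    rcases Nat.lt_succ_iff_lt_or_eq.1 hv' with hv' | rfl
    exacts [g1 v' hv', g3 (hh _ hv)]

/-! ### The matrix -/

/-- The vertex `u` is in the cluster of `w`, in terms of the arrays. -/
def InCluster (n : ℕ) (dl dA : ℕ → ℕ) (u w : ℕ) : Prop :=
  dl (u * n + w) ≠ 0 ∧ dl (u * n + w) ≤ dA u

instance (n : ℕ) (dl dA : ℕ → ℕ) (u w : ℕ) : Decidable (InCluster n dl dA u w) :=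
  inferInstanceAs (Decidable (_ ∧ _))

/-- The minimum of `n` and of the sums of distances over the first clusters. -/
def entryUpTo (n : ℕ) (dl dA : ℕ → ℕ) (u v : ℕ) : ℕ → ℕ
  | 0 => n
  | w + 1 => if InCluster n dl dA u w ∧ InCluster n dl dA v w then
      min (entryUpTo n dl dA u v w) ((dl (u * n + w) - 1) + (dl (v * n + w) - 1))
    else entryUpTo n dl dA u v w

/-- Fill the matrix with `n`. -/
def fillCmd : Cmd :=
  .loop r_x &r_n (.loop r_y &r_n (.put a_M (&r_x * &r_n + &r_y) &r_n))

/-- List the cluster of `r_w`. -/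
def gatherCmd : Cmd :=
  r_k ≔ 0 ;;
  .loop r_v &r_n (.ite (.get a_dl (&r_v * &r_n + &r_w) *
      .lt (.get a_dl (&r_v * &r_n + &r_w)) (.get a_dA &r_v + 1))
    (.put a_T &r_k &r_v ;; r_k ≔ &r_k + 1) .skip)

/-- Update the matrix for the pairs in the cluster of `r_w`. -/
def pairsCmd : Cmd :=
  .loop r_u &r_k (.loop r_j &r_k (
    (r_x ≔ .get a_T &r_u ;; r_y ≔ .get a_T &r_j ;;
      r_m ≔ (.get a_dl (&r_x * &r_n + &r_w) - 1) + (.get a_dl (&r_y * &r_n + &r_w) - 1)) ;;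
    .ite (.lt &r_m (.get a_M (&r_x * &r_n + &r_y))) (.put a_M (&r_x * &r_n + &r_y) &r_m) .skip))

/-- Compute the matrix. -/
def matrixCmd : Cmd := fillCmd ;; .loop r_w &r_n (gatherCmd ;; pairsCmd)

theorem spec_fillCmd {N n : ℕ} (hN : Big n N) (s : Store) (hn : s.reg r_n = n) :
    Spec N fillCmd s (n * (n * 40 + 30) + 10) (fun s' =>
      ∀ u < n, ∀ v < n, s'.arr a_M (u * n + v) = n) := by
  refine Spec.mono (Spec.loop (fun i s' => ∀ u < i, ∀ v < n, s'.arr a_M (u * n + v) = n) n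
    (n * 40 + 9) hn trivial (by simp) ?_) (by simp; ring_nf; omega) (fun s' h _ => h)
  intro x hx s₁ h1 hF1
  have hn1 : s₁.reg r_n = n := (hF1.reg r_n rfl).trans hn
  refine Spec.mono (Spec.loop (fun j s' => (∀ u < x, ∀ v < n, s'.arr a_M (u * n + v) = n) ∧
    ∀ v < j, s'.arr a_M (x * n + v) = n) n 29 (by simpa using hn1) trivial
    ⟨by simpa using h1, by simp⟩ ?_) (by simp; omega) ?_
  · rintro y hy s₂ ⟨h2, h3⟩ hF2
    have hn2 : s₂.reg r_n = n := (hF2.reg r_n rfl).trans (by simpa using hn1)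
    have hx2 : s₂.reg r_x = x := (hF2.reg r_x rfl).trans (by simp)
    refine (Spec.put ?_ (by simp) ?_).le (by simp)
    · simpa [hx2, hn2] using ⟨hN.mul hx.le le_rfl, hN.idx hx.le le_rfl hy.le⟩
    · simp only [Store.arr_setArr, Ex.eval_add, Ex.eval_mul, Ex.eval_var, Store.reg_setReg,
        Store.arr_setReg, Nat.reduceEqDiff, reduceIte, hx2, hn2, OfNat.zero_ne_ofNat,
        Function.update_apply]
      refine ⟨fun u hu v hv => ?_, fun v hv => ?_⟩
      · rw [h2 u hu v hv, ite_self]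
      · split_ifs with h
        · rfl
        · exact h3 v (by omega)
  · rintro s₂ ⟨h2, h3⟩ _ u hu v hv
    rcases Nat.lt_succ_iff_lt_or_eq.1 hu with hu | rfl
    exacts [h2 u hu v hv, h3 v hv]

theorem spec_gatherCmd {N n : ℕ} (hN : Big n N) (s : Store) (hn : s.reg r_n = n) {w : ℕ}
    (hw : s.reg r_w = w) (hwn : w < n) (hdl : ∀ u < n, ∀ v < n, s.arr a_dl (u * n + v) ≤ n)
    (hdA : ∀ u < n, s.arr a_dA u ≤ n) :
    Spec N gatherCmd s (n * 110 + 20) (fun s' =>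
      s'.reg r_k = ∑ v ∈ Finset.range n,
        (if InCluster n (s.arr a_dl) (s.arr a_dA) v w then 1 else 0) ∧
      (∀ i < s'.reg r_k, s'.arr a_T i < n) ∧
      ∀ v < n, InCluster n (s.arr a_dl) (s.arr a_dA) v w ↔ ∃ i < s'.reg r_k, s'.arr a_T i = v) := by
  refine Spec.le (Spec.seq (R := fun s' => s' = s.setReg r_k 0)
    (Spec.assign (by simpa using hN.zero_lt) (by simp)) (T₂ := n * 110 + 10) ?_) (by simp; omega)
  rintro _ rfl -
  refine Spec.mono (Spec.loop (fun j s' =>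
      s'.reg r_k = ∑ v ∈ Finset.range j,
        (if InCluster n (s.arr a_dl) (s.arr a_dA) v w then 1 else 0) ∧
      (∀ i < s'.reg r_k, s'.arr a_T i < j) ∧
      ∀ v < j, InCluster n (s.arr a_dl) (s.arr a_dA) v w ↔
        ∃ i < s'.reg r_k, s'.arr a_T i = v) n 99 (by simpa using hn) trivial
      (by simp) ?_) (by simp; omega) (fun s' h _ => h)
  rintro v hv s₁ ⟨h1, h2, h3⟩ hF1
  have hn1 : s₁.reg r_n = n := (hF1.reg r_n rfl).trans (by simpa using hn)
  have hw1 : s₁.reg r_w = w := (hF1.reg r_w rfl).trans (by simpa using hw)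
  have hdl1 : s₁.arr a_dl = s.arr a_dl := (hF1.arr a_dl rfl).trans (by simp)
  have hdA1 : s₁.arr a_dA = s.arr a_dA := (hF1.arr a_dA rfl).trans (by simp)
  have b1 := hdl v hv w hwn
  have b2 := hdA v hv
  set k := s₁.reg r_k with hk
  have hkn : k ≤ v := by
    rw [h1]
    exact (Finset.sum_le_sum fun v _ => show _ ≤ 1 by split_ifs <;> omega).trans (by simp)
  rw [Finset.sum_range_succ, ← h1]
  refine Spec.le (Spec.ite (T := 30) ?_ (fun hz => ?_) (fun hz => ?_)) (by simp)
  · simp only [Ex.ok_mul, Ex.ok_get, Ex.ok_add, Ex.ok_var, Ex.ok_lt, Ex.ok_one, true_and,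
      Ex.eval_lt', Ex.eval_get, Ex.eval_add, Ex.eval_mul, Ex.eval_var, Ex.eval_one,
      Store.arr_setReg, Store.reg_setReg, Nat.reduceEqDiff, reduceIte, hn1, hw1, hdl1, hdA1,
      OfNat.zero_ne_ofNat]
    refine ⟨⟨hN.mul hv.le le_rfl, hN.idx hv.le le_rfl hwn.le⟩, ⟨⟨hN.mul hv.le le_rfl,
      hN.idx hv.le le_rfl hwn.le⟩, hN.one_lt, hN.lin (by omega)⟩, hN.lin ?_⟩
    split_ifs <;> omega
  · have hz' : InCluster n (s.arr a_dl) (s.arr a_dA) v w := by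
      simpa [hn1, hw1, hdl1, hdA1, InCluster, and_comm, Nat.lt_succ_iff] using hz
    rw [if_pos hz']
    refine Spec.flat rfl ?_ (by decide) ?_
    · simpa [Cmd.ok, Cmd.den, ← hk, hN.one_lt] using hN.lin (x := k + 1) (by omega)
    · simp only [Cmd.den, Ex.eval_var, Ex.eval_add, Ex.eval_one, Store.reg_setReg,
        Store.arr_setReg, Store.arr_setArr, Store.reg_setArr, Nat.reduceEqDiff, reduceIte, ← hk,
        true_and]
      refine ⟨?_, ?_⟩
      · intro i hi
        rcases Nat.lt_succ_iff_lt_or_eq.1 hi with hi | rfl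
        · rw [Function.update_of_ne (by omega)]
          exact (h2 i hi).trans (Nat.lt_succ_self v)
        · rw [Function.update_self]
          exact Nat.lt_succ_self v
      · intro v' hv'
        rcases Nat.lt_succ_iff_lt_or_eq.1 hv' with hv' | rfl
        · rw [h3 v' hv']
          constructor
          · rintro ⟨i, hi, e⟩
            exact ⟨i, by omega, by rwa [Function.update_of_ne (by omega)]⟩
          · rintro ⟨i, hi, e⟩
            rcases Nat.lt_succ_iff_lt_or_eq.1 hi with hi | rfl
            · exact ⟨i, hi, by rwa [Function.update_of_ne (by omega)] at e⟩
            · rw [Function.update_self] at e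
              omega
        · exact ⟨fun _ => ⟨k, by omega, Function.update_self _ _ _⟩, fun _ => hz'⟩
  · have hz' : ¬ InCluster n (s.arr a_dl) (s.arr a_dA) v w := by
      intro hp
      have e1 : s.arr a_dl (v * n + w) ≠ 0 := hp.1
      have e2 : s.arr a_dl (v * n + w) < s.arr a_dA v + 1 := Nat.lt_succ_of_le hp.2
      simp [hn1, hw1, hdl1, hdA1, e1, e2] at hz
    rw [if_neg hz']
    refine (Spec.skip ?_).le (by omega)
    simp only [Store.reg_setReg, Store.arr_setReg, Nat.reduceEqDiff, reduceIte, ← hk,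
      Nat.add_zero, true_and]
    refine ⟨?_, ?_⟩
    · exact fun i hi => (h2 i hi).trans (Nat.lt_succ_self v)
    · intro v' hv'
      rcases Nat.lt_succ_iff_lt_or_eq.1 hv' with hv' | rfl
      · exact h3 v' hv'
      · refine ⟨fun h => absurd h hz', ?_⟩
        rintro ⟨i, hi, e⟩
        have := h2 i hi
        omega

theorem spec_pairsCmd {N n : ℕ} (hN : Big n N) (s : Store) (hn : s.reg r_n = n) {w k : ℕ}
    (hw : s.reg r_w = w) (hwn : w < n) (hdl : ∀ u < n, ∀ v < n, s.arr a_dl (u * n + v) ≤ n)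
    (hk : s.reg r_k = k) (hT : ∀ i < k, s.arr a_T i < n) (P : ℕ → Prop) [DecidablePred P]
    (hP : ∀ v < n, P v ↔ ∃ i < k, s.arr a_T i = v) :
    Spec N pairsCmd s (k * k * 170 + k * 20 + 9) (fun s' => ∀ u < n, ∀ v < n,
      s'.arr a_M (u * n + v) = if P u ∧ P v then min (s.arr a_M (u * n + v))
        ((s.arr a_dl (u * n + w) - 1) + (s.arr a_dl (v * n + w) - 1)) else
        s.arr a_M (u * n + v)) := by
  classical
  set T := s.arr a_T with hT'
  set M := s.arr a_M with hM
  set f : ℕ → ℕ := fun u => s.arr a_dl (u * n + w) - 1 with hf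
  refine Spec.mono (Spec.loop (fun i s' => ∀ u < n, ∀ v < n, s'.arr a_M (u * n + v) =
    if ∃ i' j', i' < i ∧ j' < k ∧ T i' = u ∧ T j' = v then min (M (u * n + v)) (f u + f v)
      else M (u * n + v)) k (k * 170 + 9) hk trivial (fun u hu v hv => by simp [hM]) ?_)
      (by simp; ring_nf; omega) ?_
  · intro i hi s₁ h1 hF1
    have hn1 : s₁.reg r_n = n := (hF1.reg r_n rfl).trans hn
    have hk1 : s₁.reg r_k = k := (hF1.reg r_k rfl).trans hk
    have hw1 : s₁.reg r_w = w := (hF1.reg r_w rfl).trans hw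
    have hT1 : s₁.arr a_T = T := hF1.arr a_T rfl
    have hdl1 : s₁.arr a_dl = s.arr a_dl := hF1.arr a_dl rfl
    refine Spec.mono (Spec.loop (fun j s' => ∀ u < n, ∀ v < n, s'.arr a_M (u * n + v) =
      if ∃ i' j', (i' < i ∨ i' = i ∧ j' < j) ∧ j' < k ∧ T i' = u ∧ T j' = v then
        min (M (u * n + v)) (f u + f v) else M (u * n + v)) k 159 (by simpa using hk1) trivial
        (fun u hu v hv => by simp [h1 u hu v hv]) ?_) (by simp; omega) ?_
    · intro j hj s₂ h2 hF2
      have hn2 : s₂.reg r_n = n := (hF2.reg r_n rfl).trans (by simpa using hn1)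
      have hw2 : s₂.reg r_w = w := (hF2.reg r_w rfl).trans (by simpa using hw1)
      have hu2 : s₂.reg r_u = i := (hF2.reg r_u rfl).trans (by simp)
      have hT2 : s₂.arr a_T = T := (hF2.arr a_T rfl).trans (by simpa using hT1)
      have hdl2 : s₂.arr a_dl = s.arr a_dl := (hF2.arr a_dl rfl).trans (by simpa using hdl1)
      set x := T i with hx
      set y := T j with hy
      have hxn : x < n := hT i hi
      have hyn : y < n := hT j hj
      have bx := hdl x hxn w hwn
      have by' := hdl y hyn w hwn
      have hex : ∀ u v, (∃ i' j', (i' < i ∨ i' = i ∧ j' < j + 1) ∧ j' < k ∧ T i' = u ∧ T j' = v) ↔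
          (∃ i' j', (i' < i ∨ i' = i ∧ j' < j) ∧ j' < k ∧ T i' = u ∧ T j' = v) ∨
            (u = x ∧ v = y) := by
        intro u v
        constructor
        · rintro ⟨i', j', h, hj', e1, e2⟩
          by_cases hc : i' = i ∧ j' = j
          · exact Or.inr ⟨by rw [← e1, hc.1], by rw [← e2, hc.2]⟩
          · exact Or.inl ⟨i', j', by omega, hj', e1, e2⟩
        · rintro (⟨i', j', h, hj', e1, e2⟩ | ⟨rfl, rfl⟩)
          · exact ⟨i', j', by omega, hj', e1, e2⟩
          · exact ⟨i, j, by omega, hj, rfl, rfl⟩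
      refine Spec.le (Spec.seq (R := fun s' => s' = (((s₂.setReg r_j j).setReg r_x x).setReg r_y
        y).setReg r_m (f x + f y)) (T₁ := 80) (T₂ := 70) (Spec.flat rfl ?_ (by decide) ?_) ?_)
        (by omega)
      · simp only [Cmd.ok, Cmd.den, Ex.ok_get, Ex.ok_var, Ex.ok_add, Ex.ok_mul, Ex.ok_sub,
          Ex.ok_one, true_and, Ex.eval_mul, Ex.eval_var, Ex.eval_get, Ex.eval_one, Ex.eval_add,
          Ex.eval_sub, Store.reg_setReg, Store.arr_setReg, Nat.reduceEqDiff, reduceIte, hn2, hw2,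
          hu2, hT2, hdl2, ← hx, ← hy, OfNat.zero_ne_ofNat]
        exact ⟨⟨⟨hN.mul hxn.le le_rfl, hN.idx hxn.le le_rfl hwn.le⟩, hN.one_lt⟩,
          ⟨⟨hN.mul hyn.le le_rfl, hN.idx hyn.le le_rfl hwn.le⟩, hN.one_lt⟩, hN.lin (by omega)⟩
      · simp only [Cmd.den, Ex.eval_mul, Ex.eval_var, Ex.eval_get, Ex.eval_one, Ex.eval_add,
          Ex.eval_sub, Store.reg_setReg, Store.arr_setReg, Nat.reduceEqDiff, reduceIte, hn2, hw2,
          hu2, hT2, hdl2, ← hx, ← hy, OfNat.zero_ne_ofNat, hf]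
      rintro _ rfl -
      refine Spec.le (Spec.ite (T := 40) ?_ (fun hz => ?_) (fun hz => ?_)) (by simp)
      · simpa [hn2] using ⟨hN.mul hxn.le le_rfl, hN.idx hxn.le le_rfl hyn.le⟩
      · have hz' : f x + f y < s₂.arr a_M (x * n + y) := by simpa [hn2] using hz
        refine (Spec.put ?_ (by simp) ?_).le (by simp)
        · simpa [hn2] using ⟨hN.mul hxn.le le_rfl, hN.idx hxn.le le_rfl hyn.le⟩
        · intro u hu v hv
          simp only [Store.arr_setArr, Ex.eval_add, Ex.eval_mul, Ex.eval_var, Store.reg_setReg,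
            Store.arr_setReg, Nat.reduceEqDiff, reduceIte, hn2, OfNat.zero_ne_ofNat,
            Function.update_apply, idx_inj hv hyn, hex]
          rw [h2 x hxn y hyn] at hz'
          have h3 := h2 u hu v hv
          by_cases huv : u = x ∧ v = y
          · rw [if_pos huv, if_pos (Or.inr huv), huv.1, huv.2]
            split_ifs at hz' <;> omega
          · rw [if_neg huv, h3]
            simp only [huv, or_false]
      · have hz' : s₂.arr a_M (x * n + y) ≤ f x + f y := by simpa [hn2] using hz
        refine (Spec.skip ?_).le (by omega)
        intro u hu v hv
        simp only [Store.arr_setReg, hex]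
        have h3 := h2 u hu v hv
        by_cases huv : u = x ∧ v = y
        · rw [h2 x hxn y hyn] at hz'
          rw [if_pos (Or.inr huv), h3, huv.1, huv.2]
          split_ifs at hz' ⊢ <;> omega
        · simp only [huv, or_false, h3]
    · intro s₂ h2 _ u hu v hv
      rw [h2 u hu v hv]
      have : (∃ i' j', (i' < i ∨ i' = i ∧ j' < k) ∧ j' < k ∧ T i' = u ∧ T j' = v) ↔
          ∃ i' j', i' < i + 1 ∧ j' < k ∧ T i' = u ∧ T j' = v := by
        constructor <;> rintro ⟨i', j', h, hj', e⟩ <;> exact ⟨i', j', by omega, hj', e⟩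
      simp only [this]
  · intro s' h _ u hu v hv
    rw [h u hu v hv]
    have : (∃ i' j', i' < k ∧ j' < k ∧ T i' = u ∧ T j' = v) ↔ P u ∧ P v := by
      rw [hP u hu, hP v hv]
      constructor
      · rintro ⟨i', j', h1, h2, e1, e2⟩
        exact ⟨⟨i', h1, e1⟩, j', h2, e2⟩
      · rintro ⟨⟨i', h1, e1⟩, j', h2, e2⟩
        exact ⟨i', j', h1, h2, e1, e2⟩
    simp only [this, hf]

/-- This is where small clusters pay off: a cluster has at most `16 * n` ordered pairs, so treating
all pairs in all `n` clusters takes `O(n * n)` steps. -/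
theorem spec_matrixCmd {N n : ℕ} (hN : Big n N) (s : Store) (hn : s.reg r_n = n) (hn0 : 1 ≤ n)
    (hdl : ∀ u < n, ∀ v < n, s.arr a_dl (u * n + v) ≤ n) (hdA : ∀ u < n, s.arr a_dA u ≤ n)
    (hsm : ∀ w < n, (∑ v ∈ Finset.range n,
      if InCluster n (s.arr a_dl) (s.arr a_dA) v w then 1 else 0) * (∑ v ∈ Finset.range n,
      if InCluster n (s.arr a_dl) (s.arr a_dA) v w then 1 else 0) ≤ 16 * n) :
    Spec N matrixCmd s (n * n * 3700) (fun s' => ∀ u < n, ∀ v < n,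
      s'.arr a_M (u * n + v) = entryUpTo n (s.arr a_dl) (s.arr a_dA) u v n) := by
  refine Spec.le (Spec.seq (spec_fillCmd hN s hn) (T₂ := n * n * 3600) ?_) (by nlinarith)
  intro s₁ hM1 hF1
  have hn1 : s₁.reg r_n = n := (hF1.reg r_n rfl).trans hn
  have hdl1 : s₁.arr a_dl = s.arr a_dl := hF1.arr a_dl rfl
  have hdA1 : s₁.arr a_dA = s.arr a_dA := hF1.arr a_dA rfl
  refine Spec.mono (Spec.loop (fun w s' => ∀ u < n, ∀ v < n,
    s'.arr a_M (u * n + v) = entryUpTo n (s.arr a_dl) (s.arr a_dA) u v w) n (n * 3150 + 40)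
    hn1 trivial hM1 ?_) (by simp; nlinarith) (fun s' h _ => h)
  intro w hw s₂ h2 hF2
  have hn2 : s₂.reg r_n = n := (hF2.reg r_n rfl).trans hn1
  have hdl2 : s₂.arr a_dl = s.arr a_dl := (hF2.arr a_dl rfl).trans hdl1
  have hdA2 : s₂.arr a_dA = s.arr a_dA := (hF2.arr a_dA rfl).trans hdA1
  refine Spec.le (Spec.seq (spec_gatherCmd hN (s₂.setReg r_w w) (by simpa using hn2) (w := w)
    (by simp) hw (by simpa [hdl2] using hdl) (by simpa [hdA2] using hdA))
    (T₂ := n * 3040 + 9) ?_) (by omega)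
  simp only [Store.arr_setReg, hdl2, hdA2]
  rintro s₃ ⟨hk3, hT3, hP3⟩ hF3
  have hM3 : s₃.arr a_M = s₂.arr a_M := (hF3.arr a_M rfl).trans (by simp)
  have hdl3 : s₃.arr a_dl = s.arr a_dl := (hF3.arr a_dl rfl).trans (by simpa using hdl2)
  have hks := hsm w hw
  rw [← hk3] at hks
  refine Spec.mono (spec_pairsCmd hN s₃ ((hF3.reg r_n rfl).trans (by simpa using hn2)) (w := w)
    ((hF3.reg r_w rfl).trans (by simp)) hw (by simpa [hdl3] using hdl) rfl hT3 _ hP3) ?_ ?_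
  · set k := s₃.reg r_k
    clear_value k
    have : k ≤ k * k := Nat.le_mul_self k
    nlinarith
  · intro s₄ h4 _ u hu v hv
    rw [h4 u hu v hv, hM3, hdl3, h2 u hu v hv, entryUpTo]

/-! ### Maxima -/

/-- An entry of the final matrix. -/
def finalEntry (n : ℕ) (M dA : ℕ → ℕ) (u v : ℕ) : ℕ :=
  if u = v then 0 else if M (u * n + v) = n then dA u + dA v - 1 else M (u * n + v)

/-- Compute the largest entry of the final matrix. -/
def maxCmd : Cmd :=
  r_d ≔ 0 ;;
  .loop r_x &r_n (.loop r_y &r_n (.ite (.eq &r_x &r_y) .skip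
    (.ite (.eq (.get a_M (&r_x * &r_n + &r_y)) &r_n)
      (r_m ≔ .get a_dA &r_x + .get a_dA &r_y - 1) (r_m ≔ .get a_M (&r_x * &r_n + &r_y)) ;;
     .ite (.lt &r_d &r_m) (r_d ≔ &r_m) .skip)))

theorem sup_range_succ (f : ℕ → ℕ) (k : ℕ) :
    (Finset.range (k + 1)).sup f = max ((Finset.range k).sup f) (f k) := by
  rw [Finset.range_add_one, Finset.sup_insert, max_comm]

theorem spec_maxCmd {N n : ℕ} (hN : Big n N) (s : Store) (hn : s.reg r_n = n) (hn0 : 1 ≤ n)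
    (hdA : ∀ u < n, s.arr a_dA u ≤ n) :
    Spec N maxCmd s (n * n * 200) (fun s' => s'.reg r_d = (Finset.range n).sup fun u =>
      (Finset.range n).sup fun v => finalEntry n (s.arr a_M) (s.arr a_dA) u v) := by
  set M := s.arr a_M with hM
  set dA := s.arr a_dA with hdA'
  refine Spec.le (Spec.seq (R := fun s' => s' = s.setReg r_d 0)
    (Spec.assign (by simpa using hN.zero_lt) (by simp)) (T₂ := n * (n * 150 + 20) + 10) ?_)
    (by simp; nlinarith)
  rintro _ rfl -
  refine Spec.mono (Spec.loop (fun i s' => s'.reg r_d = (Finset.range i).sup fun u =>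
    (Finset.range n).sup fun v => finalEntry n M dA u v) n (n * 150 + 9) (by simpa using hn) trivial
    (by simp) ?_) (by simp; ring_nf; omega) (fun s' h _ => h)
  intro x hx s₁ h1 hF1
  have hn1 : s₁.reg r_n = n := (hF1.reg r_n rfl).trans (by simpa using hn)
  have hM1 : s₁.arr a_M = M := (hF1.arr a_M rfl).trans (by simp [hM])
  have hdA1 : s₁.arr a_dA = dA := (hF1.arr a_dA rfl).trans (by simp [hdA'])
  rw [sup_range_succ, ← h1]
  refine Spec.mono (Spec.loop (fun j s' => s'.reg r_d = max (s₁.reg r_d)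
    ((Finset.range j).sup fun v => finalEntry n M dA x v)) n 139 (by simpa using hn1) trivial
    (by simp) ?_) (by simp; omega) (fun s' h _ => h)
  intro y hy s₂ h2 hF2
  have hn2 : s₂.reg r_n = n := (hF2.reg r_n rfl).trans (by simpa using hn1)
  have hx2 : s₂.reg r_x = x := (hF2.reg r_x rfl).trans (by simp)
  have hM2 : s₂.arr a_M = M := (hF2.arr a_M rfl).trans (by simpa using hM1)
  have hdA2 : s₂.arr a_dA = dA := (hF2.arr a_dA rfl).trans (by simpa using hdA1)
  have bx := hdA x hx
  have by' := hdA y hy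
  rw [sup_range_succ, ← max_assoc, ← h2]
  refine Spec.le (Spec.ite (T := 125) (by simp) (fun hz => ?_) (fun hz => ?_)) (by simp)
  · have hxy : x = y := by simpa [hx2] using hz
    refine (Spec.skip ?_).le (by omega)
    simp [finalEntry, hxy]
  · have hxy : x ≠ y := by simpa [hx2] using hz
    have e1 : x * n < N ∧ x * n + y < N := ⟨hN.mul hx.le le_rfl, hN.idx hx.le le_rfl hy.le⟩
    refine Spec.le (Spec.seq (R := fun s' => s' = (s₂.setReg r_y y).setReg r_m
      (finalEntry n M dA x y)) (Spec.ite (T := 30) ?_ (fun hc => ?_) (fun hc => ?_)) (T₂ := 30) ?_)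
      (by simp)
    · simpa [hx2, hn2] using e1
    · have hc' : M (x * n + y) = n := by simpa [hx2, hn2, hM2] using hc
      refine (Spec.assign ?_ ?_).le (by simp)
      · simpa [hx2, hdA2, hN.one_lt] using hN.lin (x := dA x + dA y) (by omega)
      · simp [hx2, hdA2, finalEntry, hxy, hc']
    · have hc' : M (x * n + y) ≠ n := by simpa [hx2, hn2, hM2] using hc
      refine (Spec.assign ?_ ?_).le (by simp)
      · simpa [hx2, hn2] using e1
      · simp [hx2, hn2, hM2, finalEntry, hxy, hc']
    rintro _ rfl -
    refine Spec.le (Spec.ite (T := 10) (by simp) (fun hz => ?_) (fun hz => ?_)) (by simp)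
    · have hz' : s₂.reg r_d < finalEntry n M dA x y := by simpa using hz
      refine (Spec.assign (by simp) ?_).le (by simp)
      simpa using hz'.le
    · have hz' : finalEntry n M dA x y ≤ s₂.reg r_d := by simpa using hz
      refine (Spec.skip ?_).le (by omega)
      simpa using hz'

/-- Compute the largest distance in the spanner from a center. -/
def eccCmd : Cmd :=
  listsCmd (.get a_H (&r_x * &r_n + &r_y)) ;; (r_K ≔ &r_n ;; r_e ≔ 0) ;;
  .loop r_v &r_n (.ite (.get a_in &r_v) (r_src ≔ &r_v ;; bfsCmd ;;
    .loop r_x &r_n (r_m ≔ .get a_D &r_x - 1 ;; .ite (.lt &r_e &r_m) (r_e ≔ &r_m) .skip)) .skip)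

/-- Only centers start a search, so the dominant cost is `R` searches in a graph with `E` ordered
pairs of neighbours. Here the sparsity of the spanner and the small number of centers are both
needed. -/
theorem spec_eccCmd {N n : ℕ} (hN : Big n N) (s : Store) (hn : s.reg r_n = n) (hn0 : 1 ≤ n)
    {H : SimpleGraph ℕ} (hH : IsMatrix n (s.arr a_H) H) (hc : ∀ u < n, ∀ v < n, H.Reachable u v)
    {E R : ℕ} (hE : pairCount n H ≤ E) (hA : ∀ x, s.arr a_in x ≤ 1)
    (hR : ∑ x ∈ Finset.range n, s.arr a_in x ≤ R) :
    Spec N eccCmd s (n * n * 300 + R * (180 * n + 120 * E + 150)) (fun s' =>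
      s'.reg r_e = (Finset.range n).sup fun v => if s.arr a_in v = 0 then 0 else
        (Finset.range n).sup fun x => H.dist v x) := by
  set A := s.arr a_in with hA'
  have hnn : n ≤ n * n := Nat.le_mul_self n
  refine Spec.le (Spec.seq (spec_listsCmd hN _ s hn H hH.supp ?_)
    (T₂ := n * n * 70 + R * (180 * n + 120 * E + 150)) ?_)
    (by simp; nlinarith)
  · intro s' u hu v hv hF hx hy
    have hn' : s'.reg r_n = n := (hF.reg r_n rfl).trans hn
    have ha' : s'.arr a_H = s.arr a_H := hF.arr a_H rfl
    simp only [Ex.ok_get, Ex.ok_add, Ex.ok_mul, Ex.ok_var, true_and, Ex.eval_mul, Ex.eval_add,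
      Ex.eval_var, Ex.eval_get, hx, hy, hn', ha', hH.ne_zero_iff hu hv, and_true]
    exact ⟨hN.mul hu.le le_rfl, hN.idx hu.le le_rfl hv.le⟩
  intro s₁ hL1 hF1
  have hn1 : s₁.reg r_n = n := (hF1.reg r_n rfl).trans hn
  have hA1 : s₁.arr a_in = A := hF1.arr a_in rfl
  refine Spec.le (Spec.seq (R := fun s' => s' = (s₁.setReg r_K n).setReg r_e 0) (T₁ := 20)
    (Spec.flat rfl (by simp [Cmd.ok, hN.zero_lt]) (by decide) (by simp [Cmd.den, hn1]))
    (T₂ := 9 + n * 20 + R * (180 * n + 120 * E + 150)) ?_) (by omega)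
  rintro _ rfl -
  refine Spec.mono (Spec.loopAcc (fun i t s' => (s'.reg r_e = (Finset.range i).sup fun v =>
      if A v = 0 then 0 else (Finset.range n).sup fun x => H.dist v x) ∧
      t ≤ i * 20 + (∑ v ∈ Finset.range i, A v) * (180 * n + 120 * E + 150)) n
      (by simpa using hn1) trivial (by simp) ?_ ?_) le_rfl (fun s' ⟨_, h, _⟩ _ => h)
  · rintro v hv t s₂ ⟨h2, ht⟩ hF2
    have hn2 : s₂.reg r_n = n := (hF2.reg r_n rfl).trans (by simpa using hn1)
    have hK2 : s₂.reg r_K = n := (hF2.reg r_K rfl).trans (by simp)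
    have hA2 : s₂.arr a_in = A := (hF2.arr a_in rfl).trans (by simpa using hA1)
    have hdg2 : s₂.arr a_dg = s₁.arr a_dg := (hF2.arr a_dg rfl).trans (by simp)
    have hnb2 : s₂.arr a_nb = s₁.arr a_nb := (hF2.arr a_nb rfl).trans (by simp)
    rw [sup_range_succ, ← h2, Finset.sum_range_succ]
    by_cases hv0 : A v = 0
    · rw [if_pos hv0, hv0, Nat.add_zero (∑ v ∈ Finset.range v, A v)]
      refine ⟨8, (Spec.ite (T := 1) (by simp) (fun hz => ?_) (fun hz => ?_)).le (by simp)⟩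
      · simp [hA2, hv0] at hz
      · exact (Spec.skip ⟨by simp, by omega⟩).le (by omega)
    · have hv1 : A v = 1 := by have := hA v; omega
      rw [if_neg hv0, hv1, Nat.succ_mul (∑ v ∈ Finset.range v, A v)]
      refine ⟨180 * n + 120 * E + 155, (Spec.ite (T := 180 * n + 120 * E + 148) (by simp)
        (fun hz => ?_) (fun hz => ?_)).le (by simp; omega)⟩
      swap
      · simp [hA2, hv1] at hz
      refine Spec.le (Spec.seq (R := fun s' => s' = (s₂.setReg r_v v).setReg r_src v)
        (Spec.assign trivial (by simp)) (T₂ := 180 * n + 120 * E + 139) ?_) (by simp; omega)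
      rintro _ rfl -
      refine Spec.le (Spec.seq (spec_bfsCmd hN _ (by simpa using hn2) n v E (by simpa using hK2)
        (by simp) (by omega) le_rfl hv H (by simpa [hdg2, hnb2] using hL1) ?_)
        (T₂ := n * 60 + 9) ?_) (by omega)
      · intro S hS _
        refine le_trans ?_ (hL1.sum_deg_le.trans hE)
        refine (Finset.sum_le_sum fun u _ => min_le_left _ _).trans ?_
        simp only [Store.arr_setReg, hdg2]
        exact Finset.sum_le_sum_of_subset hS
      · rintro s₃ ⟨_, hB, hS⟩ hF3
        have hn3 : s₃.reg r_n = n := (hF3.reg r_n rfl).trans (by simpa using hn2)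
        have he3 : s₃.reg r_e = s₂.reg r_e := (hF3.reg r_e rfl).trans (by simp)
        refine Spec.mono (Spec.loop (fun i s' => s'.reg r_e = max (s₂.reg r_e)
          ((Finset.range i).sup fun x => H.dist v x)) n 49 hn3 trivial (by simp [he3]) ?_)
          (by simp; omega) (fun s' h _ => ⟨h, by omega⟩)
        intro x hx s₄ h4 hF4
        have hD4 : s₄.arr a_D = s₃.arr a_D := hF4.arr a_D rfl
        have hDx : s₃.arr a_D x - 1 = H.dist v x := by
          obtain ⟨i, hi, rfl⟩ := hB.complete hS hH.supp hv x (hc v hv x hx)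
          rw [hB.D_q i hi, Nat.add_sub_cancel]
        rw [sup_range_succ, ← max_assoc, ← h4, ← hDx]
        refine Spec.le (Spec.seq (R := fun s' => s' = (s₄.setReg r_x x).setReg r_m
          (s₃.arr a_D x - 1)) (Spec.assign (by simpa using hN.one_lt) (by simp [hD4]))
          (T₂ := 30) ?_) (by simp)
        rintro _ rfl -
        refine Spec.le (Spec.ite (T := 10) (by simp) (fun hz => ?_) (fun hz => ?_)) (by simp)
        · have hz' : s₄.reg r_e < s₃.arr a_D x - 1 := by
            simp at hz
            omega
          refine (Spec.assign (by simp) ?_).le (by simp)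
          simpa using hz'.le
        · have hz' : s₃.arr a_D x - 1 ≤ s₄.reg r_e := by simpa using hz
          refine (Spec.skip ?_).le (by omega)
          simpa using hz'
  · rintro t s' ⟨_, ht⟩ _
    have := Nat.mul_le_mul_right (180 * n + 120 * E + 150) hR
    simp
    omega

/-- Return the estimate. -/
def outputCmd : Cmd :=
  r_e ≔ &r_e - 2 ;; .ite (.lt &r_d &r_e) (r_n ≔ &r_e) (r_n ≔ &r_d)

theorem spec_outputCmd {N n : ℕ} (hN : Big n N) (s : Store) :
    Spec N outputCmd s 40 (fun s' => s'.reg 0 = max (s.reg r_d) (s.reg r_e - 2)) := by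
  refine Spec.le (Spec.seq (R := fun s' => s' = s.setReg r_e (s.reg r_e - 2))
    (Spec.assign (by simpa using hN.two_lt) (by simp)) (T₂ := 25) ?_) (by simp)
  rintro _ rfl -
  refine Spec.le (Spec.ite (T := 10) (by simp) (fun hz => ?_) (fun hz => ?_)) (by simp)
  · have hz' : s.reg r_d < s.reg r_e - 2 := by
      simp at hz
      omega
    refine (Spec.assign (by simp) ?_).le (by simp)
    simpa using hz'.le
  · have hz' : s.reg r_e - 2 ≤ s.reg r_d := by simpa using hz
    refine (Spec.assign (by simp) ?_).le (by simp)
    simpa using hz'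

/-! ### The estimate and the diameter -/

section Estimate

variable {V : Type*} {G H : SimpleGraph V} {A : Set V}

theorem SimpleGraph.Connected.exists_dist_eq (hG : G.Connected) (u v : V) (k : ℕ)
    (hk : k ≤ G.dist u v) : ∃ w, G.dist u w = G.dist u v - k ∧ G.dist w v = k := by
  suffices h : ∃ w, G.dist u w = G.dist u v - k ∧ G.dist w v ≤ k by
    obtain ⟨w, h1, h2⟩ := h
    have := hG.dist_triangle (u := u) (v := w) (w := v)
    exact ⟨w, h1, by omega⟩
  induction k with
  | zero => exact ⟨v, by simp, by simp⟩
  | succ k ih =>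
    obtain ⟨w, h1, h2⟩ := ih (by omega)
    have hne : u ≠ w := by
      rintro rfl
      rw [SimpleGraph.dist_self] at h1
      omega
    obtain ⟨y, _, hyw, hd⟩ := (hG.preconnected u w).exists_adj_dist hne
    have h3 := hG.dist_triangle (u := y) (v := w) (w := v)
    rw [SimpleGraph.dist_eq_one_iff_adj.2 hyw] at h3
    exact ⟨y, by omega, by omega⟩

/-! ### Distances to the centers and the entries of the matrix -/

theorem distToSet_le {a : V} (ha : a ∈ A) (u : V) : distToSet G A u ≤ G.dist u a :=
  Nat.sInf_le ⟨a, ha, rfl⟩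

theorem exists_dist_eq_distToSet (hA : A.Nonempty) (u : V) :
    ∃ a ∈ A, G.dist u a = distToSet G A u := Nat.sInf_mem (hA.image _)

theorem distToSet_le_add (hG : G.Connected) (hA : A.Nonempty) (u v : V) :
    distToSet G A u ≤ G.dist u v + distToSet G A v := by
  obtain ⟨a, ha, e⟩ := exists_dist_eq_distToSet (G := G) hA v
  rw [← e]
  exact (distToSet_le ha u).trans hG.dist_triangle

theorem SimpleGraph.Connected.dist_lt_card [Finite V] (hG : G.Connected) (u v : V) :
    G.dist u v < Nat.card V := by
  have := Fintype.ofFinite V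
  obtain ⟨p, hp, e⟩ := hG.exists_path_of_dist u v
  rw [← e, Nat.card_eq_fintype_card]
  exact hp.length_lt

/-- Some vertex of a shortest path from `u` to `v` lies in both bunches, so its sum of distances is
`d(u,v)`; no other sum is smaller by the triangle inequality, and `n` exceeds every distance. -/
theorem clusterEntry_eq_dist [Finite V] (hG : G.Connected) (hA : A.Nonempty) {u v : V}
    (h : G.dist u v + 2 ≤ distToSet G A u + distToSet G A v) :
    clusterEntry G A u v = G.dist u v := by
  have h1 := distToSet_le_add hG hA u v
  have h2 := distToSet_le_add hG hA v u
  rw [G.dist_comm] at h2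
  refine IsLeast.csInf_eq ⟨Or.inr ?_, ?_⟩
  -- The witness is the last vertex of the path still in the bunch of `u`: it has distance `d(u,A) -
  -- 1` from `u`, or is `v` itself if the path is shorter. The truncated subtraction is harmless,
  -- since the hypothesis and `h2` force `d(u,A) > 0`.
  · obtain ⟨w, hw1, hw2⟩ := hG.exists_dist_eq u v
      (G.dist u v - min (G.dist u v) (distToSet G A u - 1)) (Nat.sub_le _ _)
    have e := G.dist_comm (u := w) (v := v)
    refine ⟨w, ?_, ?_, by omega⟩
    · show G.dist u w < distToSet G A u
      omega
    · show G.dist v w < distToSet G A v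
      omega
  · rintro k (rfl | ⟨w, _, _, rfl⟩)
    · exact (hG.dist_lt_card u v).le
    · rw [G.dist_comm (u := v)]
      exact hG.dist_triangle

/-- A vertex in both bunches would give `d(u,v) ≤ (d(u,A) - 1) + (d(v,A) - 1)`. -/
theorem clusterEntry_eq_card (hG : G.Connected) {u v : V}
    (h : distToSet G A u + distToSet G A v < G.dist u v + 2) :
    clusterEntry G A u v = Nat.card V := by
  refine IsLeast.csInf_eq ⟨Or.inl rfl, ?_⟩
  rintro k (rfl | ⟨w, h1, h2, rfl⟩)
  · exact le_rfl
  · have h1' : G.dist u w < distToSet G A u := h1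
    have h2' : G.dist v w < distToSet G A v := h2
    have := hG.dist_triangle (u := u) (v := w) (w := v)
    rw [G.dist_comm (u := w)] at this
    omega

/-- The two preceding cases are complementary, and the condition that separates them also decides
which term of the minimum is smaller. As distances are below `n`, the value `n` unambiguously means
that no common cluster was found. -/
theorem matrixEntry_eq_min [Finite V] (hG : G.Connected) (hA : A.Nonempty) {u v : V}
    (huv : u ≠ v) : matrixEntry G A u v =
      min (G.dist u v : ℤ) ((distToSet G A u : ℤ) + distToSet G A v - 1) := by
  rw [matrixEntry, if_neg huv]
  by_cases h : G.dist u v + 2 ≤ distToSet G A u + distToSet G A v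
  · rw [clusterEntry_eq_dist hG hA h, if_neg (hG.dist_lt_card u v).ne]
    omega
  · rw [clusterEntry_eq_card hG (by omega), if_pos rfl]
    omega

/-! ### Upper and lower bounds for the estimate -/

theorem IsAdditiveSpanner.connected {k : ℕ} (h : IsAdditiveSpanner k G H) (hG : G.Connected) :
    H.Connected := by
  have := hG.nonempty
  refine ⟨fun u v => SimpleGraph.edist_ne_top_iff_reachable.1 (ne_top_of_le_ne_top ?_ (h.2 u v))⟩
  exact WithTop.add_ne_top.2 ⟨SimpleGraph.edist_ne_top_iff_reachable.2 (hG.preconnected u v),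
    ENat.natCast_ne_top k⟩

theorem IsAdditiveSpanner.dist_le {k : ℕ} (h : IsAdditiveSpanner k G H) (hG : G.Connected)
    (u v : V) : H.dist u v ≤ G.dist u v + k := by
  have h1 := h.2 u v
  rw [← (hG.preconnected u v).coe_dist_eq_edist,
    ← ((h.connected hG).preconnected u v).coe_dist_eq_edist] at h1
  exact_mod_cast h1

theorem SimpleGraph.Connected.dist_le_diam [Finite V] (hG : G.Connected) (u v : V) :
    G.dist u v ≤ G.diam := by
  have := hG.nonempty
  exact SimpleGraph.dist_le_diam (SimpleGraph.connected_iff_ediam_ne_top.1 hG)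

theorem SimpleGraph.Connected.toNat_eccent_le_iff [Finite V] (hG : G.Connected) (u : V) (k : ℕ) :
    (G.eccent u).toNat ≤ k ↔ ∀ v, G.dist u v ≤ k := by
  have := hG.nonempty
  have hne : G.eccent u ≠ ⊤ := ne_top_of_le_ne_top
    (SimpleGraph.connected_iff_ediam_ne_top.1 hG) SimpleGraph.eccent_le_ediam
  rw [← Nat.cast_le (α := ℕ∞), ENat.natCast_toNat hne, SimpleGraph.eccent_le_iff]
  refine forall_congr' fun v => ?_
  rw [← (hG.preconnected u v).coe_dist_eq_edist, Nat.cast_le]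

/-- This replaces the suprema, which are taken in the conditionally complete order `ℤ`, by plain
inequalities; finiteness supplies the boundedness. -/
theorem diamEstimate_le_iff [Finite V] (hG : G.Connected) (hH : H.Connected) (hA : A.Nonempty)
    (k : ℤ) : diamEstimate G H A ≤ k ↔
      (∀ u v, matrixEntry G A u v ≤ k) ∧ ∀ a ∈ A, ∀ v, (H.dist a v : ℤ) ≤ k + 2 := by
  have := hG.nonempty
  have := hA.to_subtype
  rw [diamEstimate, max_le_iff, sub_le_iff_le_add, ciSup_le_iff (Set.finite_range _).bddAbove,
    ciSup_le_iff (Set.finite_range _).bddAbove]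
  refine and_congr (by simp) ?_
  simp only [Subtype.forall]
  refine forall₂_congr fun a _ => ?_
  have h1 := hH.toNat_eccent_le_iff a
  constructor
  · intro h v
    have := (h1 _).1 le_rfl v
    omega
  · intro h
    -- One instance suffices to see that `k + 2` is nonnegative, so that `Int.toNat` loses nothing.
    have h0 := h (Classical.arbitrary V)
    have := (h1 (k + 2).toNat).2 fun v => by have := h v; omega
    omega

/-- Matrix entries never exceed distances, and distances in `H` exceed those in `G` by at most the
`2` that is subtracted. -/
theorem diamEstimate_le_diam [Finite V] (hG : G.Connected) (hH : IsAdditiveSpanner 2 G H)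
    (hA : A.Nonempty) : diamEstimate G H A ≤ G.diam := by
  rw [diamEstimate_le_iff hG (hH.connected hG) hA]
  refine ⟨fun u v => ?_, fun a _ v => ?_⟩
  · by_cases huv : u = v
    · simp [matrixEntry, huv]
    · rw [matrixEntry_eq_min hG hA huv]
      have := hG.dist_le_diam u v
      omega
  · have h1 := hH.dist_le hG a v
    have := hG.dist_le_diam a v
    omega

/-- For a diametral pair, `D - k - 2` bounds the distance of both ends to `A` from below. Inserted
into the matrix entry this yields `D ≤ k` or `3k ≥ 2D - 5`; the three residues of `D` modulo `3`
arise from rounding. -/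
theorem le_diamEstimate [Finite V] (hG : G.Connected) (hH : IsAdditiveSpanner 2 G H)
    (hA : A.Nonempty) {h z : ℕ} (hz : G.diam = 3 * h + z) :
    (z = 0 ∨ z = 1 → 2 * (h : ℤ) - 1 ≤ diamEstimate G H A) ∧
      (z = 2 → 2 * (h : ℤ) ≤ diamEstimate G H A) := by
  have hHc := hH.connected hG
  have := hG.nonempty
  obtain ⟨x, y, hxy⟩ := G.exists_dist_eq_diam
  obtain ⟨h1, h2⟩ := (diamEstimate_le_iff hG hHc hA (diamEstimate G H A)).1 le_rfl
  set k := diamEstimate G H A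
  -- Go from `x` to its nearest center and on to `y`; the second distance is at most the one in the
  -- subgraph `H`, hence at most `k + 2`.
  have h3 : ∀ x y, (G.dist x y : ℤ) ≤ k + 2 + distToSet G A x := by
    intro x y
    obtain ⟨a, ha, e⟩ := exists_dist_eq_distToSet (G := G) hA x
    have h4 := h2 a ha y
    have h5 := (hHc.preconnected a y).dist_anti hH.1
    have h6 := hG.dist_triangle (u := x) (v := a) (w := y)
    omega
  have h4 := h3 x y
  have h5 := h3 y x
  rw [G.dist_comm] at h5
  by_cases hne : x = y
  · subst hne
    have h0 := h1 x x
    rw [matrixEntry, if_pos rfl] at h0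
    rw [SimpleGraph.dist_self] at hxy
    omega
  · have h0 := h1 x y
    rw [matrixEntry_eq_min hG hA hne] at h0
    omega

end Estimate

/-! ### Graphs on an initial segment of the natural numbers -/

/-- All edges join numbers below `n`, so a walk that starts there never leaves. Therefore the arrays
can describe graphs on `ℕ` while distances agree with those of the graph on `Fin n`. -/
theorem exists_comap_walk {n : ℕ} {Γ : SimpleGraph ℕ} (hΓ : ∀ u v, Γ.Adj u v → u < n) {a b : ℕ}
    (p : Γ.Walk a b) (u v : Fin n) (hu : (u : ℕ) = a) (hv : (v : ℕ) = b) :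
    ∃ q : (Γ.comap Fin.val).Walk u v, q.length = p.length := by
  induction p generalizing u with
  | nil =>
    obtain rfl : u = v := Fin.ext (hu.trans hv.symm)
    exact ⟨.nil, rfl⟩
  | @cons a c b h p ih =>
    obtain ⟨q, hq⟩ := ih ⟨c, hΓ c a h.symm⟩ rfl hv
    exact ⟨.cons (by simpa [hu] using h) q, by simp [hq]⟩

theorem edist_comap_val {n : ℕ} {Γ : SimpleGraph ℕ} (hΓ : ∀ u v, Γ.Adj u v → u < n)
    (u v : Fin n) : (Γ.comap Fin.val).edist u v = Γ.edist u v := by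
  refine le_antisymm (le_iInf fun p => ?_) (le_iInf fun p => ?_)
  · obtain ⟨q, hq⟩ := exists_comap_walk hΓ p u v rfl rfl
    rw [← hq]
    exact SimpleGraph.edist_le q
  · have := SimpleGraph.edist_le (p.map (SimpleGraph.Hom.comap Fin.val Γ))
    rwa [SimpleGraph.Walk.length_map] at this

theorem dist_comap_val {n : ℕ} {Γ : SimpleGraph ℕ} (hΓ : ∀ u v, Γ.Adj u v → u < n)
    (u v : Fin n) : (Γ.comap Fin.val).dist u v = Γ.dist u v :=
  congrArg ENat.toNat (edist_comap_val hΓ u v)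

theorem reachable_comap_val {n : ℕ} {Γ : SimpleGraph ℕ} (hΓ : ∀ u v, Γ.Adj u v → u < n)
    (u v : Fin n) : (Γ.comap Fin.val).Reachable u v ↔ Γ.Reachable u v := by
  rw [← SimpleGraph.edist_ne_top_iff_reachable, edist_comap_val hΓ,
    SimpleGraph.edist_ne_top_iff_reachable]

/-! ### What the arrays say about bunches and clusters -/

section Arrays

variable {n s : ℕ} {Γ : SimpleGraph ℕ} {ls dl A dA : ℕ → ℕ}

theorem IsBall.pred_dl {v w : ℕ} (hB : IsBall n s Γ ls dl v) (hw : w < n)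
    (h : dl (v * n + w) ≠ 0) : dl (v * n + w) = Γ.dist v w + 1 ∧ Γ.dist v w < s := by
  by_contra hc
  refine h (hB.dl_zero w hw fun p hp e => hc ?_)
  have h1 := hB.dist_le p hp
  rw [← e]
  exact ⟨hB.dl_mem p hp, by omega⟩

/-- Stored distances are shifted by one, so comparing them with `dA v` by `≤` tests the strict
inequality. Conversely a vertex closer than the first center stands before it in the row, so its
distance was stored. -/
theorem inCluster_iff {v w : ℕ} (hB : IsBall n s Γ ls dl v)
    (hp : hitPos A (rowsOf n ls v) s < s)
    (hdA : dA v = Γ.dist v (ls (v * n + hitPos A (rowsOf n ls v) s))) (hw : w < n) :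
    InCluster n dl dA v w ↔ Γ.dist v w < dA v := by
  constructor
  · rintro ⟨h1, h2⟩
    have := (hB.pred_dl hw h1).1
    omega
  · intro h
    obtain ⟨p', hp', rfl⟩ := hB.order _ hp w hw (hdA ▸ h)
    have := hB.dl_mem p' (by omega)
    exact ⟨by omega, by omega⟩

/-- Members of a cluster stand before the first center in their rows. The converse may fail for
vertices at the same distance as that center, so the greedy choice controls an upper bound for the
cluster. -/
theorem sum_inCluster_le (hB : ∀ v < n, IsBall n s Γ ls dl v)
    (hp : ∀ v < n, hitPos A (rowsOf n ls v) s < s)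
    (hdA : ∀ v < n, dA v = Γ.dist v (ls (v * n + hitPos A (rowsOf n ls v) s))) {w : ℕ}
    (hw : w < n) :
    (∑ v ∈ Finset.range n, if InCluster n dl dA v w then 1 else 0) ≤
      clusterSize n s (rowsOf n ls) A w := by
  refine Finset.sum_le_sum fun v hv => ?_
  have hv' := Finset.mem_range.1 hv
  split_ifs with h
  · rw [inCluster_iff (hB v hv') (hp v hv') (hdA v hv') hw, hdA v hv'] at h
    obtain ⟨p', hp', e⟩ := (hB v hv').order _ (hp v hv') w hw h
    refine le_trans ?_ (Finset.single_le_sum (f := fun j => if rowsOf n ls v j = w then 1 else 0)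
      (fun _ _ => Nat.zero_le _) (Finset.mem_range.2 hp'))
    simp [rowsOf, e]
  · exact Nat.zero_le _

/-- The set of centers that the array describes. -/
def centers (n : ℕ) (A : ℕ → ℕ) : Set (Fin n) := {x | A x ≠ 0}

/-- A closer center would precede the first center in the row, whether or not it was expected among
the `s` nearest vertices. -/
theorem distToSet_centers (hΓ : ∀ u v, Γ.Adj u v → u < n) {v : Fin n} (hB : IsBall n s Γ ls dl v)
    (hp : hitPos A (rowsOf n ls v) s < s)
    (hdA : dA v = Γ.dist v (ls (v * n + hitPos A (rowsOf n ls v) s))) :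
    distToSet (Γ.comap Fin.val) (centers n A) v = dA v := by
  refine IsLeast.csInf_eq ⟨⟨⟨_, hB.lt _ hp⟩, ne_zero_at_hitPos hp, ?_⟩, ?_⟩
  · rw [dist_comap_val hΓ, hdA]
  · rintro _ ⟨a, ha, rfl⟩
    rw [dist_comap_val hΓ, hdA]
    by_contra hlt
    obtain ⟨p', hp', e⟩ := hB.order _ hp a a.2 (not_le.1 hlt)
    have h := eq_zero_of_lt_hitPos (row := rowsOf n ls v) hp'
    rw [rowsOf, e] at h
    exact ha h

theorem isLeast_entryUpTo (u v m : ℕ) :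
    IsLeast (insert n {k | ∃ w < m, InCluster n dl dA u w ∧ InCluster n dl dA v w ∧
      k = (dl (u * n + w) - 1) + (dl (v * n + w) - 1)}) (entryUpTo n dl dA u v m) := by
  induction m with
  | zero => simp [entryUpTo, isLeast_singleton]
  | succ m ih =>
    obtain ⟨h1, h2⟩ := ih
    rw [entryUpTo]
    constructor
    · have h1' : entryUpTo n dl dA u v m ∈ insert n {k | ∃ w < m + 1, InCluster n dl dA u w ∧
          InCluster n dl dA v w ∧ k = (dl (u * n + w) - 1) + (dl (v * n + w) - 1)} := by
        refine h1.imp id ?_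
        rintro ⟨w, hw, h⟩
        exact ⟨w, by omega, h⟩
      split_ifs with hc
      · rcases min_choice (entryUpTo n dl dA u v m) ((dl (u * n + m) - 1) + (dl (v * n + m) - 1))
          with e | e <;> rw [e]
        · exact h1'
        · exact Or.inr ⟨m, by omega, hc.1, hc.2, rfl⟩
      · exact h1'
    · rintro k (rfl | ⟨w, hw, ha, hb, rfl⟩)
      · have := h2 (Or.inl rfl)
        split_ifs <;> omega
      · rcases Nat.lt_succ_iff_lt_or_eq.1 hw with hw | rfl
        · have := h2 (Or.inr ⟨w, hw, ha, hb, rfl⟩)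
          split_ifs <;> omega
        · rw [if_pos ⟨ha, hb⟩]
          exact min_le_right _ _

theorem clusterEntry_centers (hΓ : ∀ u v, Γ.Adj u v → u < n) (hB : ∀ v < n, IsBall n s Γ ls dl v)
    (hp : ∀ v < n, hitPos A (rowsOf n ls v) s < s)
    (hdA : ∀ v < n, dA v = Γ.dist v (ls (v * n + hitPos A (rowsOf n ls v) s))) (u v : Fin n) :
    clusterEntry (Γ.comap Fin.val) (centers n A) u v = entryUpTo n dl dA u v n := by
  have hd : ∀ v : Fin n, distToSet (Γ.comap Fin.val) (centers n A) v = dA v := fun v =>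
    distToSet_centers hΓ (hB v v.2) (hp v v.2) (hdA v v.2)
  have hmem : ∀ u w : Fin n, u ∈ cluster (Γ.comap Fin.val) (centers n A) w ↔
      InCluster n dl dA u w := fun u w => by
    rw [inCluster_iff (hB u u.2) (hp u u.2) (hdA u u.2) w.2, ← hd, ← dist_comap_val hΓ]
    rfl
  have hdist : ∀ u w : Fin n, InCluster n dl dA u w →
      dl (u * n + w) - 1 = (Γ.comap Fin.val).dist u w := fun u w h => by
    rw [((hB u u.2).pred_dl w.2 h.1).1, dist_comap_val hΓ, Nat.add_sub_cancel]
  have hset : {k | ∃ w < n, InCluster n dl dA u w ∧ InCluster n dl dA v w ∧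
      k = (dl (u * n + w) - 1) + (dl (v * n + w) - 1)} =
      {k | ∃ w, u ∈ cluster (Γ.comap Fin.val) (centers n A) w ∧
        v ∈ cluster (Γ.comap Fin.val) (centers n A) w ∧
        k = (Γ.comap Fin.val).dist u w + (Γ.comap Fin.val).dist v w} := by
    ext k
    constructor
    · rintro ⟨w, hw, h1, h2, e⟩
      exact ⟨⟨w, hw⟩, (hmem u ⟨w, hw⟩).2 h1, (hmem v ⟨w, hw⟩).2 h2,
        e.trans (by rw [← hdist u ⟨w, hw⟩ h1, ← hdist v ⟨w, hw⟩ h2])⟩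
    · rintro ⟨w, h1, h2, e⟩
      rw [hmem] at h1 h2
      exact ⟨w, w.2, h1, h2, by rw [e, hdist u w h1, hdist v w h2]⟩
  rw [clusterEntry, ← hset, Nat.card_fin]
  exact (isLeast_entryUpTo u v n).csInf_eq

theorem ncard_cluster_centers_le (hΓ : ∀ u v, Γ.Adj u v → u < n)
    (hB : ∀ v < n, IsBall n s Γ ls dl v) (hp : ∀ v < n, hitPos A (rowsOf n ls v) s < s) (w : Fin n) :
    (cluster (Γ.comap Fin.val) (centers n A) w).ncard ≤ clusterSize n s (rowsOf n ls) A w := by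
  classical
  set dA : ℕ → ℕ := fun v => Γ.dist v (ls (v * n + hitPos A (rowsOf n ls v) s)) with hdA
  refine le_trans (le_of_eq ?_) (sum_inCluster_le hB hp (dA := dA) (fun _ _ => rfl) w.2)
  rw [← Fin.sum_univ_eq_sum_range (fun v => if InCluster n dl dA v w then 1 else 0),
    ← Finset.card_filter, ← Set.ncard_coe_finset]
  congr 1
  ext u
  simp only [Finset.coe_filter, Finset.mem_univ, true_and, Set.mem_ofPred_eq]
  rw [inCluster_iff (hB u u.2) (hp u u.2) rfl w.2, ← distToSet_centers hΓ (hB u u.2) (hp u u.2)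
    (dA := dA) rfl, ← dist_comap_val hΓ]
  rfl

theorem ncard_bunch_centers_le (hΓ : ∀ u v, Γ.Adj u v → u < n) {v : Fin n}
    (hB : IsBall n s Γ ls dl v) (hp : hitPos A (rowsOf n ls v) s < s) :
    (bunch (Γ.comap Fin.val) (centers n A) v).ncard ≤ s := by
  have h : ∀ w : Fin n, w ∈ bunch (Γ.comap Fin.val) (centers n A) v →
      ∃ p < s, ls (v * n + p) = w := by
    intro w hw
    have h1 : (Γ.comap Fin.val).dist v w < distToSet (Γ.comap Fin.val) (centers n A) v := hw
    rw [distToSet_centers hΓ hB hp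
      (dA := fun v => Γ.dist v (ls (v * n + hitPos A (rowsOf n ls v) s))) rfl,
      dist_comap_val hΓ] at h1
    obtain ⟨p', hp', e⟩ := hB.order _ hp w w.2 h1
    exact ⟨p', by omega, e⟩
  choose! f hf using h
  have := Set.ncard_le_ncard_of_injOn (t := (Finset.range s : Set ℕ)) f
    (fun w hw => by simpa using (hf w hw).1)
    (fun a ha b hb e => Fin.ext (by rw [← (hf a ha).2, ← (hf b hb).2, e]))
    (Finset.finite_toSet _)
  simpa [Set.ncard_coe_finset] using this

/-- The program computes with truncated subtraction, which differs from the integer formula only at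
negative values, for instance at the entry `-1` of two distinct centers. The diagonal entries `0`
make the estimate nonnegative, so the maximum is not affected. -/
theorem cast_eq_diamEstimate {G H : SimpleGraph (Fin n)} {A : Set (Fin n)} (hG : G.Connected)
    (hH : H.Connected) (hA : A.Nonempty) (f g : ℕ → ℕ → ℕ)
    (hf : ∀ u v : Fin n, (f u v : ℤ) = max (matrixEntry G A u v) 0)
    (hg : ∀ u : Fin n, u ∈ A → ∀ v : Fin n, g u v = H.dist u v)
    (hg0 : ∀ u : Fin n, u ∉ A → ∀ v : Fin n, g u v = 0) :
    ((max ((Finset.range n).sup fun u => (Finset.range n).sup fun v => f u v)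
      (((Finset.range n).sup fun u => (Finset.range n).sup fun v => g u v) - 2) : ℕ) : ℤ) =
      diamEstimate G H A := by
  refine eq_of_forall_ge_iff fun k => ?_
  rw [diamEstimate_le_iff hG hH hA]
  have hsup : ∀ (f : ℕ → ℕ → ℕ) (m : ℕ),
      ((Finset.range n).sup fun u => (Finset.range n).sup fun v => f u v) ≤ m ↔
        ∀ u v : Fin n, f u v ≤ m := by
    intro f m
    simp only [Finset.sup_le_iff, Finset.mem_range]
    exact ⟨fun h u v => h u u.2 v v.2, fun h u hu v hv => h ⟨u, hu⟩ ⟨v, hv⟩⟩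
  have key : ∀ m : ℕ, (max ((Finset.range n).sup fun u => (Finset.range n).sup fun v => f u v)
      (((Finset.range n).sup fun u => (Finset.range n).sup fun v => g u v) - 2) ≤ m ↔
      (∀ u v, matrixEntry G A u v ≤ m) ∧ ∀ a ∈ A, ∀ v, (H.dist a v : ℤ) ≤ m + 2) := by
    intro m
    rw [max_le_iff, tsub_le_iff_right, hsup, hsup]
    refine and_congr (forall₂_congr fun u v => ?_) (forall_congr' fun u => ?_)
    · have := hf u v
      omega
    · by_cases hu : u ∈ A
      · simp only [hg u hu, hu, true_imp_iff]
        exact forall_congr' fun v => by omega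
      · simp [hg0 u hu, hu]
  obtain ⟨a, ha⟩ := hA
  -- For negative `k` neither side holds: the left one is a natural number, and the right one fails
  -- at a diagonal entry.
  by_cases hk : 0 ≤ k
  · lift k to ℕ using hk
    rw [← key, Nat.cast_le]
  · refine ⟨fun h => ?_, fun h => ?_⟩
    · omega
    · have := h.1 a a
      rw [matrixEntry, if_pos rfl] at this
      omega

end Arrays

/-! ### The program -/

/-- The whole computation. -/
def mainCmd : Cmd :=
  sqrtCmd ;; logCmd ;; ballsCmd ;; roundsCmd ;; distCmd ;; matrixCmd ;; maxCmd ;; spannerCmd ;;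
    eccCmd ;; outputCmd

/-- Every stage costs at most a constant times `X = n * n * (Nat.log 2 n + 1)`; the successive
values of `T₂` are the budgets left for the remaining stages. The choice of centers and the searches
in the spanner are responsible for the two largest shares. -/
theorem spec_mainCmd {N n : ℕ} (hN : Big n N) (s : Store) (hn : s.reg r_n = n) (hn0 : 1 ≤ n)
    {Γ : SimpleGraph ℕ} (hΓ : IsMatrix n (s.arr a_adj) Γ)
    (hc : (Γ.comap (Fin.val : Fin n → ℕ)).Connected) (h0 : ∀ a ≠ 0, ∀ i, s.arr a i = 0) :
    Spec N mainCmd s (n * n * (Nat.log 2 n + 1) * 60000) (fun s' =>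
      ∃ (A : Set (Fin n)) (H : SimpleGraph (Fin n)), A.Nonempty ∧
        (∀ w, (cluster (Γ.comap Fin.val) A w).ncard ^ 2 ≤ 16 * n) ∧
        (∀ v, (bunch (Γ.comap Fin.val) A v).ncard ^ 2 ≤ 4 * n) ∧
        IsAdditiveSpanner 2 (Γ.comap Fin.val) H ∧
        (s'.reg 0 : ℤ) = diamEstimate (Γ.comap Fin.val) H A) := by
  have hre : ∀ u < n, ∀ v < n, Γ.Reachable u v := fun u hu v hv =>
    (reachable_comap_val hΓ.supp ⟨u, hu⟩ ⟨v, hv⟩).1 (hc.preconnected _ _)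
  set X := n * n * (Nat.log 2 n + 1) with hX
  have hX1 : n * n ≤ X := Nat.le_mul_of_pos_right _ (by omega)
  have hX2 : n ≤ n * n := Nat.le_mul_self n
  have hT : ∀ a b, n * (n * a + b) + 10 ≤ X * (a + b + 10) := by
    intro a b
    have e1 : n * (n * a + b) = n * n * a + n * b := by ring
    have e2 : n * n * a ≤ X * a := Nat.mul_le_mul_right a hX1
    have e3 : n * b ≤ X * b := Nat.mul_le_mul_right b (hX2.trans hX1)
    have e4 : X * (a + b + 10) = X * a + X * b + X * 10 := by ring
    omega
  have hT' : ∀ a, n * n * a ≤ X * a := fun a => Nat.mul_le_mul_right a hX1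
  clear_value X
  refine Spec.le (Spec.seq (spec_sqrtCmd hN s hn hn0) (T₂ := X * 59800) ?_) (by omega)
  rintro s₁ ⟨hs0, hsn, hs1, hs4⟩ hF1
  obtain ⟨s₀, hs₀⟩ : ∃ s₀, s₁.reg r_s = s₀ := ⟨_, rfl⟩
  rw [hs₀] at hs0 hsn hs1 hs4
  have hn1 : s₁.reg r_n = n := (hF1.reg r_n rfl).trans hn
  have ha1 : ∀ a, s₁.arr a = s.arr a := fun a => hF1.arr a rfl
  refine Spec.le (Spec.seq (spec_logCmd hN s₁ hn1 hn0 (hs₀ ▸ hsn)) (T₂ := X * 59600) ?_) (by omega)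
  rintro s₂ ⟨hL1, hL2, hth⟩ hF2
  obtain ⟨L, hL⟩ : ∃ L, s₂.reg r_L = L := ⟨_, rfl⟩
  rw [hL] at hL1 hL2 hth
  rw [hs₀] at hth
  -- From `2 ^ L ≤ 2 * n` follows `L ≤ Nat.log 2 n + 1`.
  have hLX : n * n * L ≤ X := by
    rw [hX]
    refine Nat.mul_le_mul_left _ ?_
    have := (Nat.le_log_iff_pow_le (b := 2) one_lt_two (by omega)).2 hL2
    rwa [mul_comm, Nat.log_mul_base one_lt_two (by omega)] at this
  have hn2 : s₂.reg r_n = n := (hF2.reg r_n rfl).trans hn1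
  have hs2 : s₂.reg r_s = s₀ := (hF2.reg r_s rfl).trans hs₀
  have ha2 : ∀ a, s₂.arr a = s.arr a := fun a => (hF2.arr a rfl).trans (ha1 a)
  refine Spec.le (Spec.seq (spec_ballsCmd hN s₂ hn2 ((ha2 a_adj).symm ▸ hΓ) hre s₀ hs2 hs0 hsn hs4
    (fun i _ => by rw [ha2]; exact h0 _ (by decide) i)) (T₂ := X * 58000) ?_)
    (by have := hT' 1500; linarith)
  intro s₃ hB hF3
  have hn3 : s₃.reg r_n = n := (hF3.reg r_n rfl).trans hn2
  have hs3 : s₃.reg r_s = s₀ := (hF3.reg r_s rfl).trans hs2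
  have hL3 : s₃.reg r_L = L := (hF3.reg r_L rfl).trans hL
  have hth3 : s₃.reg r_th = s₀ * 2 ^ L := (hF3.reg r_th rfl).trans hth
  set ls := s₃.arr a_ls with hls
  set dl := s₃.arr a_dl with hdl
  have hrows : IsRows n s₀ (rowsOf n ls) := ⟨fun v hv => (hB v hv).lt, fun v hv => (hB v hv).inj⟩
  refine Spec.le (Spec.seq (spec_roundsCmd hN s₃ hn3 hs3 hL3 hs0 hsn hs1 hs4 hL1 hL2 hrows
    (fun x => by rw [hF3.arr a_in rfl, ha2]; exact h0 _ (by decide) x)) (T₂ := X * 37900) ?_)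
    (by have := Nat.mul_le_mul_right 20000 hLX; linarith)
  intro s₄ hA hF4
  set A := s₄.arr a_in with hA'
  have hn4 : s₄.reg r_n = n := (hF4.reg r_n rfl).trans hn3
  have hs4' : s₄.reg r_s = s₀ := (hF4.reg r_s rfl).trans hs3
  have hls4 : s₄.arr a_ls = ls := hF4.arr a_ls rfl
  have hdl4 : s₄.arr a_dl = dl := hF4.arr a_dl rfl
  refine Spec.le (Spec.seq (spec_distCmd hN s₄ hn4 hs4' hsn (by rw [hls4, hdl4]; exact hB) hA.le_one
    (by rw [hls4]; exact hA.hit)) (T₂ := X * 37600) ?_) (by have := hT 120 60; omega)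
  rw [hls4]
  intro s₅ hdA hF5
  set dA := s₅.arr a_dA with hdA'
  have hn5 : s₅.reg r_n = n := (hF5.reg r_n rfl).trans hn4
  have hdl5 : s₅.arr a_dl = dl := (hF5.arr a_dl rfl).trans hdl4
  have bdl : ∀ u < n, ∀ v < n, dl (u * n + v) ≤ n := by
    intro u hu v hv
    by_cases hz : dl (u * n + v) = 0
    · omega
    · have := (hB u hu).pred_dl hv hz
      omega
  have bdA : ∀ u < n, dA u ≤ n := by
    intro u hu
    rw [hdA u hu]
    have h1 := hA.hit u hu
    exact ((hB u hu).dist_le _ h1).trans (h1.le.trans hsn)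
  refine Spec.le (Spec.seq (spec_matrixCmd hN s₅ hn5 hn0 (by rw [hdl5]; exact bdl) bdA ?_)
    (T₂ := X * 33800) ?_) (by have := hT' 3700; linarith)
  · intro w hw
    rw [hdl5]
    have h1 := sum_inCluster_le hB hA.hit hdA hw
    exact (Nat.mul_le_mul h1 h1).trans (not_lt.1 (hA.small w))
  rw [hdl5]
  intro s₆ hM hF6
  have hn6 : s₆.reg r_n = n := (hF6.reg r_n rfl).trans hn5
  have hdA6 : s₆.arr a_dA = dA := hF6.arr a_dA rfl
  refine Spec.le (Spec.seq (spec_maxCmd hN s₆ hn6 hn0 (by rw [hdA6]; exact bdA))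
    (T₂ := X * 33500) ?_) (by have := hT' 200; omega)
  rw [hdA6]
  intro s₇ hd7 hF7
  have hn7 : s₇.reg r_n = n := (hF7.reg r_n rfl).trans hn6
  have hth7 : s₇.reg r_th = s₀ * 2 ^ L := (hF7.reg r_th rfl).trans ((hF6.reg r_th rfl).trans
    ((hF5.reg r_th rfl).trans ((hF4.reg r_th rfl).trans hth3)))
  have hL7 : s₇.reg r_L = L := (hF7.reg r_L rfl).trans ((hF6.reg r_L rfl).trans
    ((hF5.reg r_L rfl).trans ((hF4.reg r_L rfl).trans hL3)))
  have hA7 : s₇.arr a_in = A := (hF7.arr a_in rfl).trans ((hF6.arr a_in rfl).trans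
    (hF5.arr a_in rfl))
  have hadj7 : s₇.arr a_adj = s.arr a_adj := (hF7.arr a_adj rfl).trans ((hF6.arr a_adj rfl).trans
    ((hF5.arr a_adj rfl).trans ((hF4.arr a_adj rfl).trans ((hF3.arr a_adj rfl).trans (ha2 _)))))
  have hmk7 : s₇.arr a_mk = s.arr a_mk := (hF7.arr a_mk rfl).trans ((hF6.arr a_mk rfl).trans
    ((hF5.arr a_mk rfl).trans ((hF4.arr a_mk rfl).trans ((hF3.arr a_mk rfl).trans (ha2 _)))))
  have hH7 : s₇.arr a_H = s.arr a_H := (hF7.arr a_H rfl).trans ((hF6.arr a_H rfl).trans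
    ((hF5.arr a_H rfl).trans ((hF4.arr a_H rfl).trans ((hF3.arr a_H rfl).trans (ha2 _)))))
  refine Spec.le (Spec.seq (spec_spannerCmd hN s₇ hn7 Γ (hadj7 ▸ hΓ) s₀ L hth7 hL7 hs0 hs1 hL1.le
    hn0 (fun x _ => by rw [hmk7]; exact h0 _ (by decide) x)
    (fun i _ => by rw [hH7]; exact h0 _ (by decide) i)) (T₂ := X * 30000) ?_) (by
      have e1 := Nat.mul_le_mul_right 2520 hLX
      have e2 := hT' 130
      have e3 : n * n * (2520 * L + 130) = n * n * L * 2520 + n * n * 130 := by ring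
      omega)
  rintro s₈ ⟨H, hHm, hHΓ, hHd, hHc⟩ hF8
  have hn8 : s₈.reg r_n = n := (hF8.reg r_n rfl).trans hn7
  have hA8 : s₈.arr a_in = A := (hF8.arr a_in rfl).trans hA7
  have hd8 : s₈.reg r_d = s₇.reg r_d := hF8.reg r_d rfl
  have hsp : IsAdditiveSpanner 2 (Γ.comap Fin.val) (H.comap (Fin.val : Fin n → ℕ)) := by
    refine ⟨fun u v h => hHΓ h, fun u v => ?_⟩
    rw [edist_comap_val hHm.supp, edist_comap_val hΓ.supp]
    exact hHd u v
  have hHre : ∀ u < n, ∀ v < n, H.Reachable u v := fun u hu v hv =>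
    (reachable_comap_val hHm.supp ⟨u, hu⟩ ⟨v, hv⟩).1 ((hsp.connected hc).preconnected _ _)
  refine Spec.le (Spec.seq (spec_eccCmd hN s₈ hn8 hn0 hHm hHre hHc (by rw [hA8]; exact hA.le_one)
    (R := 2 * s₀ * (2 * L + 1)) (by rw [hA8]; exact hA.card)) (T₂ := 40) ?_) (by
      -- At most `6 * s₀ * L` searches, each with `O(n * s₀)` steps in the sparse spanner, amount to
      -- `O(n * n * L)` because `s₀ * s₀ ≤ 4 * n`.
      have hL0 : 1 ≤ L := by
        by_contra h
        obtain rfl : L = 0 := by omega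
        simp at hL1
        omega
      have e1 : 2 * s₀ * (2 * L + 1) ≤ 6 * s₀ * L := by
        have : s₀ ≤ s₀ * L := Nat.le_mul_of_pos_right _ hL0
        have : 2 * s₀ * (2 * L + 1) = 4 * (s₀ * L) + 2 * s₀ := by ring
        have : 6 * s₀ * L = 6 * (s₀ * L) := by ring
        omega
      have e2 : 180 * n + 120 * (6 * n * s₀) + 150 ≤ 1050 * (n * s₀) := by
        have : n ≤ n * s₀ := Nat.le_mul_of_pos_right _ hs0
        have : 120 * (6 * n * s₀) = 720 * (n * s₀) := by ring
        omega
      have e3 := Nat.mul_le_mul e1 e2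
      have e4 : 6 * s₀ * L * (1050 * (n * s₀)) = 6300 * (n * L) * (s₀ * s₀) := by ring
      have e5 : 6300 * (n * L) * (s₀ * s₀) ≤ 6300 * (n * L) * (4 * n) := Nat.mul_le_mul_left _ hs4
      have e6 : 6300 * (n * L) * (4 * n) = n * n * L * 25200 := by ring
      have e7 := Nat.mul_le_mul_right 25200 hLX
      have e8 := hT' 300
      linarith)
  rw [hA8]
  intro s₉ he9 hF9
  have hd9 : s₉.reg r_d = s₈.reg r_d := hF9.reg r_d rfl
  refine (spec_outputCmd hN s₉).mono le_rfl ?_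
  intro s' h' _
  rw [hd9, hd8, hd7, he9] at h'
  have hdist : ∀ v : Fin n, distToSet (Γ.comap Fin.val) (centers n A) v = dA v := fun v =>
    distToSet_centers hΓ.supp (hB v v.2) (hA.hit v v.2) (hdA v v.2)
  have hne : (centers n A).Nonempty :=
    ⟨⟨_, (hB 0 hn0).lt _ (hA.hit 0 hn0)⟩, ne_zero_at_hitPos (hA.hit 0 hn0)⟩
  refine ⟨centers n A, H.comap Fin.val, hne, fun w => ?_, fun v => ?_, hsp, ?_⟩
  · rw [sq]
    have h1 := ncard_cluster_centers_le hΓ.supp hB hA.hit w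
    exact (Nat.mul_le_mul h1 h1).trans (not_lt.1 (hA.small w))
  · rw [sq]
    have h1 := ncard_bunch_centers_le hΓ.supp (hB v v.2) (hA.hit v v.2)
    exact (Nat.mul_le_mul h1 h1).trans hs4
  · rw [h', ← cast_eq_diamEstimate hc (hsp.connected hc) hne
      (fun u v => finalEntry n (s₆.arr a_M) dA u v) (fun u v => if A u = 0 then 0 else H.dist u v)]
    · congr 4
      funext v
      split_ifs
      · exact (Finset.sup_bot _).symm
      · rfl
    · intro u v
      rw [matrixEntry, finalEntry, hM u u.2 v v.2,
        ← clusterEntry_centers hΓ.supp hB hA.hit hdA, hdist, hdist, Nat.card_fin]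
      simp only [Fin.ext_iff]
      split_ifs <;> omega
    · intro u hu v
      rw [if_neg hu, dist_comap_val hHm.supp]
    · intro u hu v
      exact if_pos (not_not.1 hu)

/-! ### The main theorem -/

/-- Ten sizes pay for the factor `1000 ≤ 2 ^ 10` and three for the cube of `n + 1 ≤ 2 ^ n.size`. -/
theorem big_of_size {n : ℕ} (hn : 1 ≤ n) : Big n (2 ^ (13 * n.size)) := by
  have h1 : n + 1 ≤ 2 ^ n.size := Nat.lt_size_self n
  have h2 : 1 ≤ n.size := Nat.size_pos.2 hn
  calc 1000 * (n + 1) ^ 3 ≤ 2 ^ (10 * n.size) * (2 ^ n.size) ^ 3 := by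
        refine Nat.mul_le_mul ?_ (Nat.pow_le_pow_left h1 3)
        calc 1000 ≤ 2 ^ 10 := by norm_num
          _ ≤ 2 ^ (10 * n.size) := Nat.pow_le_pow_right two_pos (by omega)
    _ = 2 ^ (13 * n.size) := by rw [← pow_mul, ← pow_add]; congr 1; ring

/-- Multiplied by `log 2`, both terms on the left are at most `log (n + 1)`, and `2 / log 2 < 4`. -/
theorem log_add_one_le {n : ℕ} (hn : 1 ≤ n) : (Nat.log 2 n : ℝ) + 1 ≤ 4 * Real.log (n + 1) := by
  have hn' : (1 : ℝ) ≤ n := by exact_mod_cast hn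
  have h1 : (Nat.log 2 n : ℝ) * Real.log 2 ≤ Real.log (n + 1) := by
    rw [← Real.log_pow]
    refine Real.log_le_log (by positivity) ?_
    have : (2 ^ Nat.log 2 n : ℝ) ≤ n := by exact_mod_cast Nat.pow_log_le_self 2 (by omega)
    linarith
  have h2 : Real.log 2 ≤ Real.log (n + 1) := Real.log_le_log two_pos (by linarith)
  have h3 := Real.log_two_gt_d9
  have h4 : (0 : ℝ) ≤ Nat.log 2 n := Nat.cast_nonneg _
  nlinarith

theorem isMatrix_graphInput {n : ℕ} (G : SimpleGraph (Fin n)) :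
    IsMatrix n ((graphInput G).arr 0) (G.map Fin.valEmbedding) := by
  classical
  constructor
  · intro u hu v hv
    have : (∃ u' v' : Fin n, G.Adj u' v' ∧ u * n + v = u' * n + v') ↔
        (G.map Fin.valEmbedding).Adj u v := by
      rw [SimpleGraph.map_adj]
      refine exists₂_congr fun u' v' => and_congr_right fun _ => ?_
      rw [idx_inj hv v'.2]
      exact and_congr eq_comm eq_comm
    simp only [graphInput, true_and, this]
    congr
  · intro u v h
    obtain ⟨u', _, _, rfl, _⟩ := (SimpleGraph.map_adj _ _ _ _).1 h
    exact u'.2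

theorem le_mul_sqrt_of_sq_le {m k n : ℕ} (h : m ^ 2 ≤ k ^ 2 * n) : (m : ℝ) ≤ k * √n := by
  have h' : (m : ℝ) ^ 2 ≤ k ^ 2 * n := by exact_mod_cast h
  rw [← pow_le_pow_iff_left₀ (Nat.cast_nonneg m) (by positivity) two_ne_zero, mul_pow,
    Real.sq_sqrt (Nat.cast_nonneg n)]
  exact h'

theorem mainTheorem11 :
    ∃ (p : Prog) (c : ℕ) (C : ℝ), 0 < c ∧
      ∀ (n : ℕ) (G : SimpleGraph (Fin n)), G.Connected →
        expectedTime (c * n.size) p (graphInput G) ≤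
            ENNReal.ofReal (C * (n : ℝ) ^ 2 * Real.log (n + 1)) ∧
        ∀ D' : ℕ, CanReturn (c * n.size) p (graphInput G) D' →
          (∃ (A : Set (Fin n)) (H : SimpleGraph (Fin n)),
            IsCenterSet C G A ∧ IsAdditiveSpanner 2 G H ∧ (D' : ℤ) = diamEstimate G H A) ∧
          D' ≤ G.diam ∧
          ∀ h z : ℕ, G.diam = 3 * h + z →
            (z = 0 ∨ z = 1 → 2 * (h : ℤ) - 1 ≤ D') ∧ (z = 2 → 2 * (h : ℤ) ≤ D') := by
  -- The factor `13` comes from `big_of_size`, and `240000 = 60000 * 4` combines the time bound with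
  -- `log_add_one_le`. The same constant serves for the bunches, where `2` would do.
  refine ⟨mainCmd.code 0, 13, 240000, by norm_num, fun n G hG => ?_⟩
  have hne := hG.nonempty
  have hn0 : 1 ≤ n := Fin.pos_iff_nonempty.2 hne
  have hN := big_of_size hn0
  have hcomap : (G.map Fin.valEmbedding).comap (Fin.val : Fin n → ℕ) = G :=
    SimpleGraph.comap_map_eq Fin.valEmbedding G
  have hspec := spec_mainCmd hN (graphInput G) (by simp [graphInput]) hn0 (isMatrix_graphInput G)
    (by rwa [hcomap]) (fun a ha i => by simp [graphInput, ha])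
  rw [hcomap] at hspec
  -- The input store represents itself although variables sit in even registers: register `0`
  -- corresponds to itself, and all others are `0`.
  obtain ⟨t, ht, s', σ', hruns, hreg, A, H, hA, hcl, hbu, hH, hD⟩ := hspec.runs hN.one_lt
    ⟨fun x => by
      simp only [graphInput]
      split_ifs
      exacts [hN.lin (by omega), hN.zero_lt], fun a i => by
      simp only [graphInput]
      split_ifs
      exacts [hN.one_lt, hN.zero_lt]⟩ (graphInput G)
    ⟨fun x => by simp [graphInput], rfl⟩
  refine ⟨(expectedTime_le_of_runs hruns).trans ?_, fun D' hD' => ?_⟩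
  · rw [← ENNReal.ofReal_natCast]
    refine ENNReal.ofReal_le_ofReal ?_
    calc (t : ℝ) ≤ ((n * n * (Nat.log 2 n + 1) * 60000 : ℕ) : ℝ) := by exact_mod_cast ht
      _ = 60000 * (n : ℝ) ^ 2 * ((Nat.log 2 n : ℝ) + 1) := by push_cast; ring
      _ ≤ 60000 * (n : ℝ) ^ 2 * (4 * Real.log (n + 1)) :=
          mul_le_mul_of_nonneg_left (log_add_one_le hn0) (by positivity)
      _ = 240000 * (n : ℝ) ^ 2 * Real.log (n + 1) := by ring
  · have hD'' : (D' : ℤ) = diamEstimate G H A := by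
      rw [← hD, ← hD'.eq_of_runs hruns, hreg]
    refine ⟨⟨A, H, ⟨hA, fun w => ?_, fun v => ?_⟩, hH, hD''⟩, ?_, fun h z hz => ?_⟩
    · rw [Nat.card_fin]
      exact_mod_cast le_mul_sqrt_of_sq_le (k := 4) (n := n) ((hcl w).trans_eq (by norm_num))
    · rw [Nat.card_fin]
      refine (le_mul_sqrt_of_sq_le (k := 2) (n := n) ((hbu v).trans_eq (by norm_num))).trans ?_
      exact mul_le_mul_of_nonneg_right (by norm_num) (Real.sqrt_nonneg _)
    · have := diamEstimate_le_diam hG hH hA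
      omega
    · rw [hD'']
      exact le_diamEstimate hG hH hA hz
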